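/- **Setting.** Let $M>0$, $0<r_0\le 2M$, $1<p<1+\sqrt2$, and consider the Schwarzschild metric $ds^2=-(1-\frac{2M}r)dv^2+2\,dv\,dr+r^2d\omega^2$ on $r>r_0$; for $r>2M$, with $r^*=r+2M\ln(r-2M)$ and $v=t+r^*$, it equals $-(1-\frac{2M}r)dt^2+(1-\frac{2M}r)^{-1}dr^2+r^2d\omega^2$. Let $\tilde v=v-h(r)$ be a time function with $h$ smooth on $(r_0,\infty)$, such that the slices of constant $\tilde v$ are uniformly space-like, $\tilde v=t$ for large $r$, and $\tilde v\le t+\text{const}$ on $r>2M$. Let $\tilde T$ be a smooth uniformly time-like vector field along $\{\tilde v=0\}$, equal to $\partial_t$ for large $r$. Use $x=r\omega\in\mathbb R^3$ as spatial coordinate. Let $F_p:\mathbb R\to\mathbb R$ satisfy $F_p(u)=u^p$ for $u>0$, be $C^{[p]}$ away from $0$, and satisfy $\sum_{0\le j\le[p]}|u|^j|\partial_u^jF_p(u)|\le C_F|u|^p$ for some $C_F$ (for instance $F_p(u)=|u|^p$ or the focusing $F_p(u)=|u|^{p-1}u$). Consider $$\Box u+F_p(u)=0,\qquad u|_{\tilde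 v=0}=u_0,\quad \tilde Tu|_{\tilde v=0}=u_1,\qquad u_0,u_1\in C_c^\infty(\{r>r_0\}).\tag{1}$$ A solution in a region of $\{\tilde v\ge0\}$ is a $C^1$ function there (up to $\tilde v=0$) that takes the data and satisfies the equation in the sense of distributions; the problem is well-posed in the region for given data if it has one and only one solution there. The lifespan $T_*(u_0,u_1)$ is the supremum of all $T>0$ such that (1) is well-posed in $(\tilde v,r,\omega)\in[0,T)\times(r_0,\infty)\times\mathbb S^2$. Fix $R>3M$ and a smooth $\psi$ on $\mathbb R$ with $\psi=0$ for $r<1$ and $\psi=1$ for $r>2$; put $\psi_R(r)=\psi(r/R)$, $\phi_R=1-\psi_{2R}$, $s_d=\frac12-\frac1p$, and $$\|(u_0,u_1)\|_X=\|\phi_R(u_0,u_1)\|_{H^3\times H^2}+\sum_{|\gamma|\le2}\|\psi_R(\nabla,\Omega)^\gamma(\nabla u_0,u_1)\|_{L^2\cap\dot H^{s_d-1}},$$ where $\Omega$ are the rotation vector fields. Let $T_*(\varepsilon)=\inf\{T_*(u_0,u_1):\|(u_0,u_1)\|_X\le\varepsilon\}$, the infimum being over $u_0,u_1\in C_c^\infty(\{r>r_0\})$.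 For small $\mu\ge0$ put $$N_\mu=\frac{p(p-1)}{1+2p-p^2-\mu},\qquad \alpha_\mu=\frac2{p-1}-1-\frac{\mu}{p(p-1)}.$$ **Theorem 1.1.** There is $\varepsilon_0\in(0,1)$ with $\varepsilon_0<1+2p-p^2$ such that $$T_*(\varepsilon)\le C\,\varepsilon^{-\frac{p(p-1)}{1+2p-p^2}}\quad\text{for all }\varepsilon\in(0,\varepsilon_0),\qquad C=3\,\varepsilon_0^{-\frac{p(p-1)}{1+2p-p^2}}.$$ Moreover there are $0<\theta_0<\theta_1<1$ such that for all $\varepsilon,\mu\in(0,\varepsilon_0)$, with $L=\varepsilon^{-N_\mu}$, there are radial $u_0,u_1\in C_c^\infty(\{r>r_0\})$, vanishing outside $\{L/2\le r\le20L\}$, with $$u_0=\varepsilon_0^{-\theta_0}r^{-\alpha_\mu-1},\quad u_1=\varepsilon_0^{-\theta_1}r^{-\alpha_\mu-2}\quad\text{for }r\in[L,10L],\qquad \|(u_0,u_1)\|_X\le\varepsilon_0^{-1}\varepsilon,$$ for which $T_*(u_0,u_1)\le3L$. The blow-up takes place along the outgoing null cone $r^*-\tilde v=2L$: if $T>0$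 and $u$ is a spherically symmetric solution of (1) in the region $\{0\le\tilde v<T,\ r>2M,\ r^*-\tilde v>2L,\ r^*+\tilde v<10L\}$ outside this cone, then $u>0$ there and $T\le3L$. -/

import Mathlib

open MeasureTheory Set
open scoped ENNReal FourierTransform

namespace SchwarzschildWave

/-- Euclidean 3-space, with `x = r ω`, `r = ‖x‖`. -/
abbrev E3 : Type := EuclideanSpace ℝ (Fin 3)

/-- Coordinates `(s, x)` on space-time: `s` is the time function, `x = r ω`. -/
abbrev ST : Type := ℝ × E3

/-- Standard basis vector of `E3`. -/
noncomputable def e (i : Fin 3) : E3 := EuclideanSpace.single i 1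

/-! ### The Schwarzschild metric in horizon-penetrating coordinates -/

/-- `1 - 2M/r`. -/
noncomputable def lapse (M r : ℝ) : ℝ := 1 - 2 * M / r

/-- The tortoise coordinate `r* = r + 2M log (r - 2M)`, for `r > 2M`. -/
noncomputable def rStar (M r : ℝ) : ℝ := r + 2 * M * Real.log (r - 2 * M)

/-- The radial component `dr (X)` of a vector. -/
noncomputable def radial (x : E3) (X : ST) : ℝ := inner ℝ x X.2 / ‖x‖

/-- `dv (X)`, where `v = t + r*` is the advanced time and the time coordinate is `s = v - h(r)`. -/
noncomputable def advanced (h : ℝ → ℝ) (x : E3) (X : ST) : ℝ :=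
  X.1 + deriv h ‖x‖ * radial x X

/-- The Schwarzschild metric `-(1 - 2M/r) dv² + 2 dv dr + r² dω²` in the coordinates `(s, x)`,
`s = v - h(r)`. Here `r² dω² = |dx|² - dr²`. For `r > 2M` and with `v = t + r*` it is
`-(1 - 2M/r) dt² + (1 - 2M/r)⁻¹ dr² + r² dω²`, and `s = t` where `h = r*`. -/
noncomputable def metric (M : ℝ) (h : ℝ → ℝ) (x : E3) (X Y : ST) : ℝ :=
  -(lapse M ‖x‖) * advanced h x X * advanced h x Y
    + advanced h x X * radial x Y + radial x X * advanced h x Y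
    + (inner ℝ X.2 Y.2 - radial x X * radial x Y)

/-- The radial component `ω (∂_r)` of a covector. -/
noncomputable def coradial (x : E3) (ω : ST →L[ℝ] ℝ) : ℝ := ω (0, ‖x‖⁻¹ • x)

/-- The inverse metric `g^{αβ} ω_α η_β` on covectors, see `metric_inverse`. -/
noncomputable def cometric (M : ℝ) (h : ℝ → ℝ) (x : E3) (ω η : ST →L[ℝ] ℝ) : ℝ :=
  -(deriv h ‖x‖ * (2 - lapse M ‖x‖ * deriv h ‖x‖)) * ω (1, 0) * η (1, 0)
    + (1 - lapse M ‖x‖ * deriv h ‖x‖) * (ω (1, 0) * coradial x η + coradial x ω * η (1, 0))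
    + lapse M ‖x‖ * coradial x ω * coradial x η
    + (∑ i, ω (0, e i) * η (0, e i) - coradial x ω * coradial x η)

theorem covector_apply (ω : ST →L[ℝ] ℝ) (Y : ST) :
    ω Y = Y.1 * ω (1, 0) + ∑ i, Y.2 i * ω (0, e i) := by
  have h2 : Y.2 = ∑ i, Y.2 i • e i := by
    ext j
    fin_cases j <;> simp [e, Fin.sum_univ_three]
  have h1 : Y = Y.1 • ((1 : ℝ), (0 : E3)) + ∑ i, Y.2 i • ((0 : ℝ), e i) := by
    ext1
    · simp [Prod.fst_sum]
    · simpa [Prod.snd_sum] using h2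
  conv_lhs => rw [h1]
  rw [map_add, map_sum, map_smul, smul_eq_mul]
  simp only [map_smul, smul_eq_mul]

/-- `cometric` is the inverse of `metric`: every covector `ω` has a metric dual vector, on which
every covector `η` takes the value `cometric ω η`. -/
theorem metric_inverse (M : ℝ) (h : ℝ → ℝ) (x : E3) (hx : x ≠ 0) (ω : ST →L[ℝ] ℝ) :
    ∃ X : ST, (∀ Y, metric M h x X Y = ω Y) ∧ ∀ η, η X = cometric M h x ω η := by
  have hr : ‖x‖ ≠ 0 := norm_ne_zero_iff.mpr hx
  have hn : ‖x‖ ^ 2 = x 0 ^ 2 + x 1 ^ 2 + x 2 ^ 2 := by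
    rw [EuclideanSpace.norm_sq_eq]
    simp [Fin.sum_univ_three]
  have hco : ∀ η : ST →L[ℝ] ℝ, coradial x η
      = ‖x‖⁻¹ * (x 0 * η (0, e 0) + x 1 * η (0, e 1) + x 2 * η (0, e 2)) := by
    intro η
    rw [coradial, covector_apply η]
    simp [Fin.sum_univ_three]
    ring
  set b := (1 - lapse M ‖x‖ * deriv h ‖x‖) * ω (1, 0) + (lapse M ‖x‖ - 1) * coradial x ω with hb
  set X : E3 := !₂[b * ‖x‖⁻¹ * x 0 + ω (0, e 0), b * ‖x‖⁻¹ * x 1 + ω (0, e 1),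
    b * ‖x‖⁻¹ * x 2 + ω (0, e 2)] with hX
  have hrad : ∀ s : ℝ, radial x (s, X) = b + coradial x ω := by
    intro s
    rw [hco]
    simp only [radial, PiLp.inner_apply, Fin.sum_univ_three, hX]
    simp
    field_simp
    linear_combination (-b) * hn
  have hin : ∀ s : ℝ, ∀ Y : ST, inner ℝ X Y.2 = b * radial x (s, Y.2) + ∑ i, Y.2 i * ω (0, e i) := by
    intro s Y
    simp only [radial, PiLp.inner_apply, Fin.sum_univ_three, hX]
    simp
    field_simp
    ring
  refine ⟨(-(deriv h ‖x‖ * (2 - lapse M ‖x‖ * deriv h ‖x‖)) * ω (1, 0)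
      + (1 - lapse M ‖x‖ * deriv h ‖x‖) * coradial x ω, X), ?_, ?_⟩
  · intro Y
    rw [covector_apply ω Y]
    simp only [metric, advanced, hrad, hin Y.1 Y, hb]
    ring
  · intro η
    rw [covector_apply η]
    simp only [cometric, hb, hX, hco, Fin.sum_univ_three]
    simp
    ring

/-- The volume density is `√|det g| = 1` in the coordinates `(s, x)`: the Gram determinant in the
coordinate basis is `-1`. -/
theorem metric_det (M : ℝ) (h : ℝ → ℝ) (x : E3) (hx : x ≠ 0) :
    (Matrix.of fun a b : Fin 4 => metric M h x
      ((Fin.cons (1, 0) (fun i => (0, e i)) : Fin 4 → ST) a)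
      ((Fin.cons (1, 0) (fun i => (0, e i)) : Fin 4 → ST) b)).det = -1 := by
  have hr : ‖x‖ ≠ 0 := norm_ne_zero_iff.mpr hx
  have hn : ‖x‖ ^ 2 = x 0 ^ 2 + x 1 ^ 2 + x 2 ^ 2 := by
    rw [EuclideanSpace.norm_sq_eq]
    simp [Fin.sum_univ_three]
  have he : ∀ i j : Fin 3, inner ℝ (e i) (e j) = if i = j then (1 : ℝ) else 0 := by
    intro i j
    simp [e, EuclideanSpace.inner_single_left]
  have hxe : ∀ i : Fin 3, inner ℝ x (e i) = x i := by
    intro i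
    simp [e, EuclideanSpace.inner_single_right]
  set n : Fin 3 → ℝ := fun i => x i / ‖x‖ with hnd
  have hn1 : n 0 ^ 2 + n 1 ^ 2 + n 2 ^ 2 = 1 := by
    simp only [hnd]
    field_simp
    exact hn.symm
  have h00 : metric M h x (1, 0) (1, 0) = -lapse M ‖x‖ := by
    simp [metric, advanced, radial]
  have h0i : ∀ i, metric M h x (1, 0) (0, e i) = (1 - lapse M ‖x‖ * deriv h ‖x‖) * n i := by
    intro i
    simp [metric, advanced, radial, hxe, hnd]
    ring
  have hi0 : ∀ i, metric M h x (0, e i) (1, 0) = (1 - lapse M ‖x‖ * deriv h ‖x‖) * n i := by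
    intro i
    simp [metric, advanced, radial, hxe, hnd]
    ring
  have hij : ∀ i j, metric M h x (0, e i) (0, e j) =
      (2 * deriv h ‖x‖ - lapse M ‖x‖ * deriv h ‖x‖ ^ 2 - 1) * (n i * n j)
        + if i = j then 1 else 0 := by
    intro i j
    simp only [metric, advanced, radial, hxe, hnd, he]
    ring
  generalize lapse M ‖x‖ = f at *
  generalize deriv h ‖x‖ = k at *
  set q := 2 * k - f * k ^ 2 - 1 with hq
  have hmat : (Matrix.of fun a b : Fin 4 => metric M h x
      ((Fin.cons (1, 0) (fun i => (0, e i)) : Fin 4 → ST) a)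
      ((Fin.cons (1, 0) (fun i => (0, e i)) : Fin 4 → ST) b)) =
      !![-f, (1 - f * k) * n 0, (1 - f * k) * n 1, (1 - f * k) * n 2;
        (1 - f * k) * n 0, q * (n 0 * n 0) + 1, q * (n 0 * n 1), q * (n 0 * n 2);
        (1 - f * k) * n 1, q * (n 1 * n 0), q * (n 1 * n 1) + 1, q * (n 1 * n 2);
        (1 - f * k) * n 2, q * (n 2 * n 0), q * (n 2 * n 1), q * (n 2 * n 2) + 1] := by
    ext a b
    have e1 : (1 : Fin 4) = Fin.succ 0 := rfl
    have e2 : (2 : Fin 4) = Fin.succ 1 := rfl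
    have e3 : (3 : Fin 4) = Fin.succ 2 := rfl
    fin_cases a <;> fin_cases b <;> simp only [Matrix.of_apply, Fin.mk_zero, Fin.mk_one,
      Fin.reduceFinMk, e1, e2, e3, Fin.cons_zero, Fin.cons_succ, h00, h0i, hi0, hij] <;>
      simp [q, Fin.succ]
  rw [hmat, Matrix.det_succ_row_zero]
  simp [Fin.sum_univ_succ, Matrix.det_fin_three, Fin.succAbove]
  linear_combination (-f * (2 * k - f * k ^ 2 - 1) - (1 - f * k) ^ 2) * hn1

/-- The time function `s = v - h(r)` and the vector field `T` along `{s = 0}` of the Cauchy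
problem, on the region `r > r₀`. The slices are uniformly space-like, `T` is uniformly time-like,
and `s = t`, `T = ∂_t` near spatial infinity. By `regular`, i.e. `s ≤ t + C` for `r > 2M`, the slices
do not run into the past horizon (this is automatic if `r₀ < 2M`). -/
structure Foliation (M r₀ : ℝ) where
  height : ℝ → ℝ
  field : E3 → ST
  height_smooth : ContDiffOn ℝ (⊤ : ℕ∞) height (Ioi r₀)
  field_smooth : ContDiffOn ℝ (⊤ : ℕ∞) field {x | r₀ < ‖x‖}
  spacelike : ∃ c > 0, ∀ x : E3, r₀ < ‖x‖ →
    cometric M height x (ContinuousLinearMap.fst ℝ ℝ E3) (ContinuousLinearMap.fst ℝ ℝ E3) ≤ -c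
  timelike : ∃ c > 0, ∀ x : E3, r₀ < ‖x‖ → metric M height x (field x) (field x) ≤ -c
  regular : ∃ C, ∀ r > 2 * M, rStar M r - C ≤ height r
  far : ∃ R₁ > 2 * M, (∀ r ≥ R₁, height r = rStar M r) ∧ ∀ x : E3, R₁ ≤ ‖x‖ → field x = (1, 0)

/-! ### The Cauchy problem -/

/-- The nonlinearity behaves like `|u|^p`: `∑_{j ≤ [p]} |u|^j |F^{(j)}(u)| ≤ C |u|^p`.
(At `u = 0` this only says `F 0 = 0`.) -/
def PowerLike (p : ℝ) (F : ℝ → ℝ) : Prop :=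
  ContDiffOn ℝ (⌊p⌋₊ : ℕ) F {0}ᶜ ∧
  ∃ C : ℝ, ∀ u : ℝ, ∑ j ∈ Finset.range (⌊p⌋₊ + 1), |u| ^ j * |iteratedDeriv j F u| ≤ C * |u| ^ p

/-- Initial data in `C_c^∞ (r > r₀)`. -/
structure InitialData (r₀ : ℝ) where
  u₀ : E3 → ℝ
  u₁ : E3 → ℝ
  smooth₀ : ContDiff ℝ (⊤ : ℕ∞) u₀
  smooth₁ : ContDiff ℝ (⊤ : ℕ∞) u₁
  compact₀ : HasCompactSupport u₀
  compact₁ : HasCompactSupport u₁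
  supp₀ : tsupport u₀ ⊆ {x | r₀ < ‖x‖}
  supp₁ : tsupport u₁ ⊆ {x | r₀ < ‖x‖}

variable {M r₀ : ℝ}

/-- `u` is a solution of `□u + F(u) = 0`, `u = u₀` and `T u = u₁` on `{s = 0}`, in the space-time
region `D ⊆ {s ≥ 0}`: it is `C¹` on `D` (up to the initial surface), takes the data, and satisfies
the equation in the sense of distributions in the interior of `D`, i.e.
`∫ g^{αβ} ∂_α u ∂_β φ dV_g = ∫ F(u) φ dV_g` for all test functions `φ`. -/
def IsSolutionOn (Φ : Foliation M r₀) (F : ℝ → ℝ) (d : InitialData r₀) (D : Set ST)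
    (u : ST → ℝ) : Prop :=
  ContDiffOn ℝ 1 u D ∧
  (∀ x : E3, (0, x) ∈ D →
    u (0, x) = d.u₀ x ∧ fderivWithin ℝ u D (0, x) (Φ.field x) = d.u₁ x) ∧
  ∀ φ : ST → ℝ, ContDiff ℝ (⊤ : ℕ∞) φ → HasCompactSupport φ → tsupport φ ⊆ interior D →
    ∫ z : ST, (cometric M Φ.height z.2 (fderiv ℝ u z) (fderiv ℝ φ z) - F (u z) * φ z) = 0

/-- Well-posedness in the region `D` for given data: there is one and only one solution. -/
def WellPosedOn (Φ : Foliation M r₀) (F : ℝ → ℝ) (d : InitialData r₀) (D : Set ST) : Prop :=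
  ∃ u, IsSolutionOn Φ F d D u ∧ ∀ w, IsSolutionOn Φ F d D w → EqOn w u D

/-- The domain `[0, T) × (r₀, ∞) × S²`. -/
def cylinder (r₀ T : ℝ) : Set ST := {z | 0 ≤ z.1 ∧ z.1 < T ∧ r₀ < ‖z.2‖}

/-- The lifespan `T_*(u₀, u₁)`: the supremum of all `T > 0` for which the problem is well-posed in
`[0, T) × (r₀, ∞) × S²`. -/
noncomputable def lifespan (Φ : Foliation M r₀) (F : ℝ → ℝ) (d : InitialData r₀) : ℝ≥0∞ :=
  ⨆ (T : ℝ) (_ : 0 < T) (_ : WellPosedOn Φ F d (cylinder r₀ T)), ENNReal.ofReal T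

/-- The part of `[0, T) × (r > 2M)` that lies outside the outgoing null cone `r* - t = 2L` and
inside the incoming null cone `r* + t = 10L`. -/
def outgoingRegion (M L T : ℝ) : Set ST :=
  {z | 0 ≤ z.1 ∧ z.1 < T ∧ 2 * M < ‖z.2‖ ∧
    z.1 + 2 * L < rStar M ‖z.2‖ ∧ rStar M ‖z.2‖ + z.1 < 10 * L}

/-! ### The norm of the data -/

/-- The vector fields `∂_i` (left) and the rotations `x_i ∂_j - x_j ∂_i` (right). -/
noncomputable def vfield : Fin 3 ⊕ Fin 3 → E3 → E3
  | .inl i, _ => e i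
  | .inr k, x => x (k + 1) • e (k + 2) - x (k + 2) • e (k + 1)

/-- Iterated derivative of `f` along the vector fields in a list. -/
noncomputable def derivs : List (Fin 3 ⊕ Fin 3) → (E3 → ℝ) → E3 → ℝ
  | [], f => f
  | a :: w, f => fun x => fderiv ℝ (derivs w f) x (vfield a x)

/-- The norm of the inhomogeneous Sobolev space `H^k (ℝ³)`. -/
noncomputable def sobolevNorm (k : ℕ) (f : E3 → ℝ) : ℝ≥0∞ :=
  (∑ j ∈ Finset.range (k + 1), ∑ w : Fin j → Fin 3,
    eLpNorm (derivs (List.ofFn fun i => .inl (w i)) f) 2 volume ^ 2) ^ (1 / 2 : ℝ)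

/-- The norm of the homogeneous Sobolev space `Ḣ^s (ℝ³)`, through the Fourier transform. -/
noncomputable def homSobolevNorm (s : ℝ) (f : E3 → ℝ) : ℝ≥0∞ :=
  (∫⁻ ξ : E3, ENNReal.ofReal ((2 * Real.pi * ‖ξ‖) ^ (2 * s)) *
    ‖𝓕 (fun x : E3 => (f x : ℂ)) ξ‖ₑ ^ 2) ^ (1 / 2 : ℝ)

/-- The norm of `L² ∩ Ḣ^{s_d - 1}`, where `s_d = 1/2 - 1/p`. -/
noncomputable def capNorm (p : ℝ) (f : E3 → ℝ) : ℝ≥0∞ :=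
  eLpNorm f 2 volume + homSobolevNorm (1 / 2 - 1 / p - 1) f

/-- The norm `‖(u₀, u₁)‖_X = ‖φ_R (u₀, u₁)‖_{H³ × H²}
+ ∑_{|γ| ≤ 2} ‖ψ_R (∇, Ω)^γ (∇u₀, u₁)‖_{L² ∩ Ḣ^{s_d - 1}}`,
where `ψ_R (r) = ψ (r/R)` and `φ_R = 1 - ψ_{2R}`. -/
noncomputable def xNorm (p R : ℝ) (ψ : ℝ → ℝ) (d : InitialData r₀) : ℝ≥0∞ :=
  sobolevNorm 3 (fun x => (1 - ψ (‖x‖ / (2 * R))) * d.u₀ x)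
    + sobolevNorm 2 (fun x => (1 - ψ (‖x‖ / (2 * R))) * d.u₁ x)
    + ∑ j ∈ Finset.range 3, ∑ w : Fin j → Fin 3 ⊕ Fin 3,
      (∑ i, capNorm p (fun x => ψ (‖x‖ / R) * derivs (List.ofFn w) (derivs [.inl i] d.u₀) x)
        + capNorm p (fun x => ψ (‖x‖ / R) * derivs (List.ofFn w) d.u₁ x))

/-- The lifespan of the problem with size `ε`: the infimum of `T_*(u₀, u₁)` over the data with
`‖(u₀, u₁)‖_X ≤ ε`. -/
noncomputable def lifespanOfSize (p R : ℝ) (ψ : ℝ → ℝ) (Φ : Foliation M r₀) (F : ℝ → ℝ) (ε : ℝ) :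
    ℝ≥0∞ :=
  ⨅ (d : InitialData r₀) (_ : xNorm p R ψ d ≤ ENNReal.ofReal ε), lifespan Φ F d

/-! ### The exponents -/

/-- `N_μ = p(p-1) / (1 + 2p - p² - μ)`. -/
noncomputable def expN (p μ : ℝ) : ℝ := p * (p - 1) / (1 + 2 * p - p ^ 2 - μ)

/-- `α = 2/(p-1) - 1 - μ/(p(p-1))`. -/
noncomputable def expα (p μ : ℝ) : ℝ := 2 / (p - 1) - 1 - μ / (p * (p - 1))

end SchwarzschildWave

open SchwarzschildWave

open MeasureTheory Set
open scoped ENNReal FourierTransform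

namespace SchwarzschildWave

open Filter Topology

/-! For a radial solution u put w = r u. In the coordinates (t, r*) it satisfies (∂ₜ − ∂_{r*})(∂ₜ +
∂_{r*}) w = (1 − 2M/r)(r F(w/r) − 2M r⁻³ w). The region t + 2L < r* < 10L − t is the domain of
dependence of the data on 2L < r* < 10L, so nothing near the black hole matters. For large L one has
L < r < 10L there, the foliation is the standard one, and the potential term is negligible.

The function W(t) = 10 b L (3L − t)^{-k} with k = 2/(p−1) satisfies W'' ≤ right-hand side wherever w
≥ W (`profile_le_waveSource`). Integrating along incoming and then along outgoing characteristics
propagates w > W from the initial line (`lt_of_wave_comparison`). So u is positive, and since W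
blows up at t = 3L no solution passes that time (`blowup_outgoingRegion`).

Data a₀ r^{-α-1}, a₁ r^{-α-2} with α ≤ k − 1 start above W: W(0) is of order L^{1-k}, so it suffices
that a₀ is large and a₁ is large compared with a₀. Their X norm is O(L^{1/p−α}), because in
Ḣ^{s_d−1} a function of height L^{-α-2} on a ball of radius comparable to L has norm of order
L^{-α-2} L^{2+1/p} (`exists_xNorm_powerData_le`). For p > 1 the condition p < 1 + √2 says exactly
that 1/p < 2/(p−1) − 1. Hence L^{1/p−α} decays for small μ, and equating it with ε gives L =
ε^{-N_μ}.

Two points need care. Solutions are only C¹ and satisfy the equation as distributions.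
`weak_wave_of_radial`, `weak_transport_of_weak_wave` and `transport_of_weak` therefore convert the
weak equation into an integral identity along incoming characteristics. Moreover the lifespan refers
to arbitrary solutions, while the comparison needs radial ones; uniqueness makes the solution of a
well-posed problem with radial data invariant under isometries (`lifespan_le_of_radial`). -/

/-! ### Weak equations in one space dimension and their integration along characteristics -/

/-- If a continuous function annihilates all test functions supported in an open set, it vanishes
there. -/
theorem eq_zero_of_forall_integral_mul_eq_zero {U : Set ℝ} (hU : IsOpen U) {H : ℝ → ℝ}
    (hH : Continuous H)
    (h : ∀ m : ℝ → ℝ, ContDiff ℝ (⊤ : ℕ∞) m → HasCompactSupport m → tsupport m ⊆ U →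
      ∫ s, m s * H s = 0) {x : ℝ} (hx : x ∈ U) : H x = 0 := by
  have hae : ∀ᵐ s : ℝ, s ∈ U → H s = 0 :=
    hU.ae_eq_zero_of_integral_contDiff_smul_eq_zero
      (hH.locallyIntegrable.locallyIntegrableOn U) (by simpa using h)
  have h2 : H =ᵐ[volume.restrict U] fun _ => 0 := by
    rw [Filter.EventuallyEq, ae_restrict_iff' hU.measurableSet]
    exact hae
  exact Measure.eqOn_open_of_ae_eq h2 hU hH.continuousOn continuousOn_const hx

/-- A smooth primitive of a test function `m`, vanishing to the left of its support. -/
theorem exists_primitive {m : ℝ → ℝ} (hm : ContDiff ℝ (⊤ : ℕ∞) m) {δ : ℝ}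
    (hs : ∀ s, δ ≤ |s| → m s = 0) :
    ∃ P : ℝ → ℝ, ∃ c : ℝ, ContDiff ℝ (⊤ : ℕ∞) P ∧ (∀ t, HasDerivAt P (m t) t) ∧
      (∀ t ≤ -δ, P t = 0) ∧ ∀ t ≥ δ, P t = c := by
  have hd : ∀ t, HasDerivAt (fun t => ∫ s in (-δ)..t, m s) (m t) t := fun t =>
    intervalIntegral.integral_hasDerivAt_right (hm.continuous.intervalIntegrable _ _)
      (hm.continuous.stronglyMeasurableAtFilter _ _) hm.continuous.continuousAt
  refine ⟨fun t => ∫ s in (-δ)..t, m s, ∫ s in (-δ)..δ, m s, ?_, hd, ?_, ?_⟩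
  · rw [contDiff_infty_iff_deriv]
    refine ⟨fun t => (hd t).differentiableAt, ?_⟩
    have : deriv (fun t => ∫ s in (-δ)..t, m s) = m := funext fun t => (hd t).deriv
    rwa [this]
  · intro t ht
    beta_reduce
    rw [intervalIntegral.integral_symm, neg_eq_zero]
    refine intervalIntegral.integral_zero_ae (Eventually.of_forall fun s hs' => hs s ?_)
    rw [uIoc_of_le ht] at hs'
    rw [le_abs]; right; linarith [hs'.2]
  · intro t ht
    beta_reduce
    rw [← intervalIntegral.integral_add_adjacent_intervals
      (hm.continuous.intervalIntegrable (-δ) δ) (hm.continuous.intervalIntegrable δ t)]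
    simp only [add_eq_left]
    refine intervalIntegral.integral_zero_ae (Eventually.of_forall fun s hs' => hs s ?_)
    rw [uIoc_of_le ht] at hs'
    rw [le_abs]; left; linarith [hs'.1]

/-- A weak form of the fundamental theorem of calculus, after du Bois-Reymond. -/
theorem sub_eq_integral_of_weak {h g : ℝ → ℝ} (hh : Continuous h) (hg : Continuous g)
    {t₀ t₁ δ : ℝ} (ht : t₀ ≤ t₁) (hδ : 0 < δ)
    (hw : ∀ a : ℝ → ℝ, ContDiff ℝ (⊤ : ℕ∞) a → HasCompactSupport a →
      tsupport a ⊆ Ioo (t₀ - δ) (t₁ + δ) → ∫ t, (h t * deriv a t + g t * a t) = 0) :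
    h t₁ - h t₀ = ∫ t in t₀..t₁, g t := by
  set Q : ℝ → ℝ := fun t => ∫ s in t₀..t, g s with hQ
  have hQd : ∀ t, HasDerivAt Q (g t) t := fun t =>
    intervalIntegral.integral_hasDerivAt_right (hg.intervalIntegrable _ _)
      (hg.stronglyMeasurableAtFilter _ _) hg.continuousAt
  have hQc : Continuous Q := continuous_iff_continuousAt.mpr fun t => (hQd t).continuousAt
  -- The endpoints are shifted by a common τ; testing in τ and continuity give the value at τ = 0.
  have key : (h (t₀ + 0) - Q (t₀ + 0)) - (h (t₁ + 0) - Q (t₁ + 0)) = 0 := by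
    refine eq_zero_of_forall_integral_mul_eq_zero (U := Ioo (-δ) δ) isOpen_Ioo
      (H := fun τ => (h (t₀ + τ) - Q (t₀ + τ)) - (h (t₁ + τ) - Q (t₁ + τ)))
      (by fun_prop) ?_ (x := 0) ⟨by linarith, hδ⟩
    intro m hm hmc hms
    obtain ⟨δ', hδ', hδδ, hm0⟩ : ∃ δ' > 0, δ' < δ ∧ ∀ s, δ' ≤ |s| → m s = 0 := by
      obtain ⟨r, hr0, hr, hrs⟩ : ∃ r, 0 < r ∧ r < δ ∧ tsupport m ⊆ Metric.ball 0 r := by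
        have hsub : tsupport m ⊆ Metric.ball 0 δ := by
          rw [Real.ball_eq_Ioo]; simpa using hms
        obtain ⟨r, hr, hrs⟩ := exists_pos_lt_subset_ball hδ (isClosed_tsupport m) hsub
        exact ⟨r, hr.1, hr.2, hrs⟩
      refine ⟨r, hr0, hr, fun s hs => ?_⟩
      by_contra hne
      have := hrs (subset_tsupport m hne)
      rw [Metric.mem_ball, dist_zero_right, Real.norm_eq_abs] at this
      linarith
    obtain ⟨P, c, hP, hPd, hP0, hP1⟩ := exists_primitive hm hm0
    -- A multiple of a smoothed indicator of [t₀, t₁]. To the right of t₁ + δ' the two constants c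
    -- cancel, so a has compact support, and its derivative is m placed at both endpoints with
    -- opposite signs.
    set a : ℝ → ℝ := fun t => P (t - t₀) - P (t - t₁) with ha
    have had : ∀ t, HasDerivAt a (m (t - t₀) - m (t - t₁)) t := fun t =>
      ((hPd (t - t₀)).comp_sub_const t t₀).sub ((hPd (t - t₁)).comp_sub_const t t₁)
    have hasup : Function.support a ⊆ Icc (t₀ - δ') (t₁ + δ') := by
      intro t hta
      by_contra hn
      rw [mem_Icc, not_and_or, not_le, not_le] at hn
      apply hta
      rcases hn with hn | hn
      · simp [ha, hP0 (t - t₀) (by linarith), hP0 (t - t₁) (by linarith)]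
      · simp [ha, hP1 (t - t₀) (by linarith), hP1 (t - t₁) (by linarith)]
    have hats : tsupport a ⊆ Icc (t₀ - δ') (t₁ + δ') := closure_minimal hasup isClosed_Icc
    have hac : HasCompactSupport a := isCompact_Icc.of_isClosed_subset (isClosed_tsupport a) hats
    have hasm : ContDiff ℝ (⊤ : ℕ∞) a := by
      refine ContDiff.sub ?_ ?_
      · exact hP.comp (contDiff_id.sub contDiff_const)
      · exact hP.comp (contDiff_id.sub contDiff_const)
    have h1 := hw a hasm hac (hats.trans (Icc_subset_Ioo (by linarith) (by linarith)))
    have hda : deriv a = fun t => m (t - t₀) - m (t - t₁) := funext fun t => (had t).deriv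
    have hdc : Continuous (deriv a) := by
      rw [hda]
      have := hm.continuous
      fun_prop
    have hdcs : HasCompactSupport (deriv a) := hac.deriv
    have i1 : Integrable fun t => h t * deriv a t :=
      (hh.mul hdc).integrable_of_hasCompactSupport hdcs.mul_left
    have i2 : Integrable fun t => g t * a t :=
      (hg.mul hasm.continuous).integrable_of_hasCompactSupport hac.mul_left
    have i3 : Integrable fun t => Q t * deriv a t :=
      (hQc.mul hdc).integrable_of_hasCompactSupport hdcs.mul_left
    have i4 : Integrable fun t => Q t * a t :=
      (hQc.mul hasm.continuous).integrable_of_hasCompactSupport hac.mul_left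
    have h2 : ∫ t, Q t * deriv a t = -∫ t, g t * a t :=
      integral_mul_deriv_eq_deriv_mul_of_integrable (fun t _ => hQd t)
        (fun t _ => (had t).differentiableAt.hasDerivAt) i3 i2 i4
    rw [integral_add i1 i2] at h1
    have h3 : ∫ t, (h t - Q t) * deriv a t = 0 := by
      simp only [sub_mul]
      rw [integral_sub i1 i3, h2]
      linarith
    have hmcs : ∀ c : ℝ, HasCompactSupport fun t => m (t - c) := fun c => by
      simpa [sub_eq_add_neg, Function.comp_def] using
        hmc.comp_homeomorph (Homeomorph.addRight (-c))
    have hmc' := hm.continuous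
    have j : ∀ c : ℝ, Integrable fun t => (h t - Q t) * m (t - c) := fun c =>
      (by fun_prop : Continuous fun t => (h t - Q t) * m (t - c)).integrable_of_hasCompactSupport
        (hmcs c).mul_left
    have j' : ∀ c : ℝ, Integrable fun t => m t * (h (c + t) - Q (c + t)) := fun c =>
      (by fun_prop : Continuous fun t => m t * (h (c + t) - Q (c + t))
        ).integrable_of_hasCompactSupport hmc.mul_right
    have k : ∀ c : ℝ, ∫ t, (h t - Q t) * m (t - c) = ∫ t, m t * (h (c + t) - Q (c + t)) := by
      intro c
      rw [← integral_add_right_eq_self (fun t => (h t - Q t) * m (t - c)) c]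
      congr 1
      ext t
      rw [add_sub_cancel_right, add_comm t c]
      ring
    simp only [hda, mul_sub] at h3
    rw [integral_sub (j t₀) (j t₁), k, k] at h3
    simp only [mul_sub] at h3 j' ⊢
    rw [integral_sub]
    · exact h3
    · exact j' t₀
    · exact j' t₁
  simp only [add_zero, hQ, intervalIntegral.integral_same] at key
  linarith

/-- The weak transport equation `∂ₜ h = g` in `(t, y)`, tested against products. -/
theorem sub_eq_integral_of_weak_prod {h g : ℝ × ℝ → ℝ} (hh : Continuous h) (hg : Continuous g)
    {t₀ t₁ y δ : ℝ} (ht : t₀ ≤ t₁) (hδ : 0 < δ)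
    (hw : ∀ a b : ℝ → ℝ, ContDiff ℝ (⊤ : ℕ∞) a → HasCompactSupport a →
      tsupport a ⊆ Ioo (t₀ - δ) (t₁ + δ) → ContDiff ℝ (⊤ : ℕ∞) b → HasCompactSupport b →
      tsupport b ⊆ Ioo (y - δ) (y + δ) →
      ∫ y', b y' * ∫ t, (h (t, y') * deriv a t + g (t, y') * a t) = 0) :
    h (t₁, y) - h (t₀, y) = ∫ t in t₀..t₁, g (t, y) := by
  refine sub_eq_integral_of_weak (h := fun t => h (t, y)) (g := fun t => g (t, y))
    (by fun_prop) (by fun_prop) ht hδ fun a ha hac has => ?_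
  have hda : Continuous (deriv a) := ha.continuous_deriv (by simp)
  refine eq_zero_of_forall_integral_mul_eq_zero (U := Ioo (y - δ) (y + δ)) isOpen_Ioo
    (H := fun y' => ∫ t, (h (t, y') * deriv a t + g (t, y') * a t)) ?_ 
    (fun b hb hbc hbs => hw a b ha hac has hb hbc hbs) (x := y) ⟨by linarith, by linarith⟩
  rw [← continuousOn_univ]
  refine continuousOn_integral_of_compact_support hac ?_ ?_
  · have := ha.continuous
    apply Continuous.continuousOn
    simp only [Function.uncurry_def]
    fun_prop
  · intro p t _ ht'
    have h1 : a t = 0 := image_eq_zero_of_notMem_tsupport ht'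
    have h2 : deriv a t = 0 := image_eq_zero_of_notMem_tsupport fun h => ht' (tsupport_deriv_subset h)
    simp [h1, h2]

/-- A continuous weak solution of `(∂ₜ - ∂ₓ) q = G` satisfies the equation in integrated form along
the characteristics `t + x = y`. -/
theorem transport_of_weak {Ω : Set (ℝ × ℝ)} (hΩ : IsOpen Ω) {q G : ℝ × ℝ → ℝ}
    (hq : ContinuousOn q Ω) (hG : ContinuousOn G Ω)
    (hw : ∀ χ : ℝ × ℝ → ℝ, ContDiff ℝ (⊤ : ℕ∞) χ → HasCompactSupport χ → tsupport χ ⊆ Ω →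
      ∫ z, (q z * fderiv ℝ χ z (1, -1) + G z * χ z) = 0)
    {t₀ t₁ y : ℝ} (ht : t₀ ≤ t₁) (hseg : ∀ s ∈ Icc t₀ t₁, (s, y - s) ∈ Ω) :
    q (t₁, y - t₁) - q (t₀, y - t₀) = ∫ s in t₀..t₁, G (s, y - s) := by
  -- From (t, y) with y = t + x to (t, x): in the new coordinates incoming null lines are vertical.
  set σ : ℝ × ℝ → ℝ × ℝ := fun z => (z.1, z.2 - z.1) with hσ
  have hσc : Continuous σ := by fun_prop
  obtain ⟨δ, hδ, hbox⟩ : ∃ δ > 0, ∀ s ∈ Icc (t₀ - δ) (t₁ + δ), ∀ y' ∈ Icc (y - δ) (y + δ),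
      (s, y' - s) ∈ Ω := by
    have hK : IsCompact (Icc t₀ t₁ ×ˢ ({y} : Set ℝ)) := isCompact_Icc.prod isCompact_singleton
    have hKU : Icc t₀ t₁ ×ˢ ({y} : Set ℝ) ⊆ σ ⁻¹' Ω := by
      rintro ⟨s, y'⟩ ⟨hs, hy⟩
      obtain rfl : y' = y := hy
      exact hseg s hs
    obtain ⟨δ, hδ, hsub⟩ := hK.exists_cthickening_subset_open (hΩ.preimage hσc) hKU
    refine ⟨δ, hδ, fun s hs y' hy' => hsub (a := (s, y')) ?_⟩
    refine Metric.mem_cthickening_of_dist_le (s, y') (max t₀ (min t₁ s), y) δ _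
      ⟨⟨le_max_left _ _, max_le ht (min_le_left _ _)⟩, rfl⟩ ?_
    rw [Prod.dist_eq, max_le_iff, Real.dist_eq, Real.dist_eq, abs_le, abs_le]
    refine ⟨⟨?_, ?_⟩, by linarith [hy'.1], by linarith [hy'.2]⟩
    · have : max t₀ (min t₁ s) ≤ s + δ := max_le (by linarith [hs.1])
        ((min_le_right _ _).trans (by linarith))
      simp only; linarith
    · have : s - δ ≤ max t₀ (min t₁ s) := le_max_of_le_right (le_min (by linarith [hs.2])
        (by linarith))
      simp only; linarith
  -- Clamping to the box extends q and G to globally continuous functions without changing them near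
  -- the segment.
  set κ : ℝ × ℝ → ℝ × ℝ := fun z =>
    (max (t₀ - δ) (min (t₁ + δ) z.1), max (y - δ) (min (y + δ) z.2)) with hκ
  have hκc : Continuous κ := by fun_prop
  have hκm : ∀ z, σ (κ z) ∈ Ω := fun z => hbox _
    ⟨le_max_left _ _, max_le (by linarith) (min_le_left _ _)⟩ _
    ⟨le_max_left _ _, max_le (by linarith) (min_le_left _ _)⟩
  have hκid : ∀ t ∈ Icc (t₀ - δ) (t₁ + δ), ∀ y' ∈ Icc (y - δ) (y + δ), κ (t, y') = (t, y') := by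
    intro t ht y' hy'
    simp only [hκ, Prod.mk.injEq]
    rw [min_eq_right ht.2, max_eq_right ht.1, min_eq_right hy'.2, max_eq_right hy'.1]
    exact ⟨rfl, rfl⟩
  have hext : ∀ f : ℝ × ℝ → ℝ, ContinuousOn f Ω → Continuous fun z => f (σ (κ z)) := fun f hf =>
    hf.comp_continuous (hσc.comp hκc) hκm
  have hqc := hext q hq
  have hGc := hext G hG
  have main := sub_eq_integral_of_weak_prod hqc hGc (y := y) ht hδ ?_
  · have hy0 : y ∈ Icc (y - δ) (y + δ) := ⟨by linarith, by linarith⟩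
    rw [hκid t₁ ⟨by linarith, by linarith⟩ y hy0, hκid t₀ ⟨by linarith, by linarith⟩ y hy0] at main
    rw [main]
    refine intervalIntegral.integral_congr fun s hs => ?_
    rw [uIcc_of_le ht] at hs
    simp only [hκid s ⟨by linarith [hs.1], by linarith [hs.2]⟩ y hy0, hσ]
  · intro a b ha hac has hb hbc hbs
    have hda : Continuous (deriv a) := ha.continuous_deriv (by simp)
    have hac' := ha.continuous
    have hbc' := hb.continuous
    -- The factor b is constant along (1, −1), so the transport derivative falls on a alone.
    set χ : ℝ × ℝ → ℝ := fun z => a z.1 * b (z.2 + z.1) with hχ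
    have hχd : ContDiff ℝ (⊤ : ℕ∞) χ :=
      (ha.comp contDiff_fst).mul (hb.comp (contDiff_snd.add contDiff_fst))
    have hsupp : ∀ z, χ z ≠ 0 → z.1 ∈ tsupport a ∧ z.2 + z.1 ∈ tsupport b := fun z hz =>
      ⟨subset_tsupport a (left_ne_zero_of_mul hz), subset_tsupport b (right_ne_zero_of_mul hz)⟩
    have hts : tsupport χ ⊆ {z | z.1 ∈ tsupport a ∧ z.2 + z.1 ∈ tsupport b} :=
      closure_minimal hsupp (((isClosed_tsupport a).preimage continuous_fst).inter
        ((isClosed_tsupport b).preimage (continuous_snd.add continuous_fst)))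
    have hχc : HasCompactSupport χ := by
      refine HasCompactSupport.of_support_subset_isCompact
        ((isCompact_Icc (a := t₀ - δ) (b := t₁ + δ)).prod
          (isCompact_Icc (a := y - δ - (t₁ + δ)) (b := y + δ - (t₀ - δ)))) fun z hz => ?_
      obtain ⟨h1, h2⟩ := hsupp z hz
      have h1 := has h1
      have h2 := hbs h2
      exact ⟨⟨h1.1.le, h1.2.le⟩, by linarith [h1.2, h2.1], by linarith [h1.1, h2.2]⟩
    have hχΩ : tsupport χ ⊆ Ω := by
      intro z hz
      obtain ⟨h1, h2⟩ := hts hz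
      have := hbox z.1 (Ioo_subset_Icc_self (has h1)) (z.2 + z.1) (Ioo_subset_Icc_self (hbs h2))
      simpa using this
    have h0 := hw χ hχd hχc hχΩ
    have hder : ∀ z, fderiv ℝ χ z (1, -1) = deriv a z.1 * b (z.2 + z.1) := by
      intro z
      have h1 : HasFDerivAt (fun z : ℝ × ℝ => a z.1)
          ((ContinuousLinearMap.toSpanSingleton ℝ (deriv a z.1)).comp
            (ContinuousLinearMap.fst ℝ ℝ ℝ)) z :=
        ((ha.differentiable (by simp) z.1).hasDerivAt.hasFDerivAt).comp z hasFDerivAt_fst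
      have h2 : HasFDerivAt (fun z : ℝ × ℝ => b (z.2 + z.1))
          ((ContinuousLinearMap.toSpanSingleton ℝ (deriv b (z.2 + z.1))).comp
            (ContinuousLinearMap.snd ℝ ℝ ℝ + ContinuousLinearMap.fst ℝ ℝ ℝ)) z :=
        ((hb.differentiable (by simp) (z.2 + z.1)).hasDerivAt.hasFDerivAt).comp z
          (hasFDerivAt_snd.add hasFDerivAt_fst)
      rw [(show HasFDerivAt χ _ z from h1.mul h2).fderiv]
      simp [mul_comm]
    set N : ℝ → ℝ → ℝ := fun t y' =>
      b y' * (q (σ (κ (t, y'))) * deriv a t + G (σ (κ (t, y'))) * a t) with hN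
    have hNc : Continuous (Function.uncurry N) := by
      have : Continuous fun z : ℝ × ℝ =>
          b z.2 * (q (σ (κ z)) * deriv a z.1 + G (σ (κ z)) * a z.1) :=
        (hbc'.comp continuous_snd).mul ((hqc.mul (hda.comp continuous_fst)).add
          (hGc.mul (hac'.comp continuous_fst)))
      exact this
    have hNc0 : ∀ t y', N t y' ≠ 0 → t ∈ tsupport a ∧ y' ∈ tsupport b := by
      intro t y' hn
      refine ⟨?_, subset_tsupport b (left_ne_zero_of_mul hn)⟩
      by_contra hta
      apply right_ne_zero_of_mul hn
      rw [image_eq_zero_of_notMem_tsupport hta,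
        image_eq_zero_of_notMem_tsupport fun h => hta (tsupport_deriv_subset h)]
      simp
    have hNi : Integrable (Function.uncurry N) := by
      refine hNc.integrable_of_hasCompactSupport ?_
      exact HasCompactSupport.of_support_subset_isCompact (hac.isCompact.prod hbc.isCompact)
        fun z hz => hNc0 z.1 z.2 hz
    have hNi' : Integrable fun z : ℝ × ℝ => N z.1 (z.2 + z.1) := by
      refine (hNc.comp (continuous_fst.prodMk (continuous_snd.add continuous_fst))
        ).integrable_of_hasCompactSupport ?_
      refine HasCompactSupport.of_support_subset_isCompact
        ((isCompact_Icc (a := t₀ - δ) (b := t₁ + δ)).prod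
          (isCompact_Icc (a := y - δ - (t₁ + δ)) (b := y + δ - (t₀ - δ)))) fun z hz => ?_
      obtain ⟨h1, h2⟩ := hNc0 _ _ hz
      have h1 : z.1 ∈ Ioo _ _ := has h1
      have h2 : z.2 + z.1 ∈ Ioo _ _ := hbs h2
      exact ⟨⟨h1.1.le, h1.2.le⟩, by linarith [h1.2, h2.1], by linarith [h1.1, h2.2]⟩
    have hpt : ∀ z : ℝ × ℝ, q z * fderiv ℝ χ z (1, -1) + G z * χ z = N z.1 (z.2 + z.1) := by
      intro z
      rw [hder]
      by_cases hz : z.1 ∈ tsupport a ∧ z.2 + z.1 ∈ tsupport b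
      · have : σ (κ (z.1, z.2 + z.1)) = z := by
          rw [hκid _ (Ioo_subset_Icc_self (has hz.1)) _ (Ioo_subset_Icc_self (hbs hz.2))]
          simp [hσ]
        simp only [hN, hχ, this]
        ring
      · have h1 : N z.1 (z.2 + z.1) = 0 := by
          by_contra h; exact hz (hNc0 _ _ h)
        rw [h1]
        rw [not_and_or] at hz
        rcases hz with hz | hz
        · simp [hχ, image_eq_zero_of_notMem_tsupport hz,
            image_eq_zero_of_notMem_tsupport fun h => hz (tsupport_deriv_subset h)]
        · simp [hχ, image_eq_zero_of_notMem_tsupport hz]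
    simp only [hpt] at h0
    rw [Measure.volume_eq_prod, integral_prod _ hNi'] at h0
    -- For fixed t the passage from x to y = x + t is a translation.
    simp only [integral_add_right_eq_self (μ := (volume : Measure ℝ)) (N _) _] at h0
    rw [integral_integral_swap hNi] at h0
    rw [← h0]
    refine integral_congr_ae (Eventually.of_forall fun y' => ?_)
    simp only [hN]
    rw [integral_const_mul]

/-- A function continuous on an open set and vanishing off a compact subset is integrable. -/
theorem integrable_of_continuousOn_of_compact {X : Type*} [TopologicalSpace X] [MeasurableSpace X]
    [OpensMeasurableSpace X] [T2Space X] {μ : Measure X} [IsFiniteMeasureOnCompacts μ] {g : X → ℝ} {U K : Set X}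
    (hg : ContinuousOn g U) (hK : IsCompact K) (hKU : K ⊆ U) (h0 : ∀ x ∉ K, g x = 0) :
    Integrable g μ := by
  have h1 : IntegrableOn g K μ := (hg.mono hKU).integrableOn_compact hK
  rwa [integrableOn_iff_integrable_of_support_subset] at h1
  intro x hx
  by_contra h
  exact hx (h0 x h)

/-- Integration by parts for w that is C¹ on Ω only: the support of ζ hides whatever values w takes
elsewhere. -/
theorem integral_fderiv_mul_add_mul_fderiv_eq_zero {Ω : Set (ℝ × ℝ)} (hΩ : IsOpen Ω)
    {w ζ : ℝ × ℝ → ℝ} (hw : ContDiffOn ℝ 1 w Ω) (hζ : ContDiff ℝ 1 ζ) (hζc : HasCompactSupport ζ)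
    (hζs : tsupport ζ ⊆ Ω) (v : ℝ × ℝ) :
    Integrable (fun z => fderiv ℝ w z v * ζ z + w z * fderiv ℝ ζ z v) ∧
      ∫ z, (fderiv ℝ w z v * ζ z + w z * fderiv ℝ ζ z v) = 0 := by
  have hwd : ContinuousOn (fun z => fderiv ℝ w z v) Ω :=
    (hw.continuousOn_fderiv_of_isOpen hΩ (by simp)).clm_apply continuousOn_const
  have hζd : Continuous fun z => fderiv ℝ ζ z v :=
    (hζ.continuous_fderiv (by simp)).clm_apply continuous_const
  have i1 : Integrable fun z => fderiv ℝ w z v * ζ z :=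
    integrable_of_continuousOn_of_compact (hwd.mul hζ.continuous.continuousOn) hζc hζs
      fun x hx => by simp [image_eq_zero_of_notMem_tsupport hx]
  have i2 : Integrable fun z => w z * fderiv ℝ ζ z v := by
    refine integrable_of_continuousOn_of_compact (hw.continuousOn.mul hζd.continuousOn) hζc hζs
      fun x hx => ?_
    rw [fderiv_of_notMem_tsupport ℝ hx]
    simp
  have i3 : Integrable fun z => w z * ζ z :=
    integrable_of_continuousOn_of_compact (hw.continuousOn.mul hζ.continuous.continuousOn) hζc hζs
      fun x hx => by simp [image_eq_zero_of_notMem_tsupport hx]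
  refine ⟨i1.add i2, ?_⟩
  rw [integral_add i1 i2, integral_mul_fderiv_eq_neg_fderiv_mul_of_integrable i1 i2 i3
    (fun x hx => (hw.differentiableOn (by simp)).differentiableAt (hΩ.mem_nhds (hζs hx)))
    (fun x _ => hζ.differentiable (by simp) x)]
  ring

/-- The weak wave equation in `(t, x)` for a `C¹` function, rewritten as a weak transport equation
for `w_t + w_x`. -/
theorem weak_transport_of_weak_wave {Ω : Set (ℝ × ℝ)} (hΩ : IsOpen Ω) {w S : ℝ × ℝ → ℝ}
    {κ κ' : ℝ → ℝ} (hw : ContDiffOn ℝ 1 w Ω) (hκ : ∀ x, HasDerivAt κ (κ' x) x)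
    (hκ' : Continuous κ') {χ : ℝ × ℝ → ℝ} (hχ : ContDiff ℝ (⊤ : ℕ∞) χ)
    (hχc : HasCompactSupport χ) (hχs : tsupport χ ⊆ Ω) 
    (h0 : ∫ z, (-(fderiv ℝ w z (1, 0) * fderiv ℝ χ z (1, 0)) +
      (fderiv ℝ w z (0, 1) - κ z.2 * w z) * (fderiv ℝ χ z (0, 1) - κ z.2 * χ z) - S z * χ z) = 0)
    (hi : Integrable fun z => -(fderiv ℝ w z (1, 0) * fderiv ℝ χ z (1, 0)) +
      (fderiv ℝ w z (0, 1) - κ z.2 * w z) * (fderiv ℝ χ z (0, 1) - κ z.2 * χ z) - S z * χ z) :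
    ∫ z, ((fderiv ℝ w z (1, 0) + fderiv ℝ w z (0, 1)) * fderiv ℝ χ z (1, -1) +
      (S z - (κ z.2 ^ 2 + κ' z.2) * w z) * χ z) = 0 := by
  have hdχ : ∀ v, ContDiff ℝ (⊤ : ℕ∞) fun z => fderiv ℝ χ z v := fun v =>
    (hχ.fderiv_right (m := (⊤ : ℕ∞)) (by simp)).clm_apply contDiff_const
  have hdc : ∀ v, HasCompactSupport fun z => fderiv ℝ χ z v := fun v =>
    hχc.fderiv_apply (𝕜 := ℝ) v
  have hds : ∀ v, tsupport (fun z => fderiv ℝ χ z v) ⊆ Ω := fun v =>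
    (tsupport_fderiv_apply_subset ℝ v).trans hχs
  have hdd : ∀ z u v, fderiv ℝ (fun z => fderiv ℝ χ z v) z u = fderiv ℝ (fderiv ℝ χ) z u v := by
    intro z u v
    have : DifferentiableAt ℝ (fderiv ℝ χ) z :=
      (hχ.fderiv_right (m := (⊤ : ℕ∞)) (by simp)).differentiable (by simp) z
    rw [fderiv_clm_apply this (differentiableAt_const v)]
    simp
  have hsym : ∀ z u v, fderiv ℝ (fderiv ℝ χ) z u v = fderiv ℝ (fderiv ℝ χ) z v u := fun z u v =>
    (hχ.contDiffAt.isSymmSndFDerivAt (by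
      simpa using (WithTop.coe_le_coe.mpr le_top : ((2 : ℕ∞) : WithTop ℕ∞) ≤ ((⊤ : ℕ∞) : WithTop ℕ∞)))).eq u v
  have hκ1 : ContDiff ℝ 1 κ := by
    rw [contDiff_one_iff_deriv]
    refine ⟨fun x => (hκ x).differentiableAt, ?_⟩
    rwa [show deriv κ = κ' from funext fun x => (hκ x).deriv]
  have hκχ : ContDiff ℝ 1 fun z : ℝ × ℝ => κ z.2 * χ z :=
    (hκ1.comp contDiff_snd).mul (hχ.of_le (by simp))
  have hκχc : HasCompactSupport fun z : ℝ × ℝ => κ z.2 * χ z := hχc.mul_left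
  have hκχs : tsupport (fun z : ℝ × ℝ => κ z.2 * χ z) ⊆ Ω :=
    (tsupport_mul_subset_right).trans hχs
  have hκχd : ∀ z, fderiv ℝ (fun z : ℝ × ℝ => κ z.2 * χ z) z (0, 1) =
      κ' z.2 * χ z + κ z.2 * fderiv ℝ χ z (0, 1) := by
    intro z
    have h1 : HasFDerivAt (fun z : ℝ × ℝ => κ z.2)
        ((ContinuousLinearMap.toSpanSingleton ℝ (κ' z.2)).comp
          (ContinuousLinearMap.snd ℝ ℝ ℝ)) z := (hκ z.2).hasFDerivAt.comp z hasFDerivAt_snd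
    have h2 := (hχ.differentiable (by simp) z).hasFDerivAt
    rw [(show HasFDerivAt (fun z : ℝ × ℝ => κ z.2 * χ z) _ z from h1.mul h2).fderiv]
    simp
    ring
  -- `e1` trades the terms linear in κ for κ'. `e2` and `e3` give ∫ w_x χ_t = ∫ w_t χ_x, both being
  -- −∫ w χ_tx, so that w itself needs no second derivatives.
  obtain ⟨i1, e1⟩ := integral_fderiv_mul_add_mul_fderiv_eq_zero hΩ hw hκχ hκχc hκχs (0, 1)
  obtain ⟨i2, e2⟩ := integral_fderiv_mul_add_mul_fderiv_eq_zero hΩ hw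
    ((hdχ (1, 0)).of_le (by simp)) (hdc _) (hds _) (0, 1)
  obtain ⟨i3, e3⟩ := integral_fderiv_mul_add_mul_fderiv_eq_zero hΩ hw
    ((hdχ (0, 1)).of_le (by simp)) (hdc _) (hds _) (1, 0)
  have e : ∫ z, (-((fderiv ℝ w z (1, 0) + fderiv ℝ w z (0, 1)) * fderiv ℝ χ z (1, -1) +
      (S z - (κ z.2 ^ 2 + κ' z.2) * w z) * χ z)) = 0 := by
    have hsum := integral_sub ((hi.add i1).add i3) i2
    rw [integral_add' (hi.add i1) i3, integral_add' hi i1, h0, e1, e2, e3] at hsum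
    simp only [add_zero, sub_zero] at hsum
    refine Eq.trans (integral_congr_ae (Eventually.of_forall fun z => ?_)) hsum
    have hl : fderiv ℝ χ z (1, -1) = fderiv ℝ χ z (1, 0) - fderiv ℝ χ z (0, 1) := by
      rw [← map_sub]; simp
    simp only [Pi.add_apply, hκχd, hdd, hsym z (0, 1) (1, 0), hl]
    ring
  rw [integral_neg] at e
  linarith

/-! ### The tortoise coordinate -/

theorem lapse_pos {M r : ℝ} (hM : 0 < M) (hr : 2 * M < r) : 0 < lapse M r := by
  have h0 : 0 < r := by linarith
  rw [lapse, sub_pos, div_lt_one h0]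
  exact hr

theorem hasDerivAt_rStar {M r : ℝ} (hM : 0 < M) (hr : 2 * M < r) :
    HasDerivAt (rStar M) (lapse M r)⁻¹ r := by
  have h0 : r ≠ 0 := by linarith
  have h1 : r - 2 * M ≠ 0 := by linarith
  have h : HasDerivAt (rStar M) (1 + 2 * M * (1 / (r - 2 * M))) r :=
    (hasDerivAt_id r).add ((((hasDerivAt_id r).sub_const (2 * M)).log h1).const_mul (2 * M))
  convert h using 1
  rw [lapse]
  field_simp
  ring

theorem contDiffAt_rStar {M r : ℝ} {n : WithTop ℕ∞} (hr : 2 * M < r) :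
    ContDiffAt ℝ n (rStar M) r :=
  contDiffAt_id.add (contDiffAt_const.mul
    ((contDiffAt_id.sub contDiffAt_const).log (by simp only [id]; linarith)))

theorem continuousOn_rStar {M : ℝ} : ContinuousOn (rStar M) (Ioi (2 * M)) := fun _ hr =>
  (contDiffAt_rStar (n := 0) hr).continuousAt.continuousWithinAt

theorem strictMonoOn_rStar {M : ℝ} (hM : 0 < M) : StrictMonoOn (rStar M) (Ioi (2 * M)) := by
  refine strictMonoOn_of_deriv_pos (convex_Ioi _) continuousOn_rStar fun r hr => ?_
  rw [interior_Ioi] at hr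
  rw [(hasDerivAt_rStar hM hr).deriv]
  exact inv_pos.mpr (lapse_pos hM hr)

theorem image_rStar {M : ℝ} (hM : 0 < M) : rStar M '' Ioi (2 * M) = univ := by
  refine eq_univ_of_forall fun x => ?_
  -- At r = 2M + e^{-c} the tortoise coordinate is 2M + e^{-c} − 2Mc, which is at most x for this c.
  set c := max 0 ((2 * M + 1 - x) / (2 * M)) with hc
  have hc0 : 0 ≤ c := le_max_left _ _
  have hc1 : 2 * M + 1 - x ≤ c * (2 * M) := (div_le_iff₀ (by linarith)).mp (le_max_right _ _)
  have he : 0 < Real.exp (-c) := Real.exp_pos _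
  have he1 : Real.exp (-c) ≤ 1 := Real.exp_le_one_iff.mpr (by linarith)
  set r₂ := max x (2 * M + 1) with hr₂
  have h2 : 2 * M + 1 ≤ r₂ := le_max_right _ _
  have hle : 2 * M + Real.exp (-c) ≤ r₂ := by linarith
  have hsub : Icc (2 * M + Real.exp (-c)) r₂ ⊆ Ioi (2 * M) := fun r hr => by
    have := hr.1; simp only [mem_Ioi]; linarith
  have hx : x ∈ Icc (rStar M (2 * M + Real.exp (-c))) (rStar M r₂) := by
    constructor
    · rw [rStar, add_sub_cancel_left, Real.log_exp]
      linarith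
    · have hlog : 0 ≤ Real.log (r₂ - 2 * M) := Real.log_nonneg (by linarith)
      have : x ≤ r₂ := le_max_left _ _
      rw [rStar]
      nlinarith
  obtain ⟨r, hr, hrx⟩ := intermediate_value_Icc hle (continuousOn_rStar.mono hsub) hx
  exact ⟨r, hsub hr, hrx⟩

/-- The inverse of the tortoise coordinate. -/
noncomputable def rOfStar (M x : ℝ) : ℝ := Function.invFunOn (rStar M) (Ioi (2 * M)) x

theorem rOfStar_gt {M : ℝ} (hM : 0 < M) (x : ℝ) : 2 * M < rOfStar M x :=
  Function.invFunOn_mem (by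
    have : x ∈ rStar M '' Ioi (2 * M) := by rw [image_rStar hM]; trivial
    simpa using this)

theorem rStar_rOfStar {M : ℝ} (hM : 0 < M) (x : ℝ) : rStar M (rOfStar M x) = x :=
  Function.invFunOn_eq (by
    have : x ∈ rStar M '' Ioi (2 * M) := by rw [image_rStar hM]; trivial
    simpa using this)

theorem rOfStar_rStar {M r : ℝ} (hM : 0 < M) (hr : 2 * M < r) : rOfStar M (rStar M r) = r :=
  (strictMonoOn_rStar hM).injOn (rOfStar_gt hM _) hr (rStar_rOfStar hM _)

theorem strictMono_rOfStar {M : ℝ} (hM : 0 < M) : StrictMono (rOfStar M) := fun x y hxy => by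
  rw [← (strictMonoOn_rStar hM).lt_iff_lt (rOfStar_gt hM x) (rOfStar_gt hM y)]
  rwa [rStar_rOfStar hM, rStar_rOfStar hM]

theorem hasDerivAt_rOfStar {M : ℝ} (hM : 0 < M) (x : ℝ) :
    HasDerivAt (rOfStar M) (lapse M (rOfStar M x)) x := by
  have hr := rOfStar_gt hM x
  have hc : ContinuousAt (rOfStar M) x := by
    refine ((strictMono_rOfStar hM).strictMonoOn univ).continuousAt_of_image_mem_nhds univ_mem ?_
    refine mem_of_superset (Ioi_mem_nhds hr) fun r hr => ⟨rStar M r, trivial, rOfStar_rStar hM hr⟩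
  have := HasDerivAt.of_local_left_inverse hc (hasDerivAt_rStar hM hr)
    (inv_ne_zero (lapse_pos hM hr).ne') (Eventually.of_forall (rStar_rOfStar hM))
  rwa [inv_inv] at this

theorem hasDerivAt_lapse {M r : ℝ} (hr : r ≠ 0) : HasDerivAt (lapse M) (2 * M / r ^ 2) r := by
  exact (((hasDerivAt_inv hr).const_mul (2 * M)).const_sub 1).congr_deriv (by ring)

theorem continuous_rOfStar {M : ℝ} (hM : 0 < M) : Continuous (rOfStar M) :=
  continuous_iff_continuousAt.mpr fun x => (hasDerivAt_rOfStar hM x).continuousAt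

theorem continuous_lapse_rOfStar {M : ℝ} (hM : 0 < M) :
    Continuous fun x => lapse M (rOfStar M x) :=
  continuous_iff_continuousAt.mpr fun x =>
    ((hasDerivAt_lapse (by have := rOfStar_gt hM x; linarith)).continuousAt.comp
      (continuous_rOfStar hM).continuousAt :)

theorem contDiff_rOfStar {M : ℝ} (hM : 0 < M) : ContDiff ℝ 1 (rOfStar M) := by
  rw [contDiff_one_iff_deriv]
  refine ⟨fun x => (hasDerivAt_rOfStar hM x).differentiableAt, ?_⟩
  rw [show deriv (rOfStar M) = _ from funext fun x => (hasDerivAt_rOfStar hM x).deriv]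
  exact continuous_lapse_rOfStar hM

/-! ### Radial functions in the coordinates `(t, r*)` -/

theorem hasFDerivAt_norm {y : E3} (hy : y ≠ 0) :
    HasFDerivAt (fun y : E3 => ‖y‖) (‖y‖⁻¹ • innerSL ℝ y) y := by
  have h := (hasStrictFDerivAt_norm_sq y).hasFDerivAt.sqrt
    (by simpa using hy)
  have h2 : (fun y : E3 => √(‖y‖ ^ 2)) = fun y => ‖y‖ := by
    ext y; exact Real.sqrt_sq (norm_nonneg y)
  rw [h2] at h
  refine h.congr_fderiv ?_
  rw [Real.sqrt_sq (norm_nonneg y)]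
  ext v
  simp
  ring

/-- The differential of `v(t, r*) / r`. -/
theorem hasFDerivAt_radial {M : ℝ} (hM : 0 < M) {v : ℝ × ℝ → ℝ} {z : ST} (hz : 2 * M < ‖z.2‖)
    (hv : DifferentiableAt ℝ v (z.1, rStar M ‖z.2‖)) :
    ∃ A : ST →L[ℝ] ℝ, HasFDerivAt (fun z : ST => v (z.1, rStar M ‖z.2‖) / ‖z.2‖) A z ∧
      A (1, 0) = fderiv ℝ v (z.1, rStar M ‖z.2‖) (1, 0) / ‖z.2‖ ∧
      ∀ Y, A (0, Y) = (fderiv ℝ v (z.1, rStar M ‖z.2‖) (0, 1) / (lapse M ‖z.2‖ * ‖z.2‖) -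
        v (z.1, rStar M ‖z.2‖) / ‖z.2‖ ^ 2) * (inner ℝ z.2 Y / ‖z.2‖) := by
  have hr : 0 < ‖z.2‖ := by linarith
  have hn : HasFDerivAt (fun z : ST => ‖z.2‖) _ z :=
    (hasFDerivAt_norm (norm_pos_iff.mp hr)).comp z hasFDerivAt_snd
  have hs := HasDerivAt.comp_hasFDerivAt (h₂ := rStar M) z (hasDerivAt_rStar hM hz) hn
  have hvc : HasFDerivAt (fun z : ST => v (z.1, rStar M ‖z.2‖)) _ z :=
    HasFDerivAt.comp z (f := fun z : ST => (z.1, rStar M ‖z.2‖)) hv.hasFDerivAt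
      (hasFDerivAt_fst.prodMk hs)
  have hinv := HasDerivAt.comp_hasFDerivAt (h₂ := Inv.inv) z (hasDerivAt_inv hr.ne') hn
  refine ⟨_, by simpa only [div_eq_mul_inv] using! hvc.mul hinv, ?_, fun Y => ?_⟩
  · simp
    ring
  · have h2 : ∀ c : ℝ, fderiv ℝ v (z.1, rStar M ‖z.2‖) (0, c)
        = c * fderiv ℝ v (z.1, rStar M ‖z.2‖) (0, 1) := by
      intro c
      rw [← smul_eq_mul, ← map_smul]
      simp
    have := (lapse_pos hM hz).ne'
    have h3 := h2 ((lapse M ‖z.2‖)⁻¹ * (‖z.2‖⁻¹ * inner ℝ z.2 Y))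
    simp [h3]
    field_simp
    ring

variable {M r₀ : ℝ}

theorem norm_sq_eq_sum (y : E3) : ‖y‖ ^ 2 = ∑ i, y i * y i := by
  rw [EuclideanSpace.norm_sq_eq]
  exact Finset.sum_congr rfl fun i _ => by rw [Real.norm_eq_abs, sq_abs, sq]

/-- For covectors with radial space part the angular bracket vanishes. With h' = 1/f, where f is the
lapse, the mixed coefficient 1 − f h' is zero and h'(2 − f h') = 1/f, which leaves the diagonal form
of the metric in (t, r). -/
theorem cometric_radial {h : ℝ → ℝ} {y : E3} {ω η : ST →L[ℝ] ℝ} {a b : ℝ} (hy : y ≠ 0)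
    (hf : lapse M ‖y‖ ≠ 0) (hh : deriv h ‖y‖ = (lapse M ‖y‖)⁻¹)
    (hω : ∀ Y, ω (0, Y) = a * (inner ℝ y Y / ‖y‖)) (hη : ∀ Y, η (0, Y) = b * (inner ℝ y Y / ‖y‖)) :
    cometric M h y ω η =
      -((lapse M ‖y‖)⁻¹ * (ω (1, 0) * η (1, 0))) + lapse M ‖y‖ * (a * b) := by
  have hr : ‖y‖ ≠ 0 := norm_ne_zero_iff.mpr hy
  have hc : ∀ ζ : ST →L[ℝ] ℝ, ∀ c : ℝ, (∀ Y, ζ (0, Y) = c * (inner ℝ y Y / ‖y‖)) →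
      coradial y ζ = c := by
    intro ζ c hζ
    rw [coradial, hζ, inner_smul_right, real_inner_self_eq_norm_sq]
    field_simp
  have hs : ∑ i, ω (0, e i) * η (0, e i) = a * b := by
    have h1 : ∀ i, ω (0, e i) * η (0, e i) = a * b / ‖y‖ ^ 2 * (y i * y i) := by
      intro i
      have : inner ℝ y (e i) = y i := by simp [e, EuclideanSpace.inner_single_right]
      rw [hω, hη, this]
      field_simp
    simp only [h1]
    rw [← Finset.mul_sum, ← norm_sq_eq_sum]
    field_simp
  rw [cometric, hc ω a hω, hc η b hη, hs, hh]
  field_simp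
  ring

theorem cometric_zero_right (h : ℝ → ℝ) (y : E3) (ω : ST →L[ℝ] ℝ) :
    cometric M h y ω 0 = 0 := by
  simp [cometric, coradial]

/-- The weak form of the equation for `w = r u` in the coordinates `(t, r*)`. -/
theorem weak_wave_of_radial (hM : 0 < M) {Φ : Foliation M r₀} {F : ℝ → ℝ} (hF : Continuous F)
    {d : InitialData r₀} {D : Set ST} {u : ST → ℝ} (hu : IsSolutionOn Φ F d D u)
    {Ω : Set (ℝ × ℝ)} (hΩ : IsOpen Ω) {L : ℝ} (hL : 2 * M < L)
    (hLr : ∀ r, 0 ≤ r → r ≤ L → rStar M r ≤ 2 * L) (hΩL : ∀ z ∈ Ω, 2 * L < z.2)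
    (hΩD : ∀ z : ST, L < ‖z.2‖ → (z.1, rStar M ‖z.2‖) ∈ Ω → z ∈ interior D)
    (hh : ∀ r > L, Φ.height r = rStar M r) {w : ℝ × ℝ → ℝ} (hw : ContDiffOn ℝ 1 w Ω)
    (huw : ∀ z : ST, L < ‖z.2‖ → (z.1, rStar M ‖z.2‖) ∈ Ω →
      u z = w (z.1, rStar M ‖z.2‖) / ‖z.2‖)
    {χ : ℝ × ℝ → ℝ} (hχ : ContDiff ℝ (⊤ : ℕ∞) χ) (hχc : HasCompactSupport χ)
    (hχs : tsupport χ ⊆ Ω) {J : ℝ × ℝ → ℝ}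
    (hJ : ∀ z, J z = -(fderiv ℝ w z (1, 0) * fderiv ℝ χ z (1, 0)) +
      (fderiv ℝ w z (0, 1) - lapse M (rOfStar M z.2) / rOfStar M z.2 * w z) *
        (fderiv ℝ χ z (0, 1) - lapse M (rOfStar M z.2) / rOfStar M z.2 * χ z) -
      lapse M (rOfStar M z.2) * rOfStar M z.2 * F (w z / rOfStar M z.2) * χ z) :
    Integrable J ∧ ∫ z, J z = 0 := by
  have hLpos : 0 < L := by linarith
  have hρ : ∀ x, rOfStar M x ≠ 0 := fun x => by have := rOfStar_gt hM x; linarith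
  have hρc := continuous_rOfStar hM
  have hfc := continuous_lapse_rOfStar hM
  have hκc : Continuous fun x => lapse M (rOfStar M x) / rOfStar M x := hfc.div hρc hρ
  have hwd : ∀ v, ContinuousOn (fun z => fderiv ℝ w z v) Ω := fun v =>
    (hw.continuousOn_fderiv_of_isOpen hΩ (by simp)).clm_apply continuousOn_const
  have hχd : ∀ v, Continuous fun z => fderiv ℝ χ z v := fun v =>
    (hχ.continuous_fderiv (by simp)).clm_apply continuous_const
  have hJc : ContinuousOn J Ω := by
    rw [continuousOn_congr fun z _ => hJ z]
    have c1 : ContinuousOn (fun z : ℝ × ℝ => lapse M (rOfStar M z.2) / rOfStar M z.2) Ω :=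
      (hκc.comp continuous_snd).continuousOn
    have c2 : ContinuousOn (fun z : ℝ × ℝ => lapse M (rOfStar M z.2) * rOfStar M z.2) Ω :=
      ((hfc.mul hρc).comp continuous_snd).continuousOn
    have c3 : ContinuousOn (fun z : ℝ × ℝ => F (w z / rOfStar M z.2)) Ω :=
      hF.comp_continuousOn (hw.continuousOn.div (hρc.comp continuous_snd).continuousOn
        fun z _ => hρ z.2)
    exact ((((hwd _).mul (hχd _).continuousOn).neg.add
      (((hwd _).sub (c1.mul hw.continuousOn)).mul
        ((hχd _).continuousOn.sub (c1.mul hχ.continuous.continuousOn)))).sub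
      ((c2.mul c3).mul hχ.continuous.continuousOn))
  have hJ0 : ∀ z ∉ tsupport χ, J z = 0 := by
    intro z hz
    rw [hJ, image_eq_zero_of_notMem_tsupport hz, fderiv_of_notMem_tsupport ℝ hz]
    simp
  have hJi : Integrable J := integrable_of_continuousOn_of_compact hJc hχc hχs hJ0
  refine ⟨hJi, ?_⟩
  -- The division by r treats χ like w = r u. No cut-off is needed: `hLr` also covers r ≤ 2M, where
  -- `rStar` has only its conventional value, so φ vanishes for r ≤ L.
  set φ : ST → ℝ := fun z => χ (z.1, rStar M ‖z.2‖) / ‖z.2‖ with hφ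
  have hgt : ∀ z : ST, (z.1, rStar M ‖z.2‖) ∈ Ω → L < ‖z.2‖ := by
    intro z hz
    by_contra hn
    have := hΩL _ hz
    have := hLr _ (norm_nonneg z.2) (not_lt.mp hn)
    simp only at *
    linarith
  have hφ0 : ∀ z : ST, ‖z.2‖ < L → φ =ᶠ[𝓝 z] 0 := by
    intro z hz
    filter_upwards [(isOpen_lt continuous_snd.norm continuous_const).mem_nhds hz] with z' hz'
    simp only [hφ, Pi.zero_apply, div_eq_zero_iff]
    left
    by_contra hne
    exact absurd (hgt z' (hχs (subset_tsupport χ hne))) (not_lt.mpr (le_of_lt hz'))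
  have hsm : ∀ z : ST, 2 * M < ‖z.2‖ →
      ContDiffAt ℝ (⊤ : ℕ∞) (fun z : ST => (z.1, rStar M ‖z.2‖)) z := by
    intro z hz
    have hn : ContDiffAt ℝ (⊤ : ℕ∞) (fun z : ST => ‖z.2‖) z :=
      (contDiffAt_norm ℝ (norm_pos_iff.mp (by linarith))).comp z contDiffAt_snd
    exact contDiffAt_fst.prodMk (ContDiffAt.comp z (g := rStar M) (contDiffAt_rStar hz) hn)
  have hφsm : ContDiff ℝ (⊤ : ℕ∞) φ := by
    rw [contDiff_iff_contDiffAt]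
    intro z
    rcases lt_or_ge (2 * M) ‖z.2‖ with hz | hz
    · have hn : ContDiffAt ℝ (⊤ : ℕ∞) (fun z : ST => ‖z.2‖) z :=
        (contDiffAt_norm ℝ (norm_pos_iff.mp (by linarith))).comp z contDiffAt_snd
      exact (hχ.contDiffAt.comp z (hsm z hz)).div hn (by linarith)
    · exact contDiffAt_const.congr_of_eventuallyEq (hφ0 z (by linarith))
  set K : Set ST := {z | L ≤ ‖z.2‖ ∧ (z.1, rStar M ‖z.2‖) ∈ tsupport χ} with hK
  have hKcl : IsClosed K := by
    have hc : ContinuousOn (fun z : ST => (z.1, rStar M ‖z.2‖)) {z : ST | L ≤ ‖z.2‖} :=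
      fun z hz => (hsm z (lt_of_lt_of_le hL hz)).continuousAt.continuousWithinAt
    exact hc.preimage_isClosed_of_isClosed (isClosed_le continuous_const continuous_snd.norm)
      (isClosed_tsupport χ)
  have hKc : IsCompact K := by
    obtain ⟨C, hC⟩ := hχc.isCompact.isBounded.exists_norm_le
    refine ((isCompact_Icc (a := -C) (b := C)).prod
      (isCompact_closedBall (0 : E3) (rOfStar M C))).of_isClosed_subset hKcl ?_
    rintro z ⟨hz1, hz2⟩
    have := hC _ hz2
    rw [Prod.norm_def, max_le_iff, Real.norm_eq_abs, Real.norm_eq_abs] at this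
    refine ⟨abs_le.mp this.1, ?_⟩
    rw [mem_closedBall_zero_iff, ← rOfStar_rStar hM (lt_of_lt_of_le hL hz1)]
    exact (strictMono_rOfStar hM).monotone (abs_le.mp this.2).2
  have hsuppK : tsupport φ ⊆ K := by
    refine closure_minimal (fun z hz => ?_) hKcl
    have hne : χ (z.1, rStar M ‖z.2‖) ≠ 0 := fun h => hz (by simp [hφ, h])
    have hm := subset_tsupport χ hne
    exact ⟨(hgt z (hχs hm)).le, hm⟩
  have hKD : K ⊆ interior D := fun z hz => hΩD z (hgt z (hχs hz.2)) (hχs hz.2)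
  have hφc : HasCompactSupport φ := hKc.of_isClosed_subset (isClosed_tsupport φ) hsuppK
  have hint := hu.2.2 φ hφsm hφc (hsuppK.trans hKD)
  -- The integrand of the weak equation depends only on t and r. Near r ≤ 2M the test function is
  -- zero, hence the second branch.
  set H : ℝ → ℝ → ℝ := fun t r =>
    if 2 * M < r then (lapse M r)⁻¹ / r ^ 2 * J (t, rStar M r) else 0 with hH
  have hpt : ∀ z : ST, cometric M Φ.height z.2 (fderiv ℝ u z) (fderiv ℝ φ z) - F (u z) * φ z =
      H z.1 ‖z.2‖ := by
    intro z
    rcases lt_or_ge (2 * M) ‖z.2‖ with hz | hz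
    swap
    · have h0 := hφ0 z (by linarith)
      rw [h0.fderiv_eq, h0.self_of_nhds]
      simp [hH, not_lt.mpr hz, cometric_zero_right]
    have hr : ‖z.2‖ ≠ 0 := by linarith
    have hf := (lapse_pos hM hz).ne'
    simp only [hH, if_pos hz]
    obtain ⟨A, hA, hA1, hA2⟩ := hasFDerivAt_radial hM hz
      (hχ.differentiable (by simp) (z.1, rStar M ‖z.2‖))
    rw [show fderiv ℝ φ z = A from hA.fderiv]
    by_cases hzΩ : (z.1, rStar M ‖z.2‖) ∈ Ω
    · have hzL := hgt z hzΩ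
      obtain ⟨B, hB, hB1, hB2⟩ := hasFDerivAt_radial hM hz
        ((hw.differentiableOn (by simp)).differentiableAt (hΩ.mem_nhds hzΩ))
      have hue : u =ᶠ[𝓝 z] fun z => w (z.1, rStar M ‖z.2‖) / ‖z.2‖ := by
        have h1 : ∀ᶠ z' in 𝓝 z, (z'.1, rStar M ‖z'.2‖) ∈ Ω :=
          (hsm z hz).continuousAt.eventually_mem (hΩ.mem_nhds hzΩ)
        filter_upwards [h1] with z' hz'
        exact huw z' (hgt z' hz') hz'
      have hdh : deriv Φ.height ‖z.2‖ = (lapse M ‖z.2‖)⁻¹ := by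
        rw [← (hasDerivAt_rStar hM hz).deriv]
        refine Filter.EventuallyEq.deriv_eq ?_
        filter_upwards [Ioi_mem_nhds hzL] with r hr
        exact hh r hr
      rw [hue.fderiv_eq, hB.fderiv, cometric_radial (norm_ne_zero_iff.mp hr) hf hdh hB2 hA2,
        hA1, hB1, huw z hzL hzΩ, hJ]
      simp only [rOfStar_rStar hM hz, hφ]
      field_simp
    · have hn : (z.1, rStar M ‖z.2‖) ∉ tsupport χ := fun h => hzΩ (hχs h)
      rw [fderiv_of_notMem_tsupport ℝ hn] at hA1 hA2
      rw [image_eq_zero_of_notMem_tsupport hn] at hA2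
      have hA0 : A = 0 := by
        ext Y
        · simpa using hA1
        · simpa using hA2 _
      rw [hA0, cometric_zero_right, hJ0 _ hn]
      simp [hφ, image_eq_zero_of_notMem_tsupport hn]
  simp only [hpt] at hint
  have hHi : Integrable fun z : ST => H z.1 ‖z.2‖ := by
    refine integrable_of_continuousOn_of_compact (U := {z : ST | (z.1, rStar M ‖z.2‖) ∈ Ω})
      (K := K) ?_ hKc (fun z hz => hχs hz.2) ?_
    · have heq : ∀ z ∈ {z : ST | (z.1, rStar M ‖z.2‖) ∈ Ω}, H z.1 ‖z.2‖ =
          (lapse M ‖z.2‖)⁻¹ / ‖z.2‖ ^ 2 * J (z.1, rStar M ‖z.2‖) := fun z hz => by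
        simp only [hH, if_pos (hL.trans (hgt z hz))]
      rw [continuousOn_congr heq]
      refine ContinuousOn.mul ?_ (hJc.comp (fun z hz =>
        (hsm z (hL.trans (hgt z hz))).continuousAt.continuousWithinAt) fun z hz => hz)
      intro z hz
      have hz' := hL.trans (hgt z hz)
      have hr : ‖z.2‖ ≠ 0 := by linarith
      have c1 : ContinuousAt (fun z : ST => lapse M ‖z.2‖) z :=
        ContinuousAt.comp (f := fun z : ST => ‖z.2‖) (g := lapse M) (hasDerivAt_lapse hr).continuousAt
          continuous_snd.norm.continuousAt
      exact ((c1.inv₀ (lapse_pos hM hz').ne').div (continuous_snd.norm.pow 2).continuousAt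
        (pow_ne_zero 2 hr)).continuousWithinAt
    · intro z hz
      simp only [hH]
      split_ifs with h2
      · rw [hJ0, mul_zero]
        exact fun h => hz ⟨(hgt z (hχs h)).le, h⟩
      · rfl
  rw [Measure.volume_eq_prod, integral_prod _ hHi] at hint
  -- Polar coordinates contribute r² dr, and dr* = f⁻¹ dr; together they cancel the weight f⁻¹ r⁻²
  -- in `H`.
  have hpolar : ∀ t, ∫ y : E3, H t ‖y‖ =
      3 * (volume : Measure E3).real (Metric.ball 0 1) * ∫ x, J (t, x) := by
    intro t
    rw [integral_fun_norm_addHaar]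
    simp only [finrank_euclideanSpace, Fintype.card_fin, Nat.add_one_sub_one, smul_eq_mul,
      nsmul_eq_mul, Nat.cast_ofNat]
    rw [mul_assoc]
    congr 2
    have h1 : ∫ r in Ioi 0, r ^ 2 * H t r = ∫ r in Ioi (2 * M), r ^ 2 * H t r := by
      refine setIntegral_eq_of_subset_of_forall_sdiff_eq_zero measurableSet_Ioi
        (Ioi_subset_Ioi (by linarith)) fun r hr => ?_
      simp only [hH, if_neg (show ¬ 2 * M < r from hr.2), mul_zero]
    have h2 := integral_image_eq_integral_abs_deriv_smul (s := Ioi (2 * M)) measurableSet_Ioi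
      (fun r hr => (hasDerivAt_rStar hM hr).hasDerivWithinAt) (strictMonoOn_rStar hM).injOn
      (fun x => J (t, x))
    rw [image_rStar hM, setIntegral_univ] at h2
    rw [h1, h2]
    refine setIntegral_congr_fun measurableSet_Ioi fun r hr => ?_
    have hr : 2 * M < r := hr
    have hr0 : r ≠ 0 := by linarith
    have hf := lapse_pos hM hr
    simp only [hH, if_pos hr, smul_eq_mul]
    rw [abs_of_pos (inv_pos.mpr hf)]
    field_simp
  simp only [hpolar] at hint
  rw [integral_const_mul] at hint
  rw [Measure.volume_eq_prod, integral_prod _ hJi]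
  have hpos : 0 < (volume : Measure E3).real (Metric.ball 0 1) :=
    ENNReal.toReal_pos (Metric.measure_ball_pos _ _ one_pos).ne' measure_ball_lt_top.ne
  exact (mul_eq_zero.mp hint).resolve_left (by positivity)

/-! ### The outgoing region, its characteristics and the initial values -/

/-- `L` is large in terms of the mass and the foliation: beyond `r = L` the slices are those of
constant `t`, and `r* ≤ 2L` up to there. -/
structure IsFar (Φ : Foliation M r₀) (L : ℝ) : Prop where
  mass : 2 * M + 1 ≤ L
  rStar_le : ∀ r, 0 ≤ r → r ≤ L → rStar M r ≤ 2 * L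
  height : ∀ r, L ≤ r → Φ.height r = rStar M r
  field : ∀ x : E3, L ≤ ‖x‖ → Φ.field x = (1, 0)

/-- The part of the half plane `t < T` of points `(t, r*)` between the two null lines that bound
the outgoing region. -/
def nullStrip (L T : ℝ) : Set (ℝ × ℝ) := {z | z.1 < T ∧ z.1 + 2 * L < z.2 ∧ z.2 + z.1 < 10 * L}

theorem isOpen_nullStrip (L T : ℝ) : IsOpen (nullStrip L T) :=
  (isOpen_lt continuous_fst continuous_const).inter
    ((isOpen_lt (continuous_fst.add continuous_const) continuous_snd).inter
      (isOpen_lt (continuous_snd.add continuous_fst) continuous_const))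

theorem mem_outgoingRegion_iff {L T : ℝ} {z : ST} : z ∈ outgoingRegion M L T ↔
    0 ≤ z.1 ∧ 2 * M < ‖z.2‖ ∧ (z.1, rStar M ‖z.2‖) ∈ nullStrip L T := by
  simp only [outgoingRegion, nullStrip, mem_ofPred_eq]
  tauto

theorem isOpen_radial_preimage {Ω : Set (ℝ × ℝ)} (hΩ : IsOpen Ω) :
    IsOpen {z : ST | 2 * M < ‖z.2‖ ∧ (z.1, rStar M ‖z.2‖) ∈ Ω} := by
  have hO : IsOpen {z : ST | 2 * M < ‖z.2‖} := isOpen_lt continuous_const continuous_snd.norm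
  have hc : ContinuousOn (fun z : ST => (z.1, rStar M ‖z.2‖)) {z : ST | 2 * M < ‖z.2‖} :=
    continuous_fst.continuousOn.prodMk
      (continuousOn_rStar.comp continuous_snd.norm.continuousOn fun z hz => hz)
  exact hc.isOpen_inter_preimage hO hΩ

/-- A closed half space cut by an open set, as `nullStrip` has no lower bound on t. This gives
unique derivatives at t = 0, where they are one-sided. -/
theorem outgoingRegion_eq (L T : ℝ) : outgoingRegion M L T =
    (Ici (0 : ℝ) ×ˢ (univ : Set E3)) ∩
      {z : ST | 2 * M < ‖z.2‖ ∧ (z.1, rStar M ‖z.2‖) ∈ nullStrip L T} := by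
  ext z
  rw [mem_outgoingRegion_iff]
  simp

theorem uniqueDiffOn_outgoingRegion (L T : ℝ) : UniqueDiffOn ℝ (outgoingRegion M L T) := by
  rw [outgoingRegion_eq]
  exact ((uniqueDiffOn_Ici 0).prod uniqueDiffOn_univ).inter
    (isOpen_radial_preimage (isOpen_nullStrip L T))

theorem mem_interior_outgoingRegion {L T : ℝ} {z : ST} (hz : z ∈ outgoingRegion M L T)
    (h0 : 0 < z.1) : z ∈ interior (outgoingRegion M L T) := by
  rw [mem_outgoingRegion_iff] at hz
  refine mem_interior.mpr ⟨{z : ST | 0 < z.1} ∩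
    {z : ST | 2 * M < ‖z.2‖ ∧ (z.1, rStar M ‖z.2‖) ∈ nullStrip L T}, ?_, ?_, h0, hz.2⟩
  · rintro z ⟨h1, h2⟩
    exact mem_outgoingRegion_iff.mpr ⟨le_of_lt h1, h2⟩
  · exact (isOpen_lt continuous_const continuous_fst).inter
      (isOpen_radial_preimage (isOpen_nullStrip L T))

/-- The point of space-time with coordinates `(t, r*)` on a fixed ray. -/
noncomputable def rayPoint (M : ℝ) (z : ℝ × ℝ) : ST := (z.1, rOfStar M z.2 • e 0)

theorem norm_e (i : Fin 3) : ‖e i‖ = 1 := by simp [e]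

theorem norm_rayPoint (hM : 0 < M) (z : ℝ × ℝ) : ‖(rayPoint M z).2‖ = rOfStar M z.2 := by
  have := rOfStar_gt hM z.2
  rw [rayPoint, norm_smul, norm_e, mul_one, Real.norm_eq_abs, abs_of_pos (by linarith)]

theorem contDiff_rayPoint (hM : 0 < M) : ContDiff ℝ 1 (rayPoint M) :=
  contDiff_fst.prodMk (((contDiff_rOfStar hM).comp contDiff_snd).smul contDiff_const)

theorem rayPoint_mem (hM : 0 < M) {L T : ℝ} {z : ℝ × ℝ} (h0 : 0 ≤ z.1) (hz : z ∈ nullStrip L T) :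
    rayPoint M z ∈ outgoingRegion M L T := by
  rw [mem_outgoingRegion_iff, norm_rayPoint hM, rStar_rOfStar hM]
  exact ⟨h0, rOfStar_gt hM _, hz⟩

/-- `w = r u` as a function of `(t, r*)`. -/
noncomputable def radialProfile (M : ℝ) (u : ST → ℝ) (z : ℝ × ℝ) : ℝ :=
  rOfStar M z.2 * u (rayPoint M z)

/-- The derivative `w_t + w_{r*}` of `w = r u`, taken in the region `D`. -/
noncomputable def outgoingDeriv (M : ℝ) (D : Set ST) (u : ST → ℝ) (z : ℝ × ℝ) : ℝ :=
  rOfStar M z.2 * fderivWithin ℝ u D (rayPoint M z) (1, 0) +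
    lapse M (rOfStar M z.2) * (u (rayPoint M z) +
      rOfStar M z.2 * fderivWithin ℝ u D (rayPoint M z) (0, e 0))

/-- The right hand side of the wave equation for `w`. -/
noncomputable def waveSource (M : ℝ) (F : ℝ → ℝ) (w : ℝ × ℝ → ℝ) (z : ℝ × ℝ) : ℝ :=
  lapse M (rOfStar M z.2) * (rOfStar M z.2 * F (w z / rOfStar M z.2) -
    2 * M / rOfStar M z.2 ^ 3 * w z)

theorem hasFDerivAt_radialProfile (hM : 0 < M) {L T : ℝ} {u : ST → ℝ}
    (hu : ContDiffOn ℝ 1 u (outgoingRegion M L T)) {z : ℝ × ℝ} (h0 : 0 < z.1)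
    (hz : z ∈ nullStrip L T) :
    ∃ A : ℝ × ℝ →L[ℝ] ℝ, HasFDerivAt (radialProfile M u) A z ∧
      A (1, 0) + A (0, 1) = outgoingDeriv M (outgoingRegion M L T) u z := by
  have hD := mem_interior_outgoingRegion (rayPoint_mem hM h0.le hz) h0
  have hD' : outgoingRegion M L T ∈ 𝓝 (rayPoint M z) := mem_interior_iff_mem_nhds.mp hD
  have hud : DifferentiableAt ℝ u (rayPoint M z) :=
    (hu.differentiableOn (by simp)).differentiableAt hD'
  have hρ := (hasDerivAt_rOfStar hM z.2).comp_hasFDerivAt z (hasFDerivAt_snd (𝕜 := ℝ) (E := ℝ))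
  have hι : HasFDerivAt (rayPoint M) _ z := hasFDerivAt_fst.prodMk (hρ.smul_const (e 0))
  have huι := hud.hasFDerivAt.comp z hι
  refine ⟨_, hρ.mul huι, ?_⟩
  have h2 : ∀ c : ℝ, fderiv ℝ u (rayPoint M z) (0, c • e 0) =
      c * fderiv ℝ u (rayPoint M z) (0, e 0) := by
    intro c
    rw [← smul_eq_mul, ← map_smul]
    simp
  rw [outgoingDeriv, fderivWithin_of_mem_nhds hD']
  simp [h2]
  ring

theorem continuousOn_radialProfile (hM : 0 < M) {L T : ℝ} {u : ST → ℝ}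
    (hu : ContDiffOn ℝ 1 u (outgoingRegion M L T)) :
    ContinuousOn (radialProfile M u) ({z | 0 ≤ z.1} ∩ nullStrip L T) :=
  ((continuous_rOfStar hM).comp continuous_snd).continuousOn.mul
    (hu.continuousOn.comp (contDiff_rayPoint hM).continuous.continuousOn
      fun _ hz => rayPoint_mem hM hz.1 hz.2)

/-- The reason for defining w_t + w_{r*} through `fderivWithin` of u: it stays continuous down to t
= 0, where the data are prescribed. -/
theorem continuousOn_outgoingDeriv (hM : 0 < M) {L T : ℝ} {u : ST → ℝ}
    (hu : ContDiffOn ℝ 1 u (outgoingRegion M L T)) :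
    ContinuousOn (outgoingDeriv M (outgoingRegion M L T) u)
      ({z | 0 ≤ z.1} ∩ nullStrip L T) := by
  have hι : ContinuousOn (rayPoint M) ({z | 0 ≤ z.1} ∩ nullStrip L T) :=
    (contDiff_rayPoint hM).continuous.continuousOn
  have hm : MapsTo (rayPoint M) ({z | 0 ≤ z.1} ∩ nullStrip L T) (outgoingRegion M L T) :=
    fun _ hz => rayPoint_mem hM hz.1 hz.2
  have hD := (hu.continuousOn_fderivWithin (uniqueDiffOn_outgoingRegion L T) (by simp)).comp hι hm
  have hρ : ContinuousOn (fun z : ℝ × ℝ => rOfStar M z.2) ({z | 0 ≤ z.1} ∩ nullStrip L T) :=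
    ((continuous_rOfStar hM).comp continuous_snd).continuousOn
  have hf : ContinuousOn (fun z : ℝ × ℝ => lapse M (rOfStar M z.2))
      ({z | 0 ≤ z.1} ∩ nullStrip L T) :=
    ((continuous_lapse_rOfStar hM).comp continuous_snd).continuousOn
  exact (hρ.mul (hD.clm_apply continuousOn_const)).add
    (hf.mul ((hu.continuousOn.comp hι hm).add (hρ.mul (hD.clm_apply continuousOn_const))))

/-- Along incoming null lines, `w_t + w_{r*}` is the integral of the right hand side. -/
theorem outgoingDeriv_sub_eq_integral (hM : 0 < M) {Φ : Foliation M r₀} {F : ℝ → ℝ}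
    (hF : Continuous F) {d : InitialData r₀} {L T : ℝ} (hL : IsFar Φ L) {u : ST → ℝ}
    (hu : IsSolutionOn Φ F d (outgoingRegion M L T) u)
    (hrad : ∀ s x y, (s, x) ∈ outgoingRegion M L T → ‖x‖ = ‖y‖ → u (s, x) = u (s, y))
    {t₀ t₁ y : ℝ} (h0 : 0 < t₀) (ht : t₀ ≤ t₁)
    (hseg : ∀ s ∈ Icc t₀ t₁, (s, y - s) ∈ nullStrip L T) :
    outgoingDeriv M (outgoingRegion M L T) u (t₁, y - t₁) -
      outgoingDeriv M (outgoingRegion M L T) u (t₀, y - t₀) =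
      ∫ s in t₀..t₁, waveSource M F (radialProfile M u) (s, y - s) := by
  set Ω : Set (ℝ × ℝ) := {z | 0 < z.1} ∩ nullStrip L T with hΩdef
  have hΩ : IsOpen Ω := (isOpen_lt continuous_const continuous_fst).inter (isOpen_nullStrip L T)
  have hsub : Ω ⊆ {z | 0 ≤ z.1} ∩ nullStrip L T := fun z hz =>
    ⟨show (0 : ℝ) ≤ z.1 from le_of_lt hz.1, hz.2⟩
  set w := radialProfile M u with hwdef
  have hρne : ∀ x, rOfStar M x ≠ 0 := fun x => by have := rOfStar_gt hM x; linarith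
  have hρc := continuous_rOfStar hM
  have hfc := continuous_lapse_rOfStar hM
  have hw : ContDiffOn ℝ 1 w Ω :=
    ((contDiff_rOfStar hM).comp contDiff_snd).contDiffOn.mul
      (hu.1.comp (contDiff_rayPoint hM).contDiffOn fun z hz => rayPoint_mem hM (le_of_lt hz.1) hz.2)
  have hwq : ∀ z ∈ Ω, fderiv ℝ w z (1, 0) + fderiv ℝ w z (0, 1) =
      outgoingDeriv M (outgoingRegion M L T) u z := by
    intro z hz
    obtain ⟨A, hA, hA'⟩ := hasFDerivAt_radialProfile hM hu.1 hz.1 hz.2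
    rw [hA.fderiv, hA']
  have hwc := (continuousOn_radialProfile hM hu.1).mono hsub
  have hGc : ContinuousOn (waveSource M F w) Ω := by
    have c1 : ContinuousOn (fun z : ℝ × ℝ => lapse M (rOfStar M z.2)) Ω :=
      (hfc.comp continuous_snd).continuousOn
    have c2 : ContinuousOn (fun z : ℝ × ℝ => rOfStar M z.2) Ω :=
      (hρc.comp continuous_snd).continuousOn
    exact c1.mul ((c2.mul (hF.comp_continuousOn (hwc.div c2 fun z _ => hρne z.2))).sub
      ((continuousOn_const.div (c2.pow 3) fun z _ => pow_ne_zero 3 (hρne z.2)).mul hwc))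
  refine transport_of_weak hΩ ((continuousOn_outgoingDeriv hM hu.1).mono hsub) hGc ?_ ht
    fun s hs => ⟨lt_of_lt_of_le h0 hs.1, hseg s hs⟩
  intro χ hχ hχc hχs
  have huw : ∀ z : ST, L < ‖z.2‖ → (z.1, rStar M ‖z.2‖) ∈ Ω →
      u z = w (z.1, rStar M ‖z.2‖) / ‖z.2‖ := by
    intro z hz hzΩ
    have hz2 : 2 * M < ‖z.2‖ := by linarith [hL.mass]
    have hne : ‖z.2‖ ≠ 0 := by linarith
    have hm := rayPoint_mem hM (le_of_lt hzΩ.1) hzΩ.2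
    rw [hwdef, radialProfile]
    simp only [rOfStar_rStar hM hz2]
    rw [mul_div_cancel_left₀ _ hne]
    refine (hrad _ _ z.2 hm ?_).symm
    have := norm_rayPoint hM (z.1, rStar M ‖z.2‖)
    rwa [rOfStar_rStar hM hz2] at this
  obtain ⟨hJi, hJ⟩ := weak_wave_of_radial hM hF hu hΩ (L := L) (by linarith [hL.mass])
    hL.rStar_le (fun z hz => by have := hz.1; have := hz.2.2.1; simp only [mem_ofPred_eq] at *; linarith)
    (fun z hz hzΩ => mem_interior_outgoingRegion (mem_outgoingRegion_iff.mpr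
      ⟨le_of_lt hzΩ.1, by linarith [hL.mass], hzΩ.2⟩) hzΩ.1)
    (fun r hr => hL.height r hr.le) hw huw hχ hχc hχs (fun z => rfl)
  -- Here κ = f/r is the r*-derivative of log r, and κ² + κ' = 2M f / r³ is the potential in
  -- `waveSource`.
  have hκ : ∀ x, HasDerivAt (fun x => lapse M (rOfStar M x) / rOfStar M x)
      (lapse M (rOfStar M x) * (2 * M / rOfStar M x - lapse M (rOfStar M x)) / rOfStar M x ^ 2)
      x := by
    intro x
    have h1 := hasDerivAt_rOfStar hM x
    have h2 := ((hasDerivAt_lapse (M := M) (hρne x)).comp x h1).div h1 (hρne x)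
    refine h2.congr_deriv ?_
    have := hρne x
    simp only [Function.comp_apply]
    field_simp
  have hκc : Continuous fun x =>
      lapse M (rOfStar M x) * (2 * M / rOfStar M x - lapse M (rOfStar M x)) / rOfStar M x ^ 2 :=
    (hfc.mul ((continuous_const.div hρc hρne).sub hfc)).div (hρc.pow 2)
      fun x => pow_ne_zero 2 (hρne x)
  have key := weak_transport_of_weak_wave hΩ hw hκ hκc hχ hχc hχs hJ hJi
  rw [← key]
  refine integral_congr_ae (Eventually.of_forall fun z => ?_)
  simp only
  by_cases hz : z ∈ tsupport χ
  · rw [hwq z (hχs hz)]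
    congr 2
    rw [waveSource]
    have := hρne z.2
    field_simp
    ring
  · rw [image_eq_zero_of_notMem_tsupport hz, fderiv_of_notMem_tsupport ℝ hz]
    simp

/-- The initial values of `w` and `w_t + w_{r*}`, for data that are powers of `r`. -/
theorem radialProfile_initial (hM : 0 < M) {Φ : Foliation M r₀} {F : ℝ → ℝ}
    {d : InitialData r₀} {L T : ℝ} (hL : IsFar Φ L) {a₀ a₁ α : ℝ}
    (hd : ∀ x : E3, L ≤ ‖x‖ → ‖x‖ ≤ 10 * L →
      d.u₀ x = a₀ * ‖x‖ ^ (-α - 1) ∧ d.u₁ x = a₁ * ‖x‖ ^ (-α - 2)) {u : ST → ℝ}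
    (hu : IsSolutionOn Φ F d (outgoingRegion M L T) u) {x : ℝ} (hx : (0, x) ∈ nullStrip L T) :
    L < rOfStar M x ∧ rOfStar M x < 10 * L ∧
      radialProfile M u (0, x) = a₀ * rOfStar M x ^ (-α) ∧
      outgoingDeriv M (outgoingRegion M L T) u (0, x) =
        (a₁ - lapse M (rOfStar M x) * α * a₀) * rOfStar M x ^ (-α - 1) := by
  set r := rOfStar M x with hr
  have hr2 : 2 * M < r := rOfStar_gt hM x
  have hr0 : 0 < r := by linarith
  have hxr : rStar M r = x := rStar_rOfStar hM x
  have hx1 : 2 * L < x := by have := hx.2.1; simp only at this; linarith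
  have hx2 : x < 10 * L := by have := hx.2.2; simp only at this; linarith
  have hLr : L < r := by
    by_contra hn
    have := hL.rStar_le r hr0.le (not_lt.mp hn)
    linarith
  have hrL : r < 10 * L := by
    have hlog : 0 ≤ Real.log (r - 2 * M) := Real.log_nonneg (by linarith [hL.mass])
    have : r ≤ rStar M r := by rw [rStar]; nlinarith
    linarith
  have hnorm : ∀ s : ℝ, 0 < s → ‖s • e 0‖ = s := fun s hs => by
    rw [norm_smul, norm_e, mul_one, Real.norm_eq_abs, abs_of_pos hs]
  have hm : rayPoint M (0, x) ∈ outgoingRegion M L T := rayPoint_mem hM le_rfl hx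
  have hmr : ((0 : ℝ), r • e 0) ∈ outgoingRegion M L T := hm
  have hu0 : ∀ s : ℝ, L < s → s < 10 * L → (0, s • e 0) ∈ outgoingRegion M L T →
      u (0, s • e 0) = a₀ * s ^ (-α - 1) := by
    intro s h1 h2 h3
    have hs : 0 < s := by linarith
    rw [(hu.2.1 _ h3).1, (hd _ (by rw [hnorm s hs]; exact h1.le)
      (by rw [hnorm s hs]; exact h2.le)).1, hnorm s hs]
  have hDt : fderivWithin ℝ u (outgoingRegion M L T) (0, r • e 0) (1, 0) = a₁ * r ^ (-α - 2) := by
    have h1 := (hu.2.1 _ hmr).2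
    rw [hL.field _ (by rw [hnorm r hr0]; exact hLr.le)] at h1
    rw [h1, (hd _ (by rw [hnorm r hr0]; exact hLr.le) (by rw [hnorm r hr0]; exact hrL.le)).2,
      hnorm r hr0]
  have hev : ∀ᶠ s : ℝ in 𝓝 r, ((0 : ℝ), s • e 0) ∈ outgoingRegion M L T := by
    have hc : Continuous fun s : ℝ => ((0 : ℝ), s • e 0) := by fun_prop
    have h1 := hc.continuousAt.eventually_mem
      ((isOpen_radial_preimage (M := M) (isOpen_nullStrip L T)).mem_nhds
        (mem_outgoingRegion_iff.mp hmr).2)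
    filter_upwards [h1] with s hs
    exact mem_outgoingRegion_iff.mpr ⟨le_rfl, hs⟩
  -- The path s ↦ (0, s e₀) stays in the region for s near r, so the within-derivative in the radial
  -- direction is the ordinary derivative of the initial data along the ray.
  have hDr : fderivWithin ℝ u (outgoingRegion M L T) (0, r • e 0) (0, e 0) =
      a₀ * ((-α - 1) * r ^ (-α - 2)) := by
    have hγ : HasDerivAt (fun s : ℝ => ((0 : ℝ), s • e 0)) ((0 : ℝ), e 0) r := by
      have := (hasDerivAt_const r (0 : ℝ)).prodMk ((hasDerivAt_id r).smul_const (e 0))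
      simpa using this
    have h1 : HasDerivAt (fun s : ℝ => u (0, s • e 0))
        (fderivWithin ℝ u (outgoingRegion M L T) (0, r • e 0) (0, e 0)) r :=
      (((hu.1.differentiableOn (by simp)) _ hmr).hasFDerivWithinAt.comp_hasDerivWithinAt r
        hγ.hasDerivWithinAt (s := {s | ((0 : ℝ), s • e 0) ∈ outgoingRegion M L T})
        fun s hs => hs).hasDerivAt hev
    have h2 : HasDerivAt (fun s : ℝ => u (0, s • e 0)) (a₀ * ((-α - 1) * r ^ (-α - 1 - 1))) r := by
      refine ((Real.hasDerivAt_rpow_const (Or.inl hr0.ne')).const_mul a₀).congr_of_eventuallyEq ?_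
      filter_upwards [hev, Ioo_mem_nhds hLr hrL] with s hs hs2
      exact hu0 s hs2.1 hs2.2 hs
    rw [h1.unique h2]
    ring_nf
  have e1 : r * r ^ (-α - 1) = r ^ (-α) := by
    rw [mul_comm, ← Real.rpow_add_one hr0.ne']; ring_nf
  have e2 : r * r ^ (-α - 2) = r ^ (-α - 1) := by
    rw [mul_comm, ← Real.rpow_add_one hr0.ne']; ring_nf
  refine ⟨hLr, hrL, ?_, ?_⟩
  · rw [radialProfile, rayPoint]
    simp only [← hr]
    rw [hu0 r hLr hrL hmr]
    linear_combination a₀ * e1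
  · rw [outgoingDeriv, rayPoint]
    simp only [← hr]
    rw [hDt, hDr, hu0 r hLr hrL hmr]
    linear_combination (a₁ + lapse M r * a₀ * (-α - 1)) * e2

/-! ### Comparison with an explicit profile, and blow-up -/

/-- Comparison of a solution of `(∂ₜ - ∂ₓ)(∂ₜ + ∂ₓ) w = G` with a function `W(t)`, where
`G ≥ W''` as long as `w ≥ W`. -/
theorem lt_of_wave_comparison {L T τ : ℝ} {w q G : ℝ × ℝ → ℝ} {W W' W'' : ℝ → ℝ}
    (hwc : ContinuousOn w ({z | 0 ≤ z.1} ∩ nullStrip L T))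
    (hqc : ContinuousOn q ({z | 0 ≤ z.1} ∩ nullStrip L T))
    (hGc : ContinuousOn G ({z | 0 ≤ z.1} ∩ nullStrip L T))
    (hwq : ∀ s c, 0 < s → (s, c + s) ∈ nullStrip L T →
      HasDerivAt (fun s => w (s, c + s)) (q (s, c + s)) s)
    (htr : ∀ t₀ t₁ y, 0 < t₀ → t₀ ≤ t₁ → (∀ s ∈ Icc t₀ t₁, (s, y - s) ∈ nullStrip L T) →
      q (t₁, y - t₁) - q (t₀, y - t₀) = ∫ s in t₀..t₁, G (s, y - s))
    (hW : ∀ t < τ, HasDerivAt W (W' t) t) (hW' : ∀ t < τ, HasDerivAt W' (W'' t) t)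
    (hW'' : ContinuousOn W'' (Iio τ))
    (hG : ∀ z ∈ nullStrip L T, 0 ≤ z.1 → z.1 < τ → W z.1 ≤ w z → W'' z.1 ≤ G z)
    (h0 : ∀ x, (0, x) ∈ nullStrip L T → W 0 < w (0, x) ∧ W' 0 ≤ q (0, x))
    {z : ℝ × ℝ} (hz : z ∈ nullStrip L T) (hz0 : 0 ≤ z.1) (hzτ : z.1 < τ) : W z.1 < w z := by
  by_contra hcon
  -- The backward characteristic triangle with apex z, closed under descending along either family
  -- of characteristics as long as t ≥ 0.
  set K : Set (ℝ × ℝ) := {y | 0 ≤ y.1 ∧ z.2 - z.1 ≤ y.2 - y.1 ∧ y.2 + y.1 ≤ z.2 + z.1} with hK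
  have hK1 : ∀ y ∈ K, y.1 ≤ z.1 := fun y hy => by linarith [hy.2.1, hy.2.2]
  have hKS : ∀ y ∈ K, y ∈ nullStrip L T := by
    intro y hy
    have := hK1 y hy
    obtain ⟨a, b, c⟩ := hz
    exact ⟨by linarith, by linarith [hy.2.1], by linarith [hy.2.2]⟩
  have hKsub : K ⊆ {z | 0 ≤ z.1} ∩ nullStrip L T := fun y hy => ⟨hy.1, hKS y hy⟩
  have hKcl : IsClosed K :=
    (isClosed_le continuous_const continuous_fst).inter
      ((isClosed_le continuous_const (continuous_snd.sub continuous_fst)).inter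
        (isClosed_le (continuous_snd.add continuous_fst) continuous_const))
  have hKc : IsCompact K := by
    refine ((isCompact_Icc (a := 0) (b := z.1)).prod
      (isCompact_Icc (a := z.2 - z.1) (b := z.2 + z.1))).of_isClosed_subset hKcl fun y hy => ?_
    exact ⟨⟨hy.1, hK1 y hy⟩, by linarith [hy.1, hy.2.1], by linarith [hy.1, hy.2.2]⟩
  have hWc : ContinuousOn (fun y : ℝ × ℝ => W y.1) K := fun y hy =>
    ((hW y.1 (lt_of_le_of_lt (hK1 y hy) hzτ)).continuousAt.comp
      continuous_fst.continuousAt).continuousWithinAt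
  set B : Set (ℝ × ℝ) := K ∩ (fun y => w y - W y.1) ⁻¹' Iic 0 with hB
  have hBcl : IsClosed B :=
    ((hwc.mono hKsub).sub hWc).preimage_isClosed_of_isClosed hKcl isClosed_Iic
  have hBc : IsCompact B := hKc.of_isClosed_subset hBcl inter_subset_left
  have hzB : z ∈ B := ⟨⟨hz0, le_rfl, le_rfl⟩, by
    simp only [mem_preimage, mem_Iic]; linarith [not_lt.mp hcon]⟩
  -- A point of K of least time where w ≤ W. At earlier times in K the bound w > W holds, and with
  -- it G ≥ W''.
  obtain ⟨m, hmB, hmin⟩ := hBc.exists_isMinOn ⟨z, hzB⟩ continuous_fst.continuousOn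
  have hmK := hmB.1
  have hm0' : w m - W m.1 ≤ 0 := hmB.2
  have hgood : ∀ y ∈ K, y.1 < m.1 → W y.1 < w y := by
    intro y hy hlt
    by_contra hn
    have : m.1 ≤ y.1 := hmin (show y ∈ B from ⟨hy, by
      simp only [mem_preimage, mem_Iic]; linarith [not_lt.mp hn]⟩)
    linarith
  have hmτ : m.1 < τ := lt_of_le_of_lt (hK1 m hmK) hzτ
  set c := m.2 - m.1 with hc
  have hcone : ∀ s y, 0 ≤ s → s ≤ m.1 → c ≤ y - s → y + s ≤ m.2 + m.1 → (s, y) ∈ K := by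
    intro s y h1 h2 h3 h4
    exact ⟨h1, by linarith [hmK.2.1], by linarith [hmK.2.2]⟩
  have hq : ∀ s, 0 < s → s < m.1 → W' s ≤ q (s, c + s) := by
    intro s hs0 hs
    -- The label of the incoming line through (s, c + s).
    set y := c + 2 * s with hy
    have hpt : ∀ σ, 0 ≤ σ → σ ≤ s → (σ, y - σ) ∈ K := fun σ h1 h2 =>
      hcone σ _ h1 (by linarith) (by linarith) (by linarith)
    have hstep : ∀ t, 0 < t → t ≤ s → q (t, y - t) - W' t ≤ q (s, y - s) - W' s := by
      intro t ht0 hts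
      have h1 := htr t s y ht0 hts fun σ hσ => hKS _ (hpt σ (by linarith [hσ.1]) hσ.2)
      have hIcc : uIcc t s = Icc t s := uIcc_of_le hts
      have hcW : ContinuousOn W'' (uIcc t s) := by
        rw [hIcc]
        exact hW''.mono fun σ hσ => lt_of_le_of_lt hσ.2 (by linarith)
      have h2 : ∫ σ in t..s, W'' σ = W' s - W' t :=
        intervalIntegral.integral_eq_sub_of_hasDerivAt (fun σ hσ => by
          rw [hIcc] at hσ; exact hW' σ (by linarith [hσ.2])) hcW.intervalIntegrable
      have h3 : ∫ σ in t..s, W'' σ ≤ ∫ σ in t..s, G (σ, y - σ) := by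
        refine intervalIntegral.integral_mono_on hts hcW.intervalIntegrable
          (ContinuousOn.intervalIntegrable ?_) fun σ hσ => ?_
        · rw [hIcc]
          exact hGc.comp (by fun_prop) fun σ hσ => hKsub (hpt σ (by linarith [hσ.1]) hσ.2)
        · have hm := hpt σ (by linarith [hσ.1]) hσ.2
          exact hG _ (hKS _ hm) hm.1 (show σ < τ by linarith [hσ.2])
            (hgood _ hm (show σ < m.1 by linarith [hσ.2])).le
      linarith
    -- The identity along the incoming line is known only from positive times on; continuity of q
    -- reaches the initial line.
    have hcont : Tendsto (fun t => q (t, y - t) - W' t) (𝓝[Icc 0 s] 0) (𝓝 (q (0, y - 0) - W' 0)) := by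
      have h1 : ContinuousOn (fun t => q (t, y - t)) (Icc 0 s) :=
        hqc.comp (by fun_prop) fun σ hσ => hKsub (hpt σ hσ.1 hσ.2)
      exact (h1 0 ⟨le_rfl, hs0.le⟩).sub (hW' 0 (by linarith)).continuousAt.continuousWithinAt
    have hcont' : Tendsto (fun t => q (t, y - t) - W' t) (𝓝[>] 0) (𝓝 (q (0, y - 0) - W' 0)) := by
      refine hcont.mono_left ?_
      rw [← nhdsWithin_Ioc_eq_nhdsGT hs0]
      exact nhdsWithin_mono _ Ioc_subset_Icc_self
    have hle : q (0, y - 0) - W' 0 ≤ q (s, y - s) - W' s := by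
      refine le_of_tendsto hcont' ?_
      filter_upwards [Ioc_mem_nhdsGT hs0] with t ht
      exact hstep t ht.1 ht.2
    have h00 := (h0 (y - 0) (hKS _ (hpt 0 le_rfl hs0.le))).2
    have hys : y - s = c + s := by rw [hy]; ring
    rw [hys] at hle
    linarith
  have hm1 : 0 < m.1 := by
    refine lt_of_le_of_ne hmK.1 fun h => ?_
    have hm : m = (0, m.2) := by ext <;> simp [← h]
    have := (h0 m.2 (by rw [← hm]; exact hKS m hmK)).1
    rw [← hm] at this
    rw [← h] at hm0'
    linarith
  have hpath : ∀ s, 0 ≤ s → s ≤ m.1 → (s, c + s) ∈ K := fun s h1 h2 =>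
    hcone s _ h1 h2 (by linarith) (by linarith)
  -- As W depends on t only, w − W has derivative q − W' ≥ 0 along the outgoing line ending at m. It
  -- starts positive, so it cannot be nonpositive at m.
  have hmono : MonotoneOn (fun s => w (s, c + s) - W s) (Icc 0 m.1) := by
    have hder : ∀ s ∈ interior (Icc 0 m.1), HasDerivAt (fun s => w (s, c + s) - W s)
        (q (s, c + s) - W' s) s := by
      intro s hs
      rw [interior_Icc] at hs
      exact (hwq s c hs.1 (hKS _ (hpath s hs.1.le hs.2.le))).sub (hW s (by linarith [hs.2]))
    refine monotoneOn_of_deriv_nonneg (convex_Icc _ _) ?_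
      (fun s hs => (hder s hs).differentiableAt.differentiableWithinAt) fun s hs => ?_
    · refine ContinuousOn.sub (hwc.comp (by fun_prop) fun s hs => hKsub (hpath s hs.1 hs.2))
        fun s hs => (hW s (lt_of_le_of_lt hs.2 hmτ)).continuousAt.continuousWithinAt
    · rw [(hder s hs).deriv]
      rw [interior_Icc] at hs
      linarith [hq s hs.1 hs.2]
  have hfin := hmono (left_mem_Icc.mpr hm1.le) (right_mem_Icc.mpr hm1.le) hm1.le
  have h00 := (h0 (c + 0) (hKS _ (hpath 0 le_rfl hm1.le))).1
  have hmm : (m.1, c + m.1) = m := by ext <;> simp [hc]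
  simp only [hmm] at hfin
  linarith

/-- Since r* > 2L, the radius exceeds L; then log(r − 2M) ≥ 0 by `IsFar.mass`, so r ≤ r* < 10L. -/
theorem rOfStar_bounds (hM : 0 < M) {Φ : Foliation M r₀} {L T : ℝ} (hL : IsFar Φ L) {z : ℝ × ℝ}
    (h0 : 0 ≤ z.1) (hz : z ∈ nullStrip L T) : L < rOfStar M z.2 ∧ rOfStar M z.2 < 10 * L := by
  obtain ⟨_, h1, h2⟩ := hz
  have hr := rOfStar_gt hM z.2
  have hx := rStar_rOfStar hM z.2
  have hlt : L < rOfStar M z.2 := by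
    by_contra hn
    have := hL.rStar_le _ (by linarith) (not_lt.mp hn)
    linarith
  refine ⟨hlt, ?_⟩
  have hlog : 0 ≤ Real.log (rOfStar M z.2 - 2 * M) := Real.log_nonneg (by linarith [hL.mass])
  have : rOfStar M z.2 ≤ rStar M (rOfStar M z.2) := by rw [rStar]; nlinarith
  linarith

theorem hasDerivAt_blowup_profile {B τ k t : ℝ} (ht : t < τ) :
    HasDerivAt (fun t => B * (τ - t) ^ (-k)) (B * k * (τ - t) ^ (-(k + 1))) t := by
  have h1 : HasDerivAt (fun t => τ - t) (-1) t := (hasDerivAt_id t).const_sub τ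
  have h2 := (h1.rpow_const (p := -k) (Or.inl (by linarith))).const_mul B
  refine h2.congr_deriv ?_
  rw [show -(k + 1) = -k - 1 by ring]
  ring

/-- The right hand side of the wave equation dominates `W''` for the blow-up profile
`W(t) = 10 b L (3L - t)^{-k}`, as long as `w ≥ W`. -/
theorem profile_le_waveSource (hM : 0 < M) {Φ : Foliation M r₀} {F : ℝ → ℝ} {p k b L T : ℝ}
    (hp : 1 < p) (hk : k * (p - 1) = 2) (hb : 0 < b) (hbp : b ^ (p - 1) = 4 * (k * (k + 1)))
    (hFp : ∀ u > 0, F u = u ^ p) (hL : IsFar Φ L) (hL4 : 4 * M ≤ L) (hLk : 9 * M ≤ k * (k + 1) * L)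
    {w : ℝ × ℝ → ℝ} {z : ℝ × ℝ} (hz : z ∈ nullStrip L T) (h0 : 0 ≤ z.1) (ht : z.1 < 3 * L)
    (hw : 10 * b * L * (3 * L - z.1) ^ (-k) ≤ w z) :
    10 * b * L * k * (k + 1) * (3 * L - z.1) ^ (-(k + 1 + 1)) ≤ waveSource M F w z := by
  obtain ⟨hr1, hr2⟩ := rOfStar_bounds hM hL h0 hz
  rw [waveSource]
  set r := rOfStar M z.2 with hr
  have hL0 : 0 < L := by linarith
  have hr0 : 0 < r := by linarith
  have hkpos : 0 < k := by
    by_contra hn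
    nlinarith [not_lt.mp hn]
  set s := 3 * L - z.1 with hs
  have hs0 : 0 < s := by linarith
  have hsL : s ≤ 3 * L := by linarith
  -- The lapse costs a factor 1/2 and the potential at most half of u^{p−1}; this accounts for the 4
  -- in `hbp`.
  have hf : 1 / 2 ≤ lapse M r := by
    rw [lapse]
    have : 2 * M / r ≤ 1 / 2 := by rw [div_le_iff₀ hr0]; linarith
    linarith
  have hsk : 0 < s ^ (-k) := Real.rpow_pos_of_pos hs0 _
  set W := 10 * b * L * s ^ (-k) with hW
  have hW0 : 0 < W := by positivity
  have hw0 : 0 < w z := lt_of_lt_of_le hW0 hw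
  set u := w z / r with hu
  have hu0 : 0 < u := by positivity
  have hwu : w z = r * u := by rw [hu]; field_simp
  -- The factor 10L in W is the upper bound of r, so w ≥ W turns into a bound for u that does not
  -- involve r.
  have hub : b * s ^ (-k) ≤ u := by
    rw [hu, le_div_iff₀ hr0]
    calc b * s ^ (-k) * r ≤ b * s ^ (-k) * (10 * L) := by gcongr
      _ = W := by rw [hW]; ring
      _ ≤ w z := hw
  have hup : 4 * (k * (k + 1)) * (s ^ 2)⁻¹ ≤ u ^ (p - 1) := by
    have h1 : (b * s ^ (-k)) ^ (p - 1) ≤ u ^ (p - 1) :=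
      Real.rpow_le_rpow (by positivity) hub (by linarith)
    rw [Real.mul_rpow hb.le hsk.le, hbp, ← Real.rpow_mul hs0.le, neg_mul, hk, Real.rpow_neg hs0.le,
      Real.rpow_two] at h1
    exact h1
  -- From s ≤ 3L, u^{p−1} is at least 4k(k+1)/(9L²); with r > L this beats the potential once 9M ≤
  -- k(k+1)L.
  have hpot : 4 * M / r ^ 3 ≤ u ^ (p - 1) := by
    refine le_trans ?_ hup
    rw [div_le_iff₀ (by positivity), mul_assoc, ← div_eq_inv_mul, ← mul_div_assoc,
      le_div_iff₀ (by positivity)]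
    have h1 : s ^ 2 ≤ 9 * L ^ 2 := by nlinarith
    have h2 : L ^ 3 ≤ r ^ 3 := by gcongr
    calc 4 * M * s ^ 2 ≤ 4 * M * (9 * L ^ 2) := by gcongr
      _ = 4 * (9 * M) * L ^ 2 := by ring
      _ ≤ 4 * (k * (k + 1) * L) * L ^ 2 := by gcongr
      _ = 4 * (k * (k + 1)) * L ^ 3 := by ring
      _ ≤ 4 * (k * (k + 1)) * r ^ 3 := by gcongr
  have hFu : F u = u * u ^ (p - 1) := by
    rw [hFp u hu0, ← Real.rpow_one_add' hu0.le (by linarith)]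
    ring_nf
  have hsum : s ^ (-(k + 1 + 1)) = s ^ (-k) * (s ^ 2)⁻¹ := by
    rw [show -(k + 1 + 1) = -k + -2 by ring, Real.rpow_add hs0, Real.rpow_neg hs0.le 2,
      Real.rpow_two]
  have hbr : r * F u - 2 * M / r ^ 3 * w z = w z * (u ^ (p - 1) - 2 * M / r ^ 3) := by
    rw [hFu, hwu]; ring
  rw [hbr, hsum]
  have h4 : 4 * M / r ^ 3 = 2 * (2 * M / r ^ 3) := by ring
  have h5 : u ^ (p - 1) / 2 ≤ u ^ (p - 1) - 2 * M / r ^ 3 := by linarith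
  have hupos : 0 < u ^ (p - 1) := Real.rpow_pos_of_pos hu0 _
  calc 10 * b * L * k * (k + 1) * (s ^ (-k) * (s ^ 2)⁻¹)
      = 1 / 2 * (W * (4 * (k * (k + 1)) * (s ^ 2)⁻¹ / 2)) := by rw [hW]; ring
    _ ≤ lapse M r * (w z * (u ^ (p - 1) - 2 * M / r ^ 3)) := by
      have : 4 * (k * (k + 1)) * (s ^ 2)⁻¹ / 2 ≤ u ^ (p - 1) - 2 * M / r ^ 3 := by linarith
      gcongr

/-- Blow-up in the outgoing region for large power data. -/
theorem blowup_outgoingRegion (hM : 0 < M) {Φ : Foliation M r₀} {F : ℝ → ℝ} (hF : Continuous F)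
    {p k b α a₀ a₁ L T : ℝ}
    (hp : 1 < p) (hk : k * (p - 1) = 2) (hb : 0 < b) (hbp : b ^ (p - 1) = 4 * (k * (k + 1)))
    (hFp : ∀ u > 0, F u = u ^ p) (hL : IsFar Φ L) (hL4 : 4 * M ≤ L) (hLk : 9 * M ≤ k * (k + 1) * L)
    (hα : 0 ≤ α) (hαk : α ≤ k - 1) (ha₀ : 10 ^ k * b < a₀) (ha₁ : 10 ^ (k + 1) * b * k ≤ a₁ - k * a₀)
    {d : InitialData r₀}
    (hd : ∀ x : E3, L ≤ ‖x‖ → ‖x‖ ≤ 10 * L →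
      d.u₀ x = a₀ * ‖x‖ ^ (-α - 1) ∧ d.u₁ x = a₁ * ‖x‖ ^ (-α - 2))
    {u : ST → ℝ} (hu : IsSolutionOn Φ F d (outgoingRegion M L T) u)
    (hrad : ∀ s x y, (s, x) ∈ outgoingRegion M L T → ‖x‖ = ‖y‖ → u (s, x) = u (s, y)) :
    (∀ z ∈ outgoingRegion M L T, 0 < u z) ∧ T ≤ 3 * L := by
  have hL1 : 1 ≤ L := by linarith [hL.mass]
  have hL0 : 0 < L := by linarith
  have hkpos : 0 < k := by linarith
  have hρne : ∀ x, rOfStar M x ≠ 0 := fun x => by have := rOfStar_gt hM x; linarith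
  have hwc := continuousOn_radialProfile hM hu.1
  have hGc : ContinuousOn (waveSource M F (radialProfile M u)) ({z | 0 ≤ z.1} ∩ nullStrip L T) := by
    have c1 : Continuous fun z : ℝ × ℝ => lapse M (rOfStar M z.2) :=
      (continuous_lapse_rOfStar hM).comp continuous_snd
    have c2 : ContinuousOn (fun z : ℝ × ℝ => rOfStar M z.2) ({z | 0 ≤ z.1} ∩ nullStrip L T) :=
      ((continuous_rOfStar hM).comp continuous_snd).continuousOn
    exact c1.continuousOn.mul ((c2.mul (hF.comp_continuousOn (hwc.div c2 fun z _ => hρne z.2))).sub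
      ((continuousOn_const.div (c2.pow 3) fun z _ => pow_ne_zero 3 (hρne z.2)).mul hwc))
  have hcmp : ∀ z ∈ nullStrip L T, 0 ≤ z.1 → z.1 < 3 * L →
      10 * b * L * (3 * L - z.1) ^ (-k) < radialProfile M u z := by
    intro z hz hz0 hzτ
    refine lt_of_wave_comparison (τ := 3 * L) (q := outgoingDeriv M (outgoingRegion M L T) u)
      (W := fun t => 10 * b * L * (3 * L - t) ^ (-k)) hwc (continuousOn_outgoingDeriv hM hu.1) hGc
      ?_ (fun t₀ t₁ y h1 h2 h3 => outgoingDeriv_sub_eq_integral hM hF hL hu hrad h1 h2 h3)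
      (fun t ht => hasDerivAt_blowup_profile ht) (fun t ht => hasDerivAt_blowup_profile ht) ?_
      (fun z hz h1 h2 h3 => profile_le_waveSource hM hp hk hb hbp hFp hL hL4 hLk hz h1 h2 h3) ?_ hz
      hz0 hzτ
    · intro s c hs hsc
      obtain ⟨A, hA, hA'⟩ := hasFDerivAt_radialProfile hM hu.1 (z := (s, c + s)) hs hsc
      rw [← hA', ← map_add]
      have hγ : HasDerivAt (fun s : ℝ => (s, c + s)) ((1 : ℝ), (1 : ℝ)) s :=
        (hasDerivAt_id s).prodMk ((hasDerivAt_id s).const_add c)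
      have := hA.comp_hasDerivAt s hγ
      simpa using! this
    · refine continuousOn_const.mul (ContinuousOn.rpow_const (by fun_prop) fun t ht => Or.inl ?_)
      have : t < 3 * L := ht
      linarith
    · intro x hx
      obtain ⟨h1, h2, h3, h4⟩ := radialProfile_initial hM hL hd hu hx
      rw [h3, h4]
      set r := rOfStar M x
      have hr0 : 0 < r := by linarith
      have hten : (0 : ℝ) < 10 ^ k := by positivity
      have hf0 : 0 ≤ lapse M r := (lapse_pos hM (by linarith)).le
      have hf1 : lapse M r ≤ 1 := by
        rw [lapse]
        have : 0 ≤ 2 * M / r := by positivity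
        linarith
      -- Because r < 10L and 10L ≥ 1, powers of r may be replaced by the larger decay rates k − 1
      -- and k, which are those of W(0) and W'(0) in L.
      have hpow : ∀ m n : ℝ, 0 ≤ m → m ≤ n → (10 : ℝ) ^ (-n) * L ^ (-n) ≤ r ^ (-m) := by
        intro m n hm hmn
        rw [← Real.mul_rpow (by norm_num) hL0.le]
        calc (10 * L) ^ (-n) ≤ (10 * L) ^ (-m) :=
              Real.rpow_le_rpow_of_exponent_le (by linarith) (by linarith)
          _ ≤ r ^ (-m) := Real.rpow_le_rpow_of_nonpos hr0 h2.le (by linarith)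
      have hW : ∀ n : ℝ, 0 ≤ n → (3 * L) ^ (-n) ≤ L ^ (-n) := fun n hn =>
        Real.rpow_le_rpow_of_nonpos hL0 (by linarith) (by linarith)
      have hten' : (10 : ℝ) ^ (-k) * 10 ^ k = 1 := by
        rw [← Real.rpow_add (by norm_num)]; simp
      have hLk1 : L * L ^ (-k) = L ^ (-(k - 1)) := by
        rw [mul_comm, ← Real.rpow_add_one hL0.ne']; ring_nf
      have hLk2 : L * L ^ (-(k + 1)) = L ^ (-k) := by
        rw [mul_comm, ← Real.rpow_add_one hL0.ne']; ring_nf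
      have hten1 : (10 : ℝ) ^ (-(k - 1)) = 10 * 10 ^ (-k) := by
        rw [mul_comm, ← Real.rpow_add_one (by norm_num)]; ring_nf
      have hten2 : (10 : ℝ) ^ (k + 1) = 10 * 10 ^ k := by
        rw [mul_comm, ← Real.rpow_add_one (by norm_num)]
      simp only [sub_zero]
      constructor
      · calc 10 * b * L * (3 * L) ^ (-k) ≤ 10 * b * L * L ^ (-k) := by
              exact mul_le_mul_of_nonneg_left (hW k hkpos.le) (by positivity)
          _ = 10 * (10 ^ (-k) * (10 ^ k * b)) * (L * L ^ (-k)) := by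
              rw [← mul_assoc ((10 : ℝ) ^ (-k)), hten']; ring
          _ < 10 * (10 ^ (-k) * a₀) * (L * L ^ (-k)) := by gcongr
          _ = a₀ * (10 ^ (-(k - 1)) * L ^ (-(k - 1))) := by rw [hLk1, hten1]; ring
          _ ≤ a₀ * r ^ (-α) := by
              have : 0 < a₀ := lt_trans (by positivity) ha₀
              gcongr
              exact hpow α _ hα hαk
      · have ha00 : 0 < a₀ := lt_trans (by positivity) ha₀
        -- The decay of the initial profile in r enters w_t + w_{r*} with the wrong sign; the margin
        -- in `ha₁` pays for it.
        have hfα : lapse M r * α * a₀ ≤ k * a₀ := by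
          have : lapse M r * α ≤ 1 * k := by gcongr; linarith
          nlinarith
        have hneg : -α - 1 = -(α + 1) := by ring
        rw [hneg]
        calc 10 * b * L * k * (3 * L) ^ (-(k + 1)) ≤ 10 * b * L * k * L ^ (-(k + 1)) := by
              exact mul_le_mul_of_nonneg_left (hW (k + 1) (by linarith)) (by positivity)
          _ = 10 * (10 ^ (-k) * 10 ^ k) * b * k * (L * L ^ (-(k + 1))) := by rw [hten']; ring
          _ = (10 ^ (k + 1) * b * k) * (10 ^ (-k) * L ^ (-k)) := by rw [hLk2, hten2]; ring
          _ ≤ (a₁ - lapse M r * α * a₀) * r ^ (-(α + 1)) := by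
              have : 0 ≤ a₁ - lapse M r * α * a₀ := by
                have : 0 ≤ 10 ^ (k + 1) * b * k := by positivity
                linarith
              gcongr
              · linarith
              · exact hpow (α + 1) k (by linarith) (by linarith)
  have hT : T ≤ 3 * L := by
    by_contra hn
    have hTL : 3 * L < T := not_le.mp hn
    -- The two null lines meet at t = 4L on r* = 6L. If T > 3L, w would be continuous on this
    -- compact segment, yet above W, which is unbounded as t ↑ 3L.
    have hmem : ∀ t ∈ Icc 0 (3 * L), (t, 6 * L) ∈ nullStrip L T := fun t ht =>
      ⟨by linarith [ht.2], by linarith [ht.2], by linarith [ht.2]⟩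
    have hcont : ContinuousOn (fun t => radialProfile M u (t, 6 * L)) (Icc 0 (3 * L)) :=
      hwc.comp (by fun_prop) fun t ht => ⟨ht.1, hmem t ht⟩
    obtain ⟨C, hC⟩ := isCompact_Icc.bddAbove_image hcont
    have hlim : Tendsto (fun s : ℝ => 10 * b * L * s ^ (-k)) (𝓝[>] 0) atTop :=
      (tendsto_rpow_neg_nhdsGT_zero (by linarith)).const_mul_atTop (by positivity)
    obtain ⟨s, hs1, hs2⟩ := ((hlim.eventually_gt_atTop C).and
      (Ioo_mem_nhdsGT (show (0 : ℝ) < 3 * L by positivity))).exists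
    have ht : 3 * L - s ∈ Icc 0 (3 * L) := ⟨by linarith [hs2.2], by linarith [hs2.1]⟩
    have h1 := hcmp (3 * L - s, 6 * L) (hmem _ ht) ht.1 (by simp only; linarith [hs2.1])
    have h2 := hC (mem_image_of_mem _ ht)
    simp only [sub_sub_cancel] at h1 h2
    linarith
  refine ⟨fun z hz => ?_, hT⟩
  obtain ⟨h1, h2, h3⟩ := mem_outgoingRegion_iff.mp hz
  have hw := hcmp _ h3 h1 (lt_of_lt_of_le h3.1 hT)
  have hnorm := norm_rayPoint hM (z.1, rStar M ‖z.2‖)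
  have hm := rayPoint_mem hM h1 h3
  rw [radialProfile] at hw
  rw [show z = (z.1, z.2) from rfl, ← hrad z.1 (rayPoint M (z.1, rStar M ‖z.2‖)).2 z.2 hm
    (by rw [hnorm, rOfStar_rStar hM h2])]
  have hs : 0 < 3 * L - z.1 := by have := h3.1; simp only at this; linarith
  have hpos : 0 < rOfStar M (rStar M ‖z.2‖) * u (rayPoint M (z.1, rStar M ‖z.2‖)) :=
    lt_trans (by positivity) hw
  exact (mul_pos_iff_of_pos_left (by have := rOfStar_gt hM (rStar M ‖z.2‖); linarith)).mp hpos

/-! ### Rotational symmetry of solutions and the lifespan -/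

/-- A time-like vector is not tangential to a space-like slice. -/
theorem Foliation.field_fst_ne_zero (Φ : Foliation M r₀) (hr₀ : 0 < r₀) {x : E3} (hx : r₀ < ‖x‖) :
    (Φ.field x).1 ≠ 0 := by
  intro h0
  obtain ⟨c, hc, hs⟩ := Φ.spacelike
  obtain ⟨c', hc', ht⟩ := Φ.timelike
  have h1 := hs x hx
  have h2 := ht x hx
  have hr : 0 < ‖x‖ := hr₀.trans hx
  simp only [cometric, coradial, ContinuousLinearMap.coe_fst', mul_one, mul_zero, add_zero,
    Finset.sum_const_zero, sub_zero] at h1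
  rw [metric, advanced, h0, zero_add] at h2
  have hcs : radial x (Φ.field x) ^ 2 ≤ inner ℝ (Φ.field x).2 (Φ.field x).2 := by
    rw [radial, div_pow, real_inner_self_eq_norm_sq, div_le_iff₀ (by positivity), ← mul_pow, mul_comm]
    exact sq_le_sq' (by linarith [neg_le_of_abs_le (abs_real_inner_le_norm x (Φ.field x).2)])
      (real_inner_le_norm _ _)
  -- For X without time component, g(X, X) = h'(2 − f h') X_r² + (|X|² − X_r²). The slice being
  -- space-like makes the first coefficient positive, so g(X, X) ≥ 0.
  nlinarith [mul_nonneg (show 0 ≤ deriv Φ.height ‖x‖ * (2 - lapse M ‖x‖ * deriv Φ.height ‖x‖) by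
    linarith) (sq_nonneg (radial x (Φ.field x)))]

/-- The action of a linear isometry on the space variable. -/
noncomputable def spaceIsometry (O : E3 ≃ₗᵢ[ℝ] E3) : ST ≃L[ℝ] ST :=
  (ContinuousLinearEquiv.refl ℝ ℝ).prodCongr O.toContinuousLinearEquiv

theorem spaceIsometry_apply (O : E3 ≃ₗᵢ[ℝ] E3) (z : ST) : spaceIsometry O z = (z.1, O z.2) := rfl

theorem measurePreserving_spaceIsometry (O : E3 ≃ₗᵢ[ℝ] E3) :
    MeasurePreserving (spaceIsometry O) :=
  (MeasurePreserving.id (volume : Measure ℝ)).prod O.measurePreserving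

/-- The sum is the inner product of the vectors dual to the space parts, hence the same in every
orthonormal basis. -/
theorem sum_covector_mul_isometry (O : E3 ≃ₗᵢ[ℝ] E3) (ω η : ST →L[ℝ] ℝ) :
    ∑ i, ω (0, O (e i)) * η (0, O (e i)) = ∑ i, ω (0, e i) * η (0, e i) := by
  have hrep : ∀ ζ : ST →L[ℝ] ℝ, ∃ a : E3, ∀ Y, ζ (0, Y) = inner ℝ a Y := by
    intro ζ
    refine ⟨(InnerProductSpace.toDual ℝ E3).symm (ζ.comp (ContinuousLinearMap.inr ℝ ℝ E3)),
      fun Y => ?_⟩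
    rw [InnerProductSpace.toDual_symm_apply]
    rfl
  obtain ⟨a, ha⟩ := hrep ω
  obtain ⟨b, hb⟩ := hrep η
  have key : ∀ B : OrthonormalBasis (Fin 3) ℝ E3,
      ∑ i, ω (0, B i) * η (0, B i) = inner ℝ a b := by
    intro B
    rw [← B.sum_inner_mul_inner a b]
    exact Finset.sum_congr rfl fun i _ => by rw [ha, hb, real_inner_comm b]
  have h1 := key (EuclideanSpace.basisFun (Fin 3) ℝ)
  have h2 := key ((EuclideanSpace.basisFun (Fin 3) ℝ).map O)
  simp only [OrthonormalBasis.map_apply, EuclideanSpace.basisFun_apply] at h1 h2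
  exact h2.trans h1.symm

theorem cometric_isometry (O : E3 ≃ₗᵢ[ℝ] E3) (h : ℝ → ℝ) (x : E3) (ω η : ST →L[ℝ] ℝ) :
    cometric M h x (ω.comp (spaceIsometry O : ST →L[ℝ] ST))
      (η.comp (spaceIsometry O : ST →L[ℝ] ST)) = cometric M h (O x) ω η := by
  simp only [cometric, coradial, ContinuousLinearMap.comp_apply, ContinuousLinearEquiv.coe_coe,
    spaceIsometry_apply, map_zero, map_smul, LinearIsometryEquiv.norm_map,
    sum_covector_mul_isometry]

theorem spaceIsometry_preimage_cylinder (O : E3 ≃ₗᵢ[ℝ] E3) (T : ℝ) :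
    spaceIsometry O ⁻¹' cylinder r₀ T = cylinder r₀ T := by
  ext z
  simp [cylinder, spaceIsometry_apply]

theorem uniqueDiffOn_cylinder {T : ℝ} : UniqueDiffOn ℝ (cylinder r₀ T) := by
  have : cylinder r₀ T = (Ici (0 : ℝ) ×ˢ (univ : Set E3)) ∩ {z : ST | z.1 < T ∧ r₀ < ‖z.2‖} := by
    ext z
    simp [cylinder]
  rw [this]
  exact ((uniqueDiffOn_Ici 0).prod uniqueDiffOn_univ).inter
    ((isOpen_lt continuous_fst continuous_const).inter
      (isOpen_lt continuous_const continuous_snd.norm))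

/-- On the initial surface, the tangential derivatives of a solution are those of the data. -/
theorem fderivWithin_tangential {Φ : Foliation M r₀} {F : ℝ → ℝ} {d : InitialData r₀} {T : ℝ}
    {u : ST → ℝ} (hu : IsSolutionOn Φ F d (cylinder r₀ T) u) {x : E3}
    (hx : (0, x) ∈ cylinder r₀ T) (v : E3) :
    fderivWithin ℝ u (cylinder r₀ T) (0, x) (0, v) = fderiv ℝ d.u₀ x v := by
  have hev : ∀ᶠ y : E3 in 𝓝 x, ((0 : ℝ), y) ∈ cylinder r₀ T := by
    filter_upwards [(isOpen_lt continuous_const continuous_norm).mem_nhds hx.2.2] with y hy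
    exact ⟨hx.1, hx.2.1, hy⟩
  have hγ : HasFDerivAt (fun y : E3 => ((0 : ℝ), y)) (ContinuousLinearMap.inr ℝ ℝ E3) x :=
    (ContinuousLinearMap.inr ℝ ℝ E3).hasFDerivAt
  have h1 : HasFDerivAt (fun y : E3 => u (0, y))
      ((fderivWithin ℝ u (cylinder r₀ T) (0, x)).comp (ContinuousLinearMap.inr ℝ ℝ E3)) x :=
    (((hu.1.differentiableOn (by simp)) _ hx).hasFDerivWithinAt.comp x
      hγ.hasFDerivWithinAt (s := {y | ((0 : ℝ), y) ∈ cylinder r₀ T})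
      fun s hs => hs).hasFDerivAt hev
  have h2 : (fun y : E3 => u (0, y)) =ᶠ[𝓝 x] d.u₀ := by
    filter_upwards [hev] with y hy
    exact (hu.2.1 y hy).1
  rw [← h2.fderiv_eq, h1.fderiv]
  rfl

/-- If the data are radial and vanish where the foliation is not standard, isometries map solutions
to solutions. -/
theorem IsSolutionOn.comp_isometry (hr₀ : 0 < r₀) {Φ : Foliation M r₀} {F : ℝ → ℝ}
    {d : InitialData r₀} {T L : ℝ} {u : ST → ℝ} (hu : IsSolutionOn Φ F d (cylinder r₀ T) u)
    (hrad : ∀ x y : E3, ‖x‖ = ‖y‖ → d.u₀ x = d.u₀ y ∧ d.u₁ x = d.u₁ y)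
    (hfar : ∀ x : E3, L ≤ ‖x‖ → Φ.field x = (1, 0))
    (hvan : ∀ x : E3, ‖x‖ < L → d.u₀ x = 0 ∧ d.u₁ x = 0) (O : E3 ≃ₗᵢ[ℝ] E3) :
    IsSolutionOn Φ F d (cylinder r₀ T) (u ∘ spaceIsometry O) := by
  have hpre := spaceIsometry_preimage_cylinder (r₀ := r₀) O T
  have hpreint : spaceIsometry O ⁻¹' interior (cylinder r₀ T) = interior (cylinder r₀ T) := by
    have := (spaceIsometry O).toHomeomorph.preimage_interior (cylinder r₀ T)
    rwa [ContinuousLinearEquiv.coe_toHomeomorph, hpre] at this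
  have hUD := uniqueDiffOn_cylinder (r₀ := r₀) (T := T)
  refine ⟨?_, ?_, ?_⟩
  · refine hu.1.comp (spaceIsometry O).contDiff.contDiffOn fun z hz => ?_
    rw [← hpre] at hz
    exact hz
  · intro x hx
    have hOx : ((0 : ℝ), O x) ∈ cylinder r₀ T := by
      rw [← hpre] at hx
      exact hx
    have hnorm : ‖O x‖ = ‖x‖ := O.norm_map x
    have hdat := hu.2.1 (O x) hOx
    have hsym := hrad (O x) x hnorm
    refine ⟨hdat.1.trans hsym.1, ?_⟩
    have hfd := (spaceIsometry O).comp_right_fderivWithin (f := u) (s := cylinder r₀ T)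
      (x := ((0 : ℝ), x)) (by rw [hpre]; exact hUD _ hx)
    rw [hpre] at hfd
    rw [hfd]
    simp only [ContinuousLinearMap.comp_apply, ContinuousLinearEquiv.coe_coe, spaceIsometry_apply]
    rw [← hsym.2]
    -- The field T need not be symmetric. For r ≥ L it is ∂ₜ, which commutes with isometries of
    -- space. For r < L the data vanish, and as T is transversal the whole differential of u
    -- vanishes, so T may be any vector there.
    rcases le_or_gt L ‖x‖ with hxL | hxL
    · rw [← hdat.2, hfar x hxL, hfar (O x) (by rwa [hnorm])]
      simp
    · have hxL' : ‖O x‖ < L := by rwa [hnorm]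
      have htan : ∀ v, fderivWithin ℝ u (cylinder r₀ T) (0, O x) (0, v) = 0 := by
        intro v
        rw [fderivWithin_tangential hu hOx]
        have : d.u₀ =ᶠ[𝓝 (O x)] 0 := by
          filter_upwards [(isOpen_lt continuous_norm continuous_const).mem_nhds hxL'] with y hy
          exact (hvan y hy).1
        rw [this.fderiv_eq]
        simp
      have hsplit : ∀ X : ST, fderivWithin ℝ u (cylinder r₀ T) (0, O x) X =
          X.1 * fderivWithin ℝ u (cylinder r₀ T) (0, O x) (1, 0) := by
        intro X
        have hX : X = X.1 • ((1 : ℝ), (0 : E3)) + (0, X.2) := by ext1 <;> simp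
        conv_lhs => rw [hX]
        rw [map_add, map_smul, htan, smul_eq_mul, add_zero]
      have h1 := hdat.2
      rw [(hvan _ hxL').2, hsplit] at h1
      have h2 := (mul_eq_zero.mp h1).resolve_left (Φ.field_fst_ne_zero hr₀ hOx.2.2)
      rw [hsplit, h2, (hvan _ hxL').2, mul_zero]
  · intro φ hφ hφc hφs
    set φ' : ST → ℝ := φ ∘ (spaceIsometry O).symm with hφ'
    have h1 : ContDiff ℝ (⊤ : ℕ∞) φ' := hφ.comp (spaceIsometry O).symm.contDiff
    have h2 : HasCompactSupport φ' :=
      hφc.comp_homeomorph (spaceIsometry O).symm.toHomeomorph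
    have h3 : tsupport φ' ⊆ interior (cylinder r₀ T) := by
      have : tsupport φ' = (spaceIsometry O).symm ⁻¹' tsupport φ :=
        tsupport_comp_eq_preimage φ (spaceIsometry O).symm.toHomeomorph
      rw [this]
      intro z hz
      have hz' := hφs hz
      rw [← hpreint] at hz'
      simpa using hz'
    have h4 := hu.2.2 φ' h1 h2 h3
    rw [← (measurePreserving_spaceIsometry O).integral_comp
      (spaceIsometry O).toHomeomorph.measurableEmbedding] at h4
    rw [← h4]
    refine integral_congr_ae (Eventually.of_forall fun z => ?_)
    have hφφ : φ = φ' ∘ spaceIsometry O := by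
      ext z; simp [hφ']
    simp only
    rw [(spaceIsometry O).comp_right_fderiv]
    conv_lhs => rw [hφφ]
    rw [(spaceIsometry O).comp_right_fderiv, cometric_isometry]
    simp only [Function.comp_apply, spaceIsometry_apply]

/-- Solutions restrict to smaller regions. -/
theorem IsSolutionOn.mono {Φ : Foliation M r₀} {F : ℝ → ℝ} {d : InitialData r₀} {D D' : Set ST}
    {u : ST → ℝ} (hu : IsSolutionOn Φ F d D u) (hD : D' ⊆ D) (hD' : UniqueDiffOn ℝ D') :
    IsSolutionOn Φ F d D' u := by
  refine ⟨hu.1.mono hD, fun x hx => ?_, fun φ h1 h2 h3 =>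
    hu.2.2 φ h1 h2 (h3.trans (interior_mono hD))⟩
  rw [fderivWithin_subset hD (hD' _ hx) ((hu.1.differentiableOn (by simp)) _ (hD hx))]
  exact hu.2.1 x (hD hx)

/-- The lifespan for radial data is bounded if radial solutions in the outgoing region are confined
to `t < T₀`. -/
theorem lifespan_le_of_radial (hr₀ : 0 < r₀) (hr₀M : r₀ ≤ 2 * M) {Φ : Foliation M r₀} {F : ℝ → ℝ}
    {d : InitialData r₀} {L L' T₀ : ℝ}
    (hrad : ∀ x y : E3, ‖x‖ = ‖y‖ → d.u₀ x = d.u₀ y ∧ d.u₁ x = d.u₁ y)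
    (hfar : ∀ x : E3, L' ≤ ‖x‖ → Φ.field x = (1, 0))
    (hvan : ∀ x : E3, ‖x‖ < L' → d.u₀ x = 0 ∧ d.u₁ x = 0)
    (hT : ∀ T > 0, ∀ u : ST → ℝ, IsSolutionOn Φ F d (outgoingRegion M L T) u →
      (∀ s x y, (s, x) ∈ outgoingRegion M L T → ‖x‖ = ‖y‖ → u (s, x) = u (s, y)) → T ≤ T₀) :
    lifespan Φ F d ≤ ENNReal.ofReal T₀ := by
  refine iSup_le fun T => iSup_le fun hT0 => iSup_le fun hwp => ?_
  obtain ⟨u, hu, huniq⟩ := hwp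
  have hsub : outgoingRegion M L T ⊆ cylinder r₀ T := fun z hz =>
    ⟨hz.1, hz.2.1, lt_of_le_of_lt hr₀M hz.2.2.1⟩
  refine ENNReal.ofReal_le_ofReal (hT T hT0 u (hu.mono hsub (uniqueDiffOn_outgoingRegion L T)) ?_)
  intro s x y hx hxy
  -- The reflection in the plane orthogonal to x − y exchanges x and y, since they have equal norms.
  have h1 := huniq _ (hu.comp_isometry hr₀ hrad hfar hvan (ℝ ∙ (x - y))ᗮ.reflection) (hsub hx)
  rw [← h1, Function.comp_apply, spaceIsometry_apply, Submodule.reflection_sub hxy]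

/-! ### Bounds in L² and Ḣ^s by height and size of support -/

theorem ofReal_sq_rpow_half {b : ℝ} (hb : 0 ≤ b) :
    ENNReal.ofReal (b ^ 2) ^ (1 / 2 : ℝ) = ENNReal.ofReal b := by
  rw [ENNReal.ofReal_rpow_of_nonneg (by positivity) (by norm_num), ← Real.sqrt_eq_rpow,
    Real.sqrt_sq hb]

/-- The volume of the unit ball of `E3`. -/
noncomputable def unitBallVolume : ℝ := (volume : Measure E3).real (Metric.ball 0 1)

theorem unitBallVolume_nonneg : 0 ≤ unitBallVolume := measureReal_nonneg

theorem volume_real_closedBall {ρ : ℝ} (hρ : 0 ≤ ρ) :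
    (volume : Measure E3).real (Metric.closedBall 0 ρ) = ρ ^ 3 * unitBallVolume := by
  rw [Measure.addHaar_real_closedBall _ _ hρ, unitBallVolume]
  simp

theorem integral_le_of_bound_of_ball {g : E3 → ℝ} {A ρ : ℝ} (hρ : 0 ≤ ρ)
    (hg : ∀ x, |g x| ≤ A) (hs : ∀ x, ρ < ‖x‖ → g x = 0) :
    ∫ x, g x ≤ A * (ρ ^ 3 * unitBallVolume) := by
  have h1 : ∫ x, g x = ∫ x in Metric.closedBall 0 ρ, g x := by
    symm
    refine setIntegral_eq_integral_of_forall_compl_eq_zero fun x hx => hs x ?_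
    simpa using hx
  rw [h1, ← volume_real_closedBall hρ]
  refine (le_abs_self _).trans ?_
  exact norm_setIntegral_le_of_norm_le_const (f := g) (C := A) measure_closedBall_lt_top
    fun x _ => hg x

/-- The bound s > −3 is integrability at the origin in three dimensions; the power δ^{s+3} carries
the scaling. -/
theorem lintegral_norm_rpow_ball {s δ : ℝ} (hs : -3 < s) (hδ : 0 < δ) :
    ∫⁻ ξ in Metric.ball (0 : E3) δ, ENNReal.ofReal ((2 * Real.pi * ‖ξ‖) ^ s) =
      ENNReal.ofReal (3 * unitBallVolume * ((2 * Real.pi) ^ s * (δ ^ (s + 3) / (s + 3)))) := by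
  have hpi := Real.pi_pos
  have hpow : ∀ y ∈ Ioo 0 δ, y ^ (3 - 1) • (2 * Real.pi * y) ^ s =
      (2 * Real.pi) ^ s * y ^ (s + 2) := by
    intro y hy
    rw [Real.mul_rpow (by positivity) hy.1.le, Real.rpow_add hy.1, Real.rpow_two, smul_eq_mul]
    ring
  have hii : IntervalIntegrable (fun y : ℝ => (2 * Real.pi) ^ s * y ^ (s + 2)) volume 0 δ :=
    (intervalIntegral.intervalIntegrable_rpow' (by linarith)).const_mul _
  have hint : IntegrableOn (fun ξ : E3 => (2 * Real.pi * ‖ξ‖) ^ s) (Metric.ball 0 δ) := by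
    rw [integrableOn_fun_norm_addHaar volume (f := fun y => (2 * Real.pi * y) ^ s)]
    simp only [finrank_euclideanSpace, Fintype.card_fin]
    rw [integrableOn_congr_fun hpow measurableSet_Ioo]
    exact (intervalIntegrable_iff_integrableOn_Ioo_of_le hδ.le).mp hii
  rw [← ofReal_integral_eq_lintegral_ofReal hint
    (Eventually.of_forall fun ξ => Real.rpow_nonneg (by positivity) _)]
  congr 1
  rw [← integral_indicator measurableSet_ball]
  have h1 : (Metric.ball (0 : E3) δ).indicator (fun ξ => (2 * Real.pi * ‖ξ‖) ^ s) =
      fun ξ => (Iio δ).indicator (fun y => (2 * Real.pi * y) ^ s) ‖ξ‖ := by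
    ext ξ
    simp [indicator]
  rw [h1, integral_fun_norm_addHaar volume]
  simp only [finrank_euclideanSpace, Fintype.card_fin, nsmul_eq_mul, Nat.cast_ofNat, smul_eq_mul]
  rw [mul_assoc, unitBallVolume]
  congr 2
  have h2 : ∫ y in Ioi 0, y ^ (3 - 1) * (Iio δ).indicator (fun y => (2 * Real.pi * y) ^ s) y =
      ∫ y in Ioo 0 δ, (2 * Real.pi) ^ s * y ^ (s + 2) := by
    rw [← Ioi_inter_Iio, ← Measure.restrict_restrict measurableSet_Ioi,
      ← integral_indicator measurableSet_Ioi, ← integral_indicator measurableSet_Ioi,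
      ← integral_indicator measurableSet_Iio]
    refine integral_congr_ae (Eventually.of_forall fun y => ?_)
    by_cases hy0 : 0 < y <;> by_cases hyδ : y < δ <;>
      simp [indicator, hy0, hyδ]
    simpa using hpow y ⟨hy0, hyδ⟩
  rw [h2, ← integral_Ioc_eq_integral_Ioo, ← intervalIntegral.integral_of_le hδ.le,
    intervalIntegral.integral_const_mul, integral_rpow (Or.inl (by linarith)),
    show s + 2 + 1 = s + 3 by ring, Real.zero_rpow (by linarith), sub_zero]

theorem norm_fourier_le_integral (g : E3 → ℂ) (ξ : E3) : ‖𝓕 g ξ‖ ≤ ∫ x, ‖g x‖ :=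
  VectorFourier.norm_fourierIntegral_le_integral_norm _ _ _ _ _

/-- The norm of `Ḣ^s`, `-3/2 < s < 0`, is controlled by the maximum and the size of the support. -/
theorem exists_homSobolevNorm_le {s : ℝ} (hs : -3 / 2 < s) (hs0 : s < 0) :
    ∃ C ≥ 0, ∀ (f : E3 → ℝ) (A ρ : ℝ), ContDiff ℝ (⊤ : ℕ∞) f → 0 < ρ → 0 ≤ A →
      (∀ x, |f x| ≤ A) → (∀ x, ρ < ‖x‖ → f x = 0) →
      homSobolevNorm s f ≤ ENNReal.ofReal (C * A * ρ ^ (3 / 2 - s)) := by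
  have hpi := Real.pi_pos
  have hV := unitBallVolume_nonneg
  set V := unitBallVolume with hVdef
  set C₀ : ℝ := V ^ 2 * (3 * V * ((2 * Real.pi) ^ (2 * s) / (2 * s + 3))) +
    (2 * Real.pi) ^ (2 * s) * V with hC₀
  have h23 : 0 < 2 * s + 3 := by linarith
  have hC₀0 : 0 ≤ C₀ := by positivity
  refine ⟨√C₀, Real.sqrt_nonneg _, fun f A ρ hf hρ hA hfA hfs => ?_⟩
  set g : E3 → ℂ := fun x => (f x : ℂ) with hg
  have hgn : ∀ x, ‖g x‖ = |f x| := fun x => by simp [hg]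
  have hfc : HasCompactSupport f := by
    refine HasCompactSupport.of_support_subset_isCompact (isCompact_closedBall (0 : E3) ρ)
      fun x hx => ?_
    by_contra hn
    exact hx (hfs x (by simpa using hn))
  have hgc : HasCompactSupport g := hfc.comp_left (g := Complex.ofReal) Complex.ofReal_zero
  have hgs : ContDiff ℝ (⊤ : ℕ∞) g := Complex.ofRealCLM.contDiff.comp hf
  have hsup : ∀ ξ, ‖𝓕 g ξ‖ ≤ A * (ρ ^ 3 * V) := by
    intro ξ
    refine (norm_fourier_le_integral g ξ).trans ?_
    refine integral_le_of_bound_of_ball hρ.le (fun x => ?_) fun x hx => ?_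
    · rw [abs_norm, hgn]; exact hfA x
    · rw [hgn, hfs x hx, abs_zero]
  have hL2 : ∫ ξ, ‖𝓕 g ξ‖ ^ 2 ≤ A ^ 2 * (ρ ^ 3 * V) := by
    have h1 := SchwartzMap.integral_norm_sq_fourier (hgc.toSchwartzMap hgs)
    have h2 : ∀ ξ, FourierTransform.fourier (hgc.toSchwartzMap hgs) ξ = 𝓕 g ξ := fun ξ => rfl
    have h3 : ∀ x, hgc.toSchwartzMap hgs x = g x := fun x => rfl
    simp only [h2, h3] at h1
    rw [h1]
    refine integral_le_of_bound_of_ball hρ.le (fun x => ?_) fun x hx => ?_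
    · rw [abs_of_nonneg (by positivity), hgn]
      exact pow_le_pow_left₀ (abs_nonneg _) (hfA x) 2
    · rw [hgn, hfs x hx, abs_zero]; norm_num
  have hL2i : Integrable fun ξ => ‖𝓕 g ξ‖ ^ 2 := by
    have := (FourierTransform.fourier (hgc.toSchwartzMap hgs)).memLp 2 (volume : Measure E3)
    exact this.integrable_norm_pow (by norm_num)
  have hL2l : ∫⁻ ξ, ‖𝓕 g ξ‖ₑ ^ 2 ≤ ENNReal.ofReal (A ^ 2 * (ρ ^ 3 * V)) := by
    have : ∀ ξ, ‖𝓕 g ξ‖ₑ ^ 2 = ENNReal.ofReal (‖𝓕 g ξ‖ ^ 2) := fun ξ => by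
      rw [ENNReal.ofReal_pow (norm_nonneg _), ofReal_norm]
    simp only [this]
    rw [← ofReal_integral_eq_lintegral_ofReal hL2i (Eventually.of_forall fun ξ => by positivity)]
    exact ENNReal.ofReal_le_ofReal hL2
  -- Frequencies are split at 1/ρ. Below, the transform is bounded by the L¹ norm and the weight is
  -- integrable as 2s > −3. Above, the weight is decreasing and Plancherel applies. Both parts are
  -- of size A² ρ^{3−2s}.
  have hδ : 0 < ρ⁻¹ := inv_pos.mpr hρ
  set m : E3 → ℝ≥0∞ := fun ξ => ENNReal.ofReal ((2 * Real.pi * ‖ξ‖) ^ (2 * s)) with hm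
  have hlow : ∫⁻ ξ in Metric.ball (0 : E3) ρ⁻¹, m ξ * ‖𝓕 g ξ‖ₑ ^ 2 ≤
      ENNReal.ofReal (3 * V * ((2 * Real.pi) ^ (2 * s) * (ρ⁻¹ ^ (2 * s + 3) / (2 * s + 3)))) *
        ENNReal.ofReal ((A * (ρ ^ 3 * V)) ^ 2) := by
    rw [← lintegral_norm_rpow_ball (by linarith) hδ, ← lintegral_mul_const' _ _ ENNReal.ofReal_ne_top]
    refine lintegral_mono fun ξ => ?_
    gcongr
    rw [← ofReal_norm, ← ENNReal.ofReal_pow (norm_nonneg _)]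
    exact ENNReal.ofReal_le_ofReal (pow_le_pow_left₀ (norm_nonneg _) (hsup ξ) 2)
  have hhigh : ∫⁻ ξ in (Metric.ball (0 : E3) ρ⁻¹)ᶜ, m ξ * ‖𝓕 g ξ‖ₑ ^ 2 ≤
      ENNReal.ofReal ((2 * Real.pi * ρ⁻¹) ^ (2 * s)) * ENNReal.ofReal (A ^ 2 * (ρ ^ 3 * V)) := by
    refine le_trans ?_ (mul_le_mul_right hL2l _)
    rw [← lintegral_const_mul' _ _ ENNReal.ofReal_ne_top]
    refine le_trans (setLIntegral_mono' (g := fun ξ =>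
      ENNReal.ofReal ((2 * Real.pi * ρ⁻¹) ^ (2 * s)) * ‖𝓕 g ξ‖ₑ ^ 2)
      measurableSet_ball.compl fun ξ hξ => ?_) (setLIntegral_le_lintegral _ _)
    have hξ' : ρ⁻¹ ≤ ‖ξ‖ := by simpa using hξ
    simp only [hm]
    gcongr ?_ * _
    refine ENNReal.ofReal_le_ofReal ?_
    exact Real.rpow_le_rpow_of_nonpos (by positivity) (by gcongr) (by linarith)
  have htot : ∫⁻ ξ, m ξ * ‖𝓕 g ξ‖ₑ ^ 2 ≤
      ENNReal.ofReal ((√C₀ * A * ρ ^ (3 / 2 - s)) ^ 2) := by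
    rw [← lintegral_add_compl _ (measurableSet_ball (x := (0 : E3)) (ε := ρ⁻¹))]
    refine (add_le_add hlow hhigh).trans ?_
    rw [← ENNReal.ofReal_mul (by positivity), ← ENNReal.ofReal_mul (by positivity),
      ← ENNReal.ofReal_add (by positivity) (by positivity)]
    refine ENNReal.ofReal_le_ofReal (le_of_eq ?_)
    have hR : (√C₀ * A * ρ ^ (3 / 2 - s)) ^ 2 = C₀ * A ^ 2 * ρ ^ ((3 / 2 - s) * (2 : ℕ)) := by
      rw [mul_pow, mul_pow, Real.sq_sqrt hC₀0, ← Real.rpow_mul_natCast hρ.le]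
    rw [hR, Real.mul_rpow (by positivity) hδ.le, Real.inv_rpow hρ.le, Real.inv_rpow hρ.le,
      ← Real.rpow_neg hρ.le, ← Real.rpow_neg hρ.le]
    have e1 : ρ ^ (-(2 * s + 3)) * ρ ^ 6 = ρ ^ ((3 / 2 - s) * (2 : ℕ)) := by
      rw [← Real.rpow_natCast ρ 6, ← Real.rpow_add hρ]; congr 1; push_cast; ring
    have e2 : ρ ^ (-(2 * s)) * ρ ^ 3 = ρ ^ ((3 / 2 - s) * (2 : ℕ)) := by
      rw [← Real.rpow_natCast ρ 3, ← Real.rpow_add hρ]; congr 1; push_cast; ring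
    rw [hC₀]
    linear_combination (3 * V * ((2 * Real.pi) ^ (2 * s) / (2 * s + 3)) * A ^ 2 * V ^ 2) * e1 +
      ((2 * Real.pi) ^ (2 * s) * A ^ 2 * V) * e2
  rw [homSobolevNorm, ← ofReal_sq_rpow_half (by positivity)]
  exact ENNReal.rpow_le_rpow htot (by norm_num)

theorem eLpNorm_two_le {f : E3 → ℝ} {A ρ : ℝ} (hf : Continuous f) (hρ : 0 < ρ) (hA : 0 ≤ A)
    (hfA : ∀ x, |f x| ≤ A) (hfs : ∀ x, ρ < ‖x‖ → f x = 0) :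
    eLpNorm f 2 volume ≤ ENNReal.ofReal (√unitBallVolume * A * ρ ^ (3 / 2 : ℝ)) := by
  have hfc : HasCompactSupport f := by
    refine HasCompactSupport.of_support_subset_isCompact (isCompact_closedBall (0 : E3) ρ)
      fun x hx => ?_
    by_contra hn
    exact hx (hfs x (by simpa using hn))
  have hi : Integrable fun x => f x * f x :=
    (hf.mul hf).integrable_of_hasCompactSupport hfc.mul_left
  have h1 : ∀ x, ‖f x‖ₑ ^ (2 : ℝ) = ENNReal.ofReal (f x * f x) := fun x => by
    rw [ENNReal.rpow_two, ← ofReal_norm, ← ENNReal.ofReal_pow (norm_nonneg _), Real.norm_eq_abs,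
      sq_abs, sq]
  have h2 : ∫ x, f x * f x ≤ (√unitBallVolume * A * ρ ^ (3 / 2 : ℝ)) ^ 2 := by
    refine (integral_le_of_bound_of_ball (A := A ^ 2) hρ.le (fun x => ?_) fun x hx => ?_).trans
      (le_of_eq ?_)
    · rw [abs_mul, sq]
      exact mul_le_mul (hfA x) (hfA x) (abs_nonneg _) hA
    · rw [hfs x hx, mul_zero]
    · rw [mul_pow, mul_pow, Real.sq_sqrt unitBallVolume_nonneg, ← Real.rpow_mul_natCast hρ.le,
        ← Real.rpow_natCast ρ 3]
      norm_num
      ring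
  rw [eLpNorm_eq_lintegral_rpow_enorm_toReal (by norm_num) (by norm_num)]
  simp only [ENNReal.toReal_ofNat, h1]
  rw [← ofReal_integral_eq_lintegral_ofReal hi (Eventually.of_forall fun x => mul_self_nonneg _)]
  refine (ENNReal.rpow_le_rpow (ENNReal.ofReal_le_ofReal h2) (by norm_num)).trans (le_of_eq ?_)
  exact ofReal_sq_rpow_half (by positivity)

/-- As p > 1, s_d − 1 = −1/2 − 1/p lies in (−3/2, 0), and 3/2 − (s_d − 1) = 2 + 1/p. For ρ ≥ 1 this
power also dominates the ρ^{3/2} of the L² part. -/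
theorem exists_capNorm_le {p : ℝ} (hp : 1 < p) :
    ∃ C ≥ 0, ∀ (f : E3 → ℝ) (A ρ : ℝ), ContDiff ℝ (⊤ : ℕ∞) f → 1 ≤ ρ → 0 ≤ A →
      (∀ x, |f x| ≤ A) → (∀ x, ρ < ‖x‖ → f x = 0) →
      capNorm p f ≤ ENNReal.ofReal (C * A * ρ ^ (2 + 1 / p)) := by
  have hp1 : 1 / p < 1 := by rw [div_lt_one (by linarith)]; exact hp
  have hp0 : 0 < 1 / p := by positivity
  obtain ⟨C, hC, h⟩ := exists_homSobolevNorm_le (s := 1 / 2 - 1 / p - 1) (by linarith)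
    (by linarith)
  refine ⟨√unitBallVolume + C, by positivity, fun f A ρ hf hρ hA hfA hfs => ?_⟩
  have hρ0 : 0 < ρ := by linarith
  have h1 := h f A ρ hf hρ0 hA hfA hfs
  have h2 := eLpNorm_two_le hf.continuous hρ0 hA hfA hfs
  rw [capNorm]
  refine (add_le_add h2 h1).trans ?_
  rw [← ENNReal.ofReal_add (by positivity) (by positivity)]
  refine ENNReal.ofReal_le_ofReal ?_
  rw [show (3 / 2 - (1 / 2 - 1 / p - 1) : ℝ) = 2 + 1 / p by ring]
  have : ρ ^ (3 / 2 : ℝ) ≤ ρ ^ (2 + 1 / p) :=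
    Real.rpow_le_rpow_of_exponent_le hρ (by linarith)
  have h3 : √unitBallVolume * A * ρ ^ (3 / 2 : ℝ) ≤ √unitBallVolume * A * ρ ^ (2 + 1 / p) := by
    gcongr
  linarith

/-! ### Iterated derivatives along the vector fields -/

theorem contDiff_vfield (a : Fin 3 ⊕ Fin 3) : ContDiff ℝ (⊤ : ℕ∞) (vfield a) := by
  have hc : ∀ j : Fin 3, ContDiff ℝ (⊤ : ℕ∞) fun x : E3 => x j := fun j =>
    (EuclideanSpace.proj (𝕜 := ℝ) j).contDiff
  cases a with
  | inl i => exact contDiff_const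
  | inr k => exact ((hc _).smul contDiff_const).sub ((hc _).smul contDiff_const)

theorem derivs_append (w w' : List (Fin 3 ⊕ Fin 3)) (f : E3 → ℝ) :
    derivs (w ++ w') f = derivs w (derivs w' f) := by
  induction w with
  | nil => rfl
  | cons a w ih => simp only [List.cons_append, derivs, ih]

theorem tsupport_derivs_subset (w : List (Fin 3 ⊕ Fin 3)) (f : E3 → ℝ) :
    tsupport (derivs w f) ⊆ tsupport f := by
  induction w with
  | nil => rfl
  | cons a w ih =>
    refine closure_minimal (fun x hx => ?_) (isClosed_tsupport f)
    refine ih ?_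
    by_contra hn
    apply hx
    simp [derivs, fderiv_of_notMem_tsupport ℝ hn]

theorem derivs_eq_zero_of_notMem {w : List (Fin 3 ⊕ Fin 3)} {f : E3 → ℝ} {x : E3}
    (hx : x ∉ tsupport f) : derivs w f x = 0 :=
  image_eq_zero_of_notMem_tsupport fun h => hx (tsupport_derivs_subset w f h)

/-- Joint smoothness in a parameter yields, by compactness, bounds uniform in the exponent of the
data, which varies with μ. -/
theorem contDiff_derivs_param {G : ℝ × E3 → ℝ} (hG : ContDiff ℝ (⊤ : ℕ∞) G)
    (w : List (Fin 3 ⊕ Fin 3)) :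
    ContDiff ℝ (⊤ : ℕ∞) fun z : ℝ × E3 => derivs w (fun y => G (z.1, y)) z.2 := by
  induction w with
  | nil => exact hG
  | cons a w ih =>
    set H : ℝ × E3 → ℝ := fun z => derivs w (fun y => G (z.1, y)) z.2 with hH
    have h1 : ∀ z : ℝ × E3, derivs (a :: w) (fun y => G (z.1, y)) z.2 =
        fderiv ℝ H z (0, vfield a z.2) := by
      intro z
      have hd : HasFDerivAt (fun y => H (z.1, y))
          ((fderiv ℝ H z).comp (ContinuousLinearMap.inr ℝ ℝ E3)) z.2 :=
        HasFDerivAt.comp z.2 (f := fun y => (z.1, y))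
          (ih.differentiable (by simp) z).hasFDerivAt (hasFDerivAt_prodMk_right z.1 z.2)
      have : derivs w (fun y => G (z.1, y)) = fun y => H (z.1, y) := rfl
      rw [derivs, this]
      beta_reduce
      rw [hd.fderiv]
      simp
    simp only [h1]
    exact (ih.fderiv_right (m := (⊤ : ℕ∞)) (by simp)).clm_apply
      (contDiff_const.prodMk ((contDiff_vfield a).comp contDiff_snd))

theorem contDiff_derivs {f : E3 → ℝ} (hf : ContDiff ℝ (⊤ : ℕ∞) f) (w : List (Fin 3 ⊕ Fin 3)) :
    ContDiff ℝ (⊤ : ℕ∞) (derivs w f) :=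
  (contDiff_derivs_param (hf.comp contDiff_snd) w).comp
    ((contDiff_const (c := (0 : ℝ))).prodMk contDiff_id)

/-- The number of translation fields in a list. -/
def translationCount : List (Fin 3 ⊕ Fin 3) → ℕ
  | [] => 0
  | .inl _ :: w => translationCount w + 1
  | .inr _ :: w => translationCount w

theorem translationCount_append_inl (w : List (Fin 3 ⊕ Fin 3)) (i : Fin 3) :
    1 ≤ translationCount (w ++ [.inl i]) := by
  induction w with
  | nil => simp [translationCount]
  | cons a w ih => cases a <;> simp only [List.cons_append, translationCount] <;> omega

/-- Rotations commute with dilations, while each translation field contributes a factor c. With c =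
1/L only the ∂ᵢ gain decay. -/
theorem derivs_dilation {g : E3 → ℝ} (hg : ContDiff ℝ (⊤ : ℕ∞) g) (b c : ℝ)
    (w : List (Fin 3 ⊕ Fin 3)) (x : E3) :
    derivs w (fun x => b * g (c • x)) x = b * (c ^ translationCount w * derivs w g (c • x)) := by
  induction w generalizing x with
  | nil => simp [derivs, translationCount]
  | cons a w ih =>
    have hfun : derivs w (fun x => b * g (c • x)) =
        fun x => b * (c ^ translationCount w * derivs w g (c • x)) := funext ih
    have hD := ((contDiff_derivs hg w).differentiable (by simp) (c • x)).hasFDerivAt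
    have hlin : HasFDerivAt (fun x : E3 => c • x) (c • ContinuousLinearMap.id ℝ E3) x :=
      (hasFDerivAt_id x).const_smul c
    have h1 := ((hD.comp x hlin).const_mul (c ^ translationCount w)).const_mul b
    rw [derivs, hfun]
    beta_reduce
    rw [show fderiv ℝ (fun x => b * (c ^ translationCount w * derivs w g (c • x))) x =
      _ from h1.fderiv]
    cases a with
    | inl i =>
      simp only [smul_apply, ContinuousLinearMap.comp_apply, ContinuousLinearMap.id_apply, vfield,
        map_smul, smul_eq_mul, derivs, translationCount]
      ring
    | inr k =>
      have hv : c • vfield (.inr k) x = vfield (.inr k) (c • x) := by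
        simp [vfield, smul_sub, smul_smul]
      simp only [smul_apply, ContinuousLinearMap.comp_apply,
        ContinuousLinearMap.id_apply, hv, smul_eq_mul, derivs, translationCount]

/-! ### Power data -/

/-- A cut-off to `1/2 < r < 20`, equal to `1` for `1 ≤ r ≤ 10`. -/
noncomputable def shell (r : ℝ) : ℝ :=
  Real.smoothTransition (2 * r - 1) * Real.smoothTransition ((20 - r) / 10)

theorem contDiff_shell : ContDiff ℝ (⊤ : ℕ∞) shell :=
  (Real.smoothTransition.contDiff.comp (by fun_prop)).mul
    (Real.smoothTransition.contDiff.comp (by fun_prop))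

theorem shell_eq_one {r : ℝ} (h1 : 1 ≤ r) (h2 : r ≤ 10) : shell r = 1 := by
  rw [shell, Real.smoothTransition.one_of_one_le (by linarith),
    Real.smoothTransition.one_of_one_le (by linarith), mul_one]

theorem shell_eq_zero {r : ℝ} (h : r ≤ 1 / 2 ∨ 20 ≤ r) : shell r = 0 := by
  rcases h with h | h
  · rw [shell, Real.smoothTransition.zero_of_nonpos (by linarith), zero_mul]
  · rw [shell, Real.smoothTransition.zero_of_nonpos (x := (20 - r) / 10) (by linarith), mul_zero]

/-- The localized power `|y|^{-β}`. -/
noncomputable def shellPower (β : ℝ) (y : E3) : ℝ := shell ‖y‖ * ‖y‖ ^ (-β)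

theorem contDiff_shellPower_param :
    ContDiff ℝ (⊤ : ℕ∞) fun z : ℝ × E3 => shellPower z.1 z.2 := by
  rw [contDiff_iff_contDiffAt]
  intro z
  rcases lt_or_ge ‖z.2‖ (1 / 2) with hz | hz
  · refine (contDiffAt_const (c := (0 : ℝ))).congr_of_eventuallyEq ?_
    filter_upwards [(isOpen_lt continuous_snd.norm continuous_const).mem_nhds hz] with z' hz'
    rw [shellPower, shell_eq_zero (Or.inl (le_of_lt hz')), zero_mul]
  · have hne : z.2 ≠ 0 := norm_pos_iff.mp (by linarith)
    have hn : ContDiffAt ℝ (⊤ : ℕ∞) (fun z : ℝ × E3 => ‖z.2‖) z :=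
      (contDiffAt_norm ℝ hne).comp z contDiffAt_snd
    exact (contDiff_shell.contDiffAt.comp z hn).mul
      (hn.rpow contDiffAt_fst.neg (norm_ne_zero_iff.mpr hne))

theorem contDiff_shellPower (β : ℝ) : ContDiff ℝ (⊤ : ℕ∞) (shellPower β) :=
  ContDiff.comp (g := fun z : ℝ × E3 => shellPower z.1 z.2) (f := fun y : E3 => (β, y))
    contDiff_shellPower_param (contDiff_const.prodMk contDiff_id)

theorem norm_of_mem_tsupport_shellPower {β : ℝ} {y : E3} (hy : y ∈ tsupport (shellPower β)) :
    1 / 2 ≤ ‖y‖ ∧ ‖y‖ ≤ 20 := by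
  have hcl : IsClosed {y : E3 | 1 / 2 ≤ ‖y‖ ∧ ‖y‖ ≤ 20} :=
    (isClosed_le continuous_const continuous_norm).inter
      (isClosed_le continuous_norm continuous_const)
  refine closure_minimal (fun y hy => ?_) hcl hy
  by_contra hn
  apply hy
  rw [mem_ofPred_eq, not_and_or, not_le, not_le] at hn
  rw [shellPower, shell_eq_zero (hn.imp le_of_lt le_of_lt), zero_mul]

/-- The derivatives of the localized powers are bounded, uniformly in the exponent. -/
theorem exists_derivs_shellPower_le (b : ℝ) (n : ℕ) : ∃ C ≥ 0, ∀ w : List (Fin 3 ⊕ Fin 3),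
    w.length ≤ n → ∀ β ∈ Icc 0 b, ∀ y, |derivs w (shellPower β) y| ≤ C := by
  have h1 : ∀ w : List (Fin 3 ⊕ Fin 3), ∃ C ≥ 0, ∀ β ∈ Icc 0 b, ∀ y,
      |derivs w (shellPower β) y| ≤ C := by
    intro w
    have hK : IsCompact (Icc 0 b ×ˢ Metric.closedBall (0 : E3) 20) :=
      isCompact_Icc.prod (isCompact_closedBall _ _)
    obtain ⟨C, hC⟩ := hK.exists_bound_of_continuousOn
      (contDiff_derivs_param contDiff_shellPower_param w).continuous.continuousOn
    refine ⟨max C 0, le_max_right _ _, fun β hβ y => ?_⟩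
    by_cases hy : y ∈ tsupport (shellPower β)
    · refine le_max_of_le_left (hC (β, y) ⟨hβ, ?_⟩)
      rw [mem_closedBall_zero_iff]
      exact (norm_of_mem_tsupport_shellPower hy).2
    · rw [derivs_eq_zero_of_notMem hy, abs_zero]
      exact le_max_right _ _
  choose c hc0 hc using h1
  obtain ⟨C, hC⟩ := ((List.finite_length_le (Fin 3 ⊕ Fin 3) n).image c).bddAbove
  refine ⟨max C 0, le_max_right _ _, fun w hw β hβ y => (hc w β hβ y).trans ?_⟩
  exact le_max_of_le_left (hC (mem_image_of_mem _ hw))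

/-- The profile `a (|x|/L)^{-β}`, localized to `L/2 ≤ |x| ≤ 20L`. -/
noncomputable def scaledPower (L a β : ℝ) (x : E3) : ℝ := a * shellPower β (L⁻¹ • x)

theorem norm_inv_smul {L : ℝ} (hL : 0 < L) (x : E3) : ‖L⁻¹ • x‖ = ‖x‖ / L := by
  rw [norm_smul, norm_inv, Real.norm_eq_abs, abs_of_pos hL]
  field_simp

theorem norm_of_mem_tsupport_scaledPower {L a β : ℝ} (hL : 0 < L) {x : E3}
    (hx : x ∈ tsupport (scaledPower L a β)) : L / 2 ≤ ‖x‖ ∧ ‖x‖ ≤ 20 * L := by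
  have hcl : IsClosed {y : E3 | L / 2 ≤ ‖y‖ ∧ ‖y‖ ≤ 20 * L} :=
    (isClosed_le continuous_const continuous_norm).inter
      (isClosed_le continuous_norm continuous_const)
  refine closure_minimal (fun y hy => ?_) hcl hx
  have := norm_of_mem_tsupport_shellPower (subset_tsupport _ (right_ne_zero_of_mul hy))
  rw [norm_inv_smul hL, le_div_iff₀ hL, div_le_iff₀ hL] at this
  exact ⟨by linarith [this.1], this.2⟩

theorem contDiff_scaledPower (L a β : ℝ) : ContDiff ℝ (⊤ : ℕ∞) (scaledPower L a β) :=
  contDiff_const.mul ((contDiff_shellPower β).comp (contDiff_const_smul L⁻¹))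

theorem scaledPower_eq {L a β : ℝ} (hL : 0 < L) {x : E3} (h1 : L ≤ ‖x‖) (h2 : ‖x‖ ≤ 10 * L) :
    scaledPower L (a * L ^ (-β)) β x = a * ‖x‖ ^ (-β) := by
  rw [scaledPower, shellPower, norm_inv_smul hL, shell_eq_one ((one_le_div hL).mpr h1)
    ((div_le_iff₀ hL).mpr h2), Real.div_rpow (norm_nonneg _) hL.le]
  have := (Real.rpow_pos_of_pos hL (-β)).ne'
  field_simp

/-- Radial initial data, equal to `a₀ r^{-α-1}` and `a₁ r^{-α-2}` for `L ≤ r ≤ 10L`. -/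
noncomputable def powerData {L : ℝ} (hL : 0 < L) (hr₀ : r₀ < L / 2) (a₀ a₁ α : ℝ) :
    InitialData r₀ where
  u₀ := scaledPower L (a₀ * L ^ (-(α + 1))) (α + 1)
  u₁ := scaledPower L (a₁ * L ^ (-(α + 2))) (α + 2)
  smooth₀ := contDiff_scaledPower _ _ _
  smooth₁ := contDiff_scaledPower _ _ _
  compact₀ := (isCompact_closedBall (0 : E3) (20 * L)).of_isClosed_subset (isClosed_tsupport _)
    fun x hx => by
      rw [mem_closedBall_zero_iff]; exact (norm_of_mem_tsupport_scaledPower hL hx).2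
  compact₁ := (isCompact_closedBall (0 : E3) (20 * L)).of_isClosed_subset (isClosed_tsupport _)
    fun x hx => by
      rw [mem_closedBall_zero_iff]; exact (norm_of_mem_tsupport_scaledPower hL hx).2
  supp₀ := fun x hx => lt_of_lt_of_le hr₀ (norm_of_mem_tsupport_scaledPower hL hx).1
  supp₁ := fun x hx => lt_of_lt_of_le hr₀ (norm_of_mem_tsupport_scaledPower hL hx).1

theorem sobolevNorm_zero (k : ℕ) : sobolevNorm k (fun _ => 0) = 0 := by
  have h : ∀ w : List (Fin 3 ⊕ Fin 3), derivs w (fun _ => 0) = fun _ => 0 := by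
    intro w
    induction w with
    | nil => rfl
    | cons a w ih =>
      simp only [derivs, ih]
      ext x
      simp
  simp [sobolevNorm, h]

/-! ### The X norm of the power data -/

/-- The size of the power data in the norm `X`. -/
theorem exists_xNorm_powerData_le {p R : ℝ} (hp : 1 < p) (hR : 0 < R) {ψ : ℝ → ℝ}
    (hψ1 : ∀ r > 2, ψ r = 1) (b : ℝ) :
    ∃ C ≥ 0, ∀ {L : ℝ} (hL : 0 < L) (hr₀ : r₀ < L / 2) (a₀ a₁ α : ℝ), 1 ≤ L → 8 * R < L →
      α ∈ Icc 0 b → xNorm p R ψ (powerData hL hr₀ a₀ a₁ α) ≤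
        ENNReal.ofReal (C * (|a₀| + |a₁|) * L ^ (1 / p - α)) := by
  obtain ⟨C₁, hC₁, hcap⟩ := exists_capNorm_le hp
  obtain ⟨C₂, hC₂, hder⟩ := exists_derivs_shellPower_le (b + 2) 3
  -- There are 1 + 6 + 36 = 43 words of length at most two in the six fields, each with three terms
  -- from ∇u₀ and one from u₁; the support has radius 20L.
  refine ⟨172 * (C₁ * C₂ * 20 ^ (2 + 1 / p)), by positivity,
    fun {L} hL hr₀ a₀ a₁ α hL1 hLR hα => ?_⟩
  set Q : ℝ := C₁ * C₂ * 20 ^ (2 + 1 / p) * (|a₀| + |a₁|) * L ^ (1 / p - α) with hQ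
  -- The data live at r ≥ L/2 > 4R, where φ_R = 0 and ψ_R = 1, so the cut-offs disappear and the
  -- Sobolev part of the norm is zero.
  have hφ : ∀ a β, (fun x => (1 - ψ (‖x‖ / (2 * R))) * scaledPower L a β x) = fun _ => 0 := by
    intro a β
    ext x
    by_cases hx : x ∈ tsupport (scaledPower L a β)
    · have := (norm_of_mem_tsupport_scaledPower hL hx).1
      rw [hψ1 _ (by rw [gt_iff_lt, lt_div_iff₀ (by positivity)]; linarith), sub_self, zero_mul]
    · rw [image_eq_zero_of_notMem_tsupport hx, mul_zero]
  have hψ : ∀ a β w, (fun x => ψ (‖x‖ / R) * derivs w (scaledPower L a β) x) =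
      derivs w (scaledPower L a β) := by
    intro a β w
    ext x
    by_cases hx : x ∈ tsupport (scaledPower L a β)
    · have := (norm_of_mem_tsupport_scaledPower hL hx).1
      rw [hψ1 _ (by rw [gt_iff_lt, lt_div_iff₀ hR]; linarith), one_mul]
    · rw [derivs_eq_zero_of_notMem hx, mul_zero]
  have hc0 : 0 < L⁻¹ := inv_pos.mpr hL
  have hc1 : L⁻¹ ≤ 1 := inv_le_one_of_one_le₀ hL1
  have hterm : ∀ (w : List (Fin 3 ⊕ Fin 3)) (a β : ℝ), w.length ≤ 3 → β ∈ Icc 0 (b + 2) →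
      |a| ≤ |a₀| + |a₁| → L⁻¹ ^ translationCount w * L ^ (-β) ≤ L ^ (-(α + 2)) →
      capNorm p (derivs w (scaledPower L (a * L ^ (-β)) β)) ≤ ENNReal.ofReal Q := by
    intro w a β hw hβ ha hexp
    have hLβ : 0 < L ^ (-β) := Real.rpow_pos_of_pos hL _
    have hb : ∀ x, |derivs w (scaledPower L (a * L ^ (-β)) β) x| ≤
        (|a₀| + |a₁|) * L ^ (-(α + 2)) * C₂ := by
      intro x
      have := derivs_dilation (contDiff_shellPower β) (a * L ^ (-β)) L⁻¹ w x
      rw [show derivs w (scaledPower L (a * L ^ (-β)) β) x = _ from this, abs_mul, abs_mul, abs_mul,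
        abs_of_pos hLβ, abs_of_pos (pow_pos hc0 _)]
      calc |a| * L ^ (-β) * (L⁻¹ ^ translationCount w * |derivs w (shellPower β) (L⁻¹ • x)|)
          = |a| * (L⁻¹ ^ translationCount w * L ^ (-β)) * |derivs w (shellPower β) (L⁻¹ • x)| := by
            ring
        _ ≤ (|a₀| + |a₁|) * L ^ (-(α + 2)) * C₂ := by
            gcongr
            exact hder w hw β hβ _
    have hs : ∀ x, 20 * L < ‖x‖ → derivs w (scaledPower L (a * L ^ (-β)) β) x = 0 := fun x hx =>
      derivs_eq_zero_of_notMem fun h => by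
        linarith [(norm_of_mem_tsupport_scaledPower hL h).2]
    have := hcap _ _ (20 * L) (contDiff_derivs (contDiff_scaledPower L (a * L ^ (-β)) β) w)
      (by linarith) (by positivity) hb hs
    refine this.trans (ENNReal.ofReal_le_ofReal (le_of_eq ?_))
    have e1 : L ^ (-(α + 2)) * L ^ (2 + 1 / p) = L ^ (1 / p - α) := by
      rw [← Real.rpow_add hL]; ring_nf
    rw [hQ, Real.mul_rpow (by norm_num) hL.le]
    linear_combination (C₁ * C₂ * 20 ^ (2 + 1 / p) * (|a₀| + |a₁|)) * e1
  have hβ1 : α + 1 ∈ Icc 0 (b + 2) := ⟨by linarith [hα.1], by linarith [hα.2]⟩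
  have hβ2 : α + 2 ∈ Icc 0 (b + 2) := ⟨by linarith [hα.1], by linarith [hα.2]⟩
  have hshift : L⁻¹ * L ^ (-(α + 1)) = L ^ (-(α + 2)) := by
    rw [← Real.rpow_neg_one, ← Real.rpow_add hL]; ring_nf
  have ht0 : ∀ (w : List (Fin 3 ⊕ Fin 3)) (i : Fin 3), w.length ≤ 2 →
      capNorm p (fun x => ψ (‖x‖ / R) * derivs w (derivs [.inl i]
        (powerData hL hr₀ a₀ a₁ α).u₀) x) ≤ ENNReal.ofReal Q := by
    intro w i hw
    simp only [← derivs_append, powerData, hψ]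
    refine hterm _ a₀ (α + 1) (by simp; omega) hβ1 (le_add_of_nonneg_right (abs_nonneg _)) ?_
    -- The innermost ∂ᵢ guarantees one factor 1/L, which compensates the slower decay of u₀ compared
    -- with u₁.
    rw [← hshift]
    gcongr
    exact pow_le_of_le_one hc0.le hc1 (by have := translationCount_append_inl w i; omega)
  have ht1 : ∀ (w : List (Fin 3 ⊕ Fin 3)), w.length ≤ 2 →
      capNorm p (fun x => ψ (‖x‖ / R) * derivs w (powerData hL hr₀ a₀ a₁ α).u₁ x) ≤
        ENNReal.ofReal Q := by
    intro w hw
    simp only [powerData, hψ]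
    refine hterm _ a₁ (α + 2) (by omega) hβ2 (le_add_of_nonneg_left (abs_nonneg _)) ?_
    exact mul_le_of_le_one_left (Real.rpow_nonneg hL.le _) (pow_le_one₀ hc0.le hc1)
  have hQ0 : 0 ≤ Q := by positivity
  rw [xNorm]
  have hz0 : sobolevNorm 3 (fun x => (1 - ψ (‖x‖ / (2 * R))) * (powerData hL hr₀ a₀ a₁ α).u₀ x) = 0 := by
    simp only [powerData, hφ, sobolevNorm_zero]
  have hz1 : sobolevNorm 2 (fun x => (1 - ψ (‖x‖ / (2 * R))) * (powerData hL hr₀ a₀ a₁ α).u₁ x) = 0 := by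
    simp only [powerData, hφ, sobolevNorm_zero]
  rw [hz0, hz1, zero_add, zero_add]
  calc _ ≤ ∑ j ∈ Finset.range 3, ∑ w : Fin j → Fin 3 ⊕ Fin 3,
        ((∑ i : Fin 3, ENNReal.ofReal Q) + ENNReal.ofReal Q) := by
        refine Finset.sum_le_sum fun j hj => Finset.sum_le_sum fun w _ => ?_
        have hlen : (List.ofFn w).length ≤ 2 := by
          rw [List.length_ofFn]; have := Finset.mem_range.mp hj; omega
        exact add_le_add (Finset.sum_le_sum fun i _ => ht0 _ i hlen) (ht1 _ hlen)
    _ = 172 * ENNReal.ofReal Q := by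
        simp only [Finset.sum_const, Finset.card_univ, Fintype.card_fin, Fintype.card_fun,
          Fintype.card_sum, Finset.sum_range_succ, Finset.sum_range_zero, nsmul_eq_mul]
        push_cast
        ring
    _ = ENNReal.ofReal (172 * (C₁ * C₂ * 20 ^ (2 + 1 / p)) * (|a₀| + |a₁|) * L ^ (1 / p - α)) := by
        rw [show (172 : ℝ≥0∞) = ENNReal.ofReal 172 by simp, ← ENNReal.ofReal_mul (by norm_num), hQ]
        congr 1
        ring

/-! ### Continuity of F, largeness of L, and the exponents -/

theorem PowerLike.continuous {p : ℝ} (hp : 0 < p) {F : ℝ → ℝ} (hF : PowerLike p F) :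
    Continuous F := by
  obtain ⟨hd, C, hC⟩ := hF
  have hle : ∀ u, |F u| ≤ C * |u| ^ p := by
    intro u
    refine le_trans ?_ (hC u)
    have := Finset.single_le_sum (f := fun j => |u| ^ j * |iteratedDeriv j F u|)
      (fun j _ => by positivity) (Finset.mem_range.mpr (Nat.succ_pos ⌊p⌋₊))
    simpa using this
  rw [continuous_iff_continuousAt]
  intro x
  rcases eq_or_ne x 0 with rfl | hx
  · have h0 : F 0 = 0 := by
      have := hle 0
      rw [abs_zero, Real.zero_rpow hp.ne', mul_zero] at this
      exact abs_eq_zero.mp (le_antisymm this (abs_nonneg _))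
    rw [ContinuousAt, h0]
    refine squeeze_zero_norm (a := fun u => C * |u| ^ p) (fun u => hle u) ?_
    have : Continuous fun u : ℝ => C * |u| ^ p :=
      continuous_const.mul (continuous_abs.rpow_const fun _ => Or.inr hp.le)
    have h := this.tendsto 0
    rwa [abs_zero, Real.zero_rpow hp.ne', mul_zero] at h
  · exact hd.continuousOn.continuousAt (isOpen_compl_singleton.mem_nhds hx)

theorem eventually_isFar (hM : 0 < M) (Φ : Foliation M r₀) : ∀ᶠ L in atTop, IsFar Φ L := by
  obtain ⟨R₁, hR₁, hh, hf⟩ := Φ.far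
  have hlog := Real.isLittleO_log_id_atTop.bound (show (0 : ℝ) < 1 / (2 * M) by positivity)
  filter_upwards [eventually_ge_atTop (2 * M + 1), eventually_ge_atTop R₁, hlog] with L h1 h2 h3
  have hL : 1 ≤ L := by linarith
  have hlogL : 0 ≤ Real.log L := Real.log_nonneg hL
  rw [Real.norm_eq_abs, id, Real.norm_eq_abs, abs_of_nonneg hlogL, abs_of_pos (by linarith),
    div_mul_eq_mul_div, one_mul, le_div_iff₀ (by positivity)] at h3
  refine ⟨h1, fun r hr0 hrL => ?_, fun r hr => hh r (h2.trans hr), fun x hx => hf x (h2.trans hx)⟩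
  have h4 : Real.log (r - 2 * M) ≤ Real.log L := by
    -- For r < 2M the logarithm is that of |r − 2M|, and at r = 2M it is 0; either way it is at most
    -- log L.
    rw [← Real.log_abs]
    rcases eq_or_ne (r - 2 * M) 0 with h | h
    · rw [h, abs_zero, Real.log_zero]; exact hlogL
    · exact Real.log_le_log (abs_pos.mpr h) (abs_le.mpr ⟨by linarith, by linarith⟩)
  rw [rStar]
  have : 2 * M * Real.log (r - 2 * M) ≤ 2 * M * Real.log L := by gcongr
  linarith

theorem one_add_two_mul_sub_sq_pos {p : ℝ} (hp : 1 < p) (hp' : p < 1 + √2) :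
    0 < 1 + 2 * p - p ^ 2 := by
  have h2 : √2 ^ 2 = 2 := Real.sq_sqrt (by norm_num)
  nlinarith [Real.sqrt_nonneg 2]

/-- The right side is −1/N_μ, so L = ε^{-N_μ} gives L^{1/p−α} = ε. -/
theorem one_div_sub_expα {p μ : ℝ} (hp : 1 < p) :
    1 / p - expα p μ = -((1 + 2 * p - p ^ 2 - μ) / (p * (p - 1))) := by
  have h1 : p ≠ 0 := by linarith
  have h2 : p - 1 ≠ 0 := by linarith
  rw [expα]
  field_simp
  ring

end SchwarzschildWave

open SchwarzschildWave

open MeasureTheory Set Filter Topology in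
theorem theorem1p1 (M r₀ p R : ℝ) (hM : 0 < M) (hr₀ : 0 < r₀) (hr₀M : r₀ ≤ 2 * M)
    (hp : 1 < p) (hp' : p < 1 + √2) (hR : 3 * M < R)
    (ψ : ℝ → ℝ) (hψ : ContDiff ℝ (⊤ : ℕ∞) ψ)
    (hψ0 : ∀ r < 1, ψ r = 0) (hψ1 : ∀ r > 2, ψ r = 1)
    (F : ℝ → ℝ) (hF : PowerLike p F) (hFp : ∀ u > 0, F u = u ^ p)
    (Φ : Foliation M r₀) :
    ∃ ε₀ > 0, ε₀ < 1 ∧ ε₀ < 1 + 2 * p - p ^ 2 ∧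
      (∀ ε ∈ Set.Ioo 0 ε₀, lifespanOfSize p R ψ Φ F ε ≤
        ENNReal.ofReal (3 * ε₀ ^ (-(p * (p - 1) / (1 + 2 * p - p ^ 2)))
          * ε ^ (-(p * (p - 1) / (1 + 2 * p - p ^ 2))))) ∧
      ∃ θ₀ θ₁ : ℝ, 0 < θ₀ ∧ θ₀ < θ₁ ∧ θ₁ < 1 ∧
        ∀ ε ∈ Set.Ioo 0 ε₀, ∀ μ ∈ Set.Ioo 0 ε₀, ∀ L, L = ε ^ (-expN p μ) →
          ∃ d : InitialData r₀,
            (∀ x y : E3, ‖x‖ = ‖y‖ → d.u₀ x = d.u₀ y ∧ d.u₁ x = d.u₁ y) ∧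
            (∀ x : E3, d.u₀ x ≠ 0 ∨ d.u₁ x ≠ 0 → L / 2 ≤ ‖x‖ ∧ ‖x‖ ≤ 20 * L) ∧
            (∀ x : E3, L ≤ ‖x‖ → ‖x‖ ≤ 10 * L →
              d.u₀ x = ε₀ ^ (-θ₀) * ‖x‖ ^ (-expα p μ - 1) ∧
              d.u₁ x = ε₀ ^ (-θ₁) * ‖x‖ ^ (-expα p μ - 2)) ∧
            xNorm p R ψ d ≤ ENNReal.ofReal (ε₀⁻¹ * ε) ∧
            lifespan Φ F d ≤ ENNReal.ofReal (3 * L) ∧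
            ∀ T > 0, ∀ u : ST → ℝ, IsSolutionOn Φ F d (outgoingRegion M L T) u →
              (∀ s x y, (s, x) ∈ outgoingRegion M L T → ‖x‖ = ‖y‖ → u (s, x) = u (s, y)) →
              (∀ z ∈ outgoingRegion M L T, 0 < u z) ∧ T ≤ 3 * L := by
  have hp1 : 0 < p - 1 := by linarith
  have hFc := hF.continuous (by linarith)
  set δ := 1 + 2 * p - p ^ 2 with hδ
  have hδ0 : 0 < δ := one_add_two_mul_sub_sq_pos hp hp'
  set N := p * (p - 1) / δ with hN
  have hN0 : 0 < N := by positivity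
  set k := 2 / (p - 1) with hk
  have hk0 : 0 < k := by positivity
  have hkp : k * (p - 1) = 2 := by rw [hk]; field_simp
  set b := (4 * (k * (k + 1))) ^ (p - 1)⁻¹ with hb
  have hb0 : 0 < b := by positivity
  have hbp : b ^ (p - 1) = 4 * (k * (k + 1)) := Real.rpow_inv_rpow (by positivity) hp1.ne'
  obtain ⟨C, hC0, hC⟩ := exists_xNorm_powerData_le (r₀ := r₀) hp (show 0 < R by linarith) hψ1
    (k - 1)
  -- The comparison takes place beyond r = L, but the data reach down to L/2, and the symmetry
  -- argument needs T = ∂ₜ there.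
  obtain ⟨Λ, hΛ⟩ : ∃ Λ, ∀ L ≥ Λ, IsFar Φ (L / 2) ∧ IsFar Φ L ∧ 4 * M ≤ L ∧ 9 * M ≤ k * (k + 1) * L ∧
      8 * R < L ∧ r₀ < L / 2 ∧ 1 ≤ L := by
    have h1 := (tendsto_id.atTop_div_const (show (0 : ℝ) < 2 by norm_num)).eventually
      (eventually_isFar hM Φ)
    have h2 : ∀ᶠ L : ℝ in atTop, 9 * M ≤ k * (k + 1) * L :=
      (tendsto_id.const_mul_atTop (show 0 < k * (k + 1) by positivity)).eventually_ge_atTop _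
    obtain ⟨Λ, hΛ⟩ := eventually_atTop.mp (h1.and ((eventually_isFar hM Φ).and
      ((eventually_ge_atTop (4 * M)).and (h2.and ((eventually_gt_atTop (8 * R)).and
        ((eventually_gt_atTop (2 * r₀)).and (eventually_ge_atTop 1)))))))
    refine ⟨Λ, fun L hL => ?_⟩
    obtain ⟨a1, a2, a3, a4, a5, a6, a7⟩ := hΛ L hL
    exact ⟨a1, a2, a3, a4, a5, by linarith, a7⟩
  have hlim : ∀ q : ℝ, 0 < q → Tendsto (fun ε : ℝ => ε ^ (-q)) (𝓝[>] 0) atTop := fun q hq =>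
    tendsto_rpow_neg_nhdsGT_zero (by linarith)
  -- With θ₀ = 1/4 and θ₁ = 1/2 one has a₁ = a₀², so a₀ ≥ k + 1 gives a₁ − k a₀ ≥ a₀. The bound on
  -- 2C gives C(a₀ + a₁) ≤ ε₀⁻¹, and ε₀ < δ/2 keeps δ − μ positive.
  obtain ⟨ε₀, ⟨hε0, hε1⟩, hεC, hεb, hεk, hεΛ⟩ : ∃ ε₀, ε₀ ∈ Ioo 0 (min 1 (δ / 2)) ∧
      2 * C ≤ ε₀ ^ (-(1 / 2) : ℝ) ∧
      max (10 ^ k * b + 1) (10 ^ (k + 1) * b * k) ≤ ε₀ ^ (-(1 / 4) : ℝ) ∧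
      k + 1 ≤ ε₀ ^ (-(1 / 4) : ℝ) ∧ Λ ≤ ε₀ ^ (-N) := by
    refine Eventually.exists (f := 𝓝[>] (0 : ℝ)) ?_
    filter_upwards [Ioo_mem_nhdsGT (show (0 : ℝ) < min 1 (δ / 2) by positivity),
      (hlim (1 / 2) (by norm_num)).eventually_ge_atTop (2 * C),
      (hlim (1 / 4) (by norm_num)).eventually_ge_atTop _,
      (hlim (1 / 4) (by norm_num)).eventually_ge_atTop _,
      (hlim N hN0).eventually_ge_atTop Λ] with ε h1 h2 h3 h4 h5
    exact ⟨h1, h2, h3, h4, h5⟩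
  have hε11 : ε₀ < 1 := lt_of_lt_of_le hε1 (min_le_left _ _)
  have hεδ : ε₀ < δ / 2 := lt_of_lt_of_le hε1 (min_le_right _ _)
  have hhalf : ε₀ ^ (-(1 / 2) : ℝ) = ε₀ ^ (-(1 / 4) : ℝ) * ε₀ ^ (-(1 / 4) : ℝ) := by
    rw [← Real.rpow_add hε0]; norm_num
  have hone : ε₀⁻¹ = ε₀ ^ (-(1 / 2) : ℝ) * ε₀ ^ (-(1 / 2) : ℝ) := by
    rw [← Real.rpow_add hε0, ← Real.rpow_neg_one]; norm_num
  have key : ∀ ε ∈ Ioo 0 ε₀, ∀ μ ∈ Ioo 0 ε₀, ∀ L, L = ε ^ (-expN p μ) →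
      ∃ d : InitialData r₀,
        (∀ x y : E3, ‖x‖ = ‖y‖ → d.u₀ x = d.u₀ y ∧ d.u₁ x = d.u₁ y) ∧
        (∀ x : E3, d.u₀ x ≠ 0 ∨ d.u₁ x ≠ 0 → L / 2 ≤ ‖x‖ ∧ ‖x‖ ≤ 20 * L) ∧
        (∀ x : E3, L ≤ ‖x‖ → ‖x‖ ≤ 10 * L →
          d.u₀ x = ε₀ ^ (-(1 / 4) : ℝ) * ‖x‖ ^ (-expα p μ - 1) ∧
          d.u₁ x = ε₀ ^ (-(1 / 2) : ℝ) * ‖x‖ ^ (-expα p μ - 2)) ∧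
        xNorm p R ψ d ≤ ENNReal.ofReal (ε₀⁻¹ * ε) ∧
        lifespan Φ F d ≤ ENNReal.ofReal (3 * L) ∧
        ∀ T > 0, ∀ u : ST → ℝ, IsSolutionOn Φ F d (outgoingRegion M L T) u →
          (∀ s x y, (s, x) ∈ outgoingRegion M L T → ‖x‖ = ‖y‖ → u (s, x) = u (s, y)) →
          (∀ z ∈ outgoingRegion M L T, 0 < u z) ∧ T ≤ 3 * L := by
    rintro ε ⟨he0, he1⟩ μ ⟨hμ0, hμ1⟩ L hL
    have hδμ : 0 < δ - μ := by linarith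
    have hNμ : expN p μ = p * (p - 1) / (δ - μ) := rfl
    -- Hence L ≥ ε₀^{-N} ≥ Λ for all admissible ε and μ at once.
    have hNN : N ≤ expN p μ := by
      rw [hNμ, hN]
      exact div_le_div_of_nonneg_left (by positivity) hδμ (by linarith)
    have hLΛ : Λ ≤ L := by
      rw [hL]
      calc Λ ≤ ε₀ ^ (-N) := hεΛ
        _ ≤ ε ^ (-N) := Real.rpow_le_rpow_of_nonpos he0 he1.le (by linarith)
        _ ≤ ε ^ (-expN p μ) :=
          Real.rpow_le_rpow_of_exponent_ge he0 (by linarith) (by linarith)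
    obtain ⟨hfar2, hfar, hL4, hLk, hLR, hLr, hL1⟩ := hΛ L hLΛ
    have hL0 : 0 < L := by linarith
    set α := expα p μ with hα
    have hα1 : 1 / p - α = -((δ - μ) / (p * (p - 1))) := one_div_sub_expα hp
    have hα0 : 0 ≤ α := by
      have h1 : 0 < 1 / p := by positivity
      have h2 : 0 < (δ - μ) / (p * (p - 1)) := by positivity
      linarith
    have hαk : α ≤ k - 1 := by
      have : 0 < μ / (p * (p - 1)) := by positivity
      rw [hα, expα, ← hk]
      linarith
    have hLε : L ^ (1 / p - α) = ε := by
      rw [hL, ← Real.rpow_mul he0.le, hα1, hNμ]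
      have : -(p * (p - 1) / (δ - μ)) * -((δ - μ) / (p * (p - 1))) = 1 := by field_simp
      rw [this, Real.rpow_one]
    set a₀ := ε₀ ^ (-(1 / 4) : ℝ) with ha₀
    have ha₀0 : 0 < a₀ := Real.rpow_pos_of_pos hε0 _
    set d := powerData hL0 hLr a₀ (ε₀ ^ (-(1 / 2) : ℝ)) α with hd
    have hdata : ∀ x : E3, L ≤ ‖x‖ → ‖x‖ ≤ 10 * L →
        d.u₀ x = a₀ * ‖x‖ ^ (-α - 1) ∧ d.u₁ x = ε₀ ^ (-(1 / 2) : ℝ) * ‖x‖ ^ (-α - 2) := by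
      intro x h1 h2
      rw [show -α - 1 = -(α + 1) by ring, show -α - 2 = -(α + 2) by ring]
      exact ⟨scaledPower_eq hL0 h1 h2, scaledPower_eq hL0 h1 h2⟩
    have hradial : ∀ x y : E3, ‖x‖ = ‖y‖ → d.u₀ x = d.u₀ y ∧ d.u₁ x = d.u₁ y := by
      intro x y hxy
      have h : ∀ a β, scaledPower L a β x = scaledPower L a β y := fun a β => by
        rw [scaledPower, scaledPower, shellPower, shellPower, norm_inv_smul hL0, norm_inv_smul hL0,
          hxy]
      exact ⟨h _ _, h _ _⟩
    have hsupp : ∀ x : E3, d.u₀ x ≠ 0 ∨ d.u₁ x ≠ 0 → L / 2 ≤ ‖x‖ ∧ ‖x‖ ≤ 20 * L := by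
      rintro x (hx | hx)
      · exact norm_of_mem_tsupport_scaledPower hL0 (subset_tsupport _ hx)
      · exact norm_of_mem_tsupport_scaledPower hL0 (subset_tsupport _ hx)
    have hblow : ∀ T > 0, ∀ u : ST → ℝ, IsSolutionOn Φ F d (outgoingRegion M L T) u →
        (∀ s x y, (s, x) ∈ outgoingRegion M L T → ‖x‖ = ‖y‖ → u (s, x) = u (s, y)) →
        (∀ z ∈ outgoingRegion M L T, 0 < u z) ∧ T ≤ 3 * L := by
      intro T _ u hu hrad
      refine blowup_outgoingRegion hM hFc hp hkp hb0 hbp hFp hfar hL4 hLk hα0 hαk ?_ ?_ hdata hu hrad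
      · linarith [le_max_left (10 ^ k * b + 1) (10 ^ (k + 1) * b * k)]
      · rw [hhalf]
        have h1 := (le_max_right (10 ^ k * b + 1) (10 ^ (k + 1) * b * k)).trans hεb
        nlinarith
    refine ⟨d, hradial, hsupp, hdata, ?_, ?_, hblow⟩
    · refine (hC hL0 hLr a₀ (ε₀ ^ (-(1 / 2) : ℝ)) α hL1 hLR ⟨hα0, hαk⟩).trans
        (ENNReal.ofReal_le_ofReal ?_)
      rw [hLε, abs_of_pos ha₀0, abs_of_pos (Real.rpow_pos_of_pos hε0 _)]
      refine mul_le_mul_of_nonneg_right ?_ he0.le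
      have h1 : a₀ ≤ ε₀ ^ (-(1 / 2) : ℝ) :=
        Real.rpow_le_rpow_of_exponent_ge hε0 hε11.le (by norm_num)
      calc C * (a₀ + ε₀ ^ (-(1 / 2) : ℝ))
          ≤ C * (ε₀ ^ (-(1 / 2) : ℝ) + ε₀ ^ (-(1 / 2) : ℝ)) := by gcongr
        _ = 2 * C * ε₀ ^ (-(1 / 2) : ℝ) := by ring
        _ ≤ ε₀ ^ (-(1 / 2) : ℝ) * ε₀ ^ (-(1 / 2) : ℝ) := by gcongr
        _ = ε₀⁻¹ := hone.symm
    · refine lifespan_le_of_radial hr₀ hr₀M (L := L) (L' := L / 2) hradial hfar2.field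
        (fun x hx => ?_) fun T hT u hu hrad => (hblow T hT u hu hrad).2
      by_contra hn
      rw [not_and_or] at hn
      linarith [(hsupp x hn).1]
  refine ⟨ε₀, hε0, hε11, by linarith, ?_, 1 / 4, 1 / 2, by norm_num, by norm_num, by norm_num, key⟩
  rintro ε ⟨he0, he1⟩
  -- The data with parameter ε₀ε have norm at most ε₀⁻¹(ε₀ε) = ε; this rescaling produces the factor
  -- ε₀^{-N} in the constant.
  have hεε : ε₀ * ε ∈ Ioo 0 ε₀ := ⟨by positivity, by nlinarith⟩
  have hle : ∀ μ ∈ Ioo 0 ε₀, lifespanOfSize p R ψ Φ F ε ≤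
      ENNReal.ofReal (3 * (ε₀ * ε) ^ (-expN p μ)) := by
    intro μ hμ
    obtain ⟨d, _, _, _, hx, hl, _⟩ := key _ hεε μ hμ _ rfl
    rw [inv_mul_cancel_left₀ hε0.ne'] at hx
    exact (iInf₂_le d hx).trans hl
  -- The left side of `hle` does not involve μ, so μ → 0 gives the sharp exponent N.
  have hcont : Tendsto (fun μ => ENNReal.ofReal (3 * (ε₀ * ε) ^ (-expN p μ))) (𝓝[>] 0)
      (𝓝 (ENNReal.ofReal (3 * (ε₀ * ε) ^ (-expN p 0)))) := by
    have h1 : ContinuousAt (fun μ => p * (p - 1) / (δ - μ)) 0 :=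
      continuousAt_const.div (continuousAt_const.sub continuousAt_id) (by simpa using hδ0.ne')
    have h2 : ContinuousAt (fun μ => 3 * (ε₀ * ε) ^ (-expN p μ)) 0 :=
      continuousAt_const.mul (continuousAt_const.rpow h1.neg (Or.inl hεε.1.ne'))
    exact ((ENNReal.continuous_ofReal.continuousAt.comp h2).tendsto).mono_left nhdsWithin_le_nhds
  have hfin := ge_of_tendsto hcont (by
    filter_upwards [Ioo_mem_nhdsGT hε0] with μ hμ
    exact hle μ hμ)
  refine hfin.trans (le_of_eq ?_)
  rw [show expN p 0 = N by rw [expN, sub_zero], Real.mul_rpow hε0.le he0.le, mul_assoc]
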